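/- Let $n\ge 2$ and let $\mathcal S$ be the manifold of faithful density operators on $\mathbb C^n$, i.e. of positive definite Hermitian $n\times n$ matrices of trace $1$, an open subset of the real affine space of Hermitian matrices of trace $1$; its tangent spaces consist of the traceless Hermitian matrices. For $\alpha\in\mathbb R\setminus\{0,1\}$ and $\rho,\sigma\in\mathcal S$ put $$D_\alpha(\rho\|\sigma)=\frac{1}{\alpha(\alpha-1)}\log\operatorname{Tr}\left(\sigma^{\frac{1-\alpha}{2\alpha}}\,\rho\,\sigma^{\frac{1-\alpha}{2\alpha}}\right)^{\alpha},\qquad D_1(\rho\|\sigma)=\lim_{\alpha\to1}D_\alpha(\rho\|\sigma).$$ The limit exists and $D_1(\rho\|\sigma)=\operatorname{Tr}\{\rho(\log\rho-\log\sigma)\}$ is the Umegaki relative entropy. For $\alpha\in\mathbb R\setminus\{0\}$ and smooth vector fields $X,Y,Z$ on $\mathcal S$ define $g^{(D_\alpha)}$, $\nabla^{(D_\alpha)}$, $\nabla^{(D_\alpha)*}$ by $$g^{(D_\alpha)}(X,Y)=X_\rho Y_\rho D_\alpha(\rho\|\sigma)\big|_{\sigma=\rho},$$ $$g^{(D_\alpha)}(\nabla^{(D_\alpha)}_XY,Z)=-X_\rho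 Y_\rho Z_\sigma D_\alpha(\rho\|\sigma)\big|_{\sigma=\rho},\qquad g^{(D_\alpha)}(\nabla^{(D_\alpha)*}_XY,Z)=-X_\sigma Y_\sigma Z_\rho D_\alpha(\rho\|\sigma)\big|_{\sigma=\rho},$$ where the index says on which argument a vector field acts. These are a Riemannian metric and two affine connections on $\mathcal S$ with $X g^{(D_\alpha)}(Y,Z)=g^{(D_\alpha)}(\nabla^{(D_\alpha)}_XY,Z)+g^{(D_\alpha)}(Y,\nabla^{(D_\alpha)*}_XZ)$, and the quantum statistical manifold $(\mathcal S,g^{(D_\alpha)},\nabla^{(D_\alpha)},\nabla^{(D_\alpha)*})$ is dually flat (the torsion and the curvature of both connections vanish identically) if and only if $\alpha=1$. -/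

import Mathlib

open Filter Topology
open scoped ContDiff ComplexOrder Matrix.Norms.L2Operator

noncomputable section

namespace InfoGeom

/-! Information geometry of an open subset `U` of a real normed space `E` (a manifold with one
global chart).  Functions and vector fields on `U` are maps defined on all of `E` of which only the
restriction to `U` matters; a vector field is smooth when it is `C^∞` on `U`. -/

section Geometry

variable {E : Type*} [NormedAddCommGroup E] [NormedSpace ℝ E]

/-- The function `X f`: the derivative of `f` along the vector field `X`. -/
def along (X : E → E) (f : E → ℝ) : E → ℝ := fun x => fderiv ℝ f x (X x)

/-- `g` is a Riemannian metric on `U`: a symmetric, positive definite form on smooth vector fields,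
bilinear over the smooth functions, with smooth values. -/
structure IsRiemannianMetric (U : Set E) (g : (E → E) → (E → E) → E → ℝ) : Prop where
  smooth : ∀ X Y, ContDiffOn ℝ ∞ X U → ContDiffOn ℝ ∞ Y U → ContDiffOn ℝ ∞ (g X Y) U
  symm : ∀ X Y, ContDiffOn ℝ ∞ X U → ContDiffOn ℝ ∞ Y U → ∀ x ∈ U, g X Y x = g Y X x
  add : ∀ X X' Y, ContDiffOn ℝ ∞ X U → ContDiffOn ℝ ∞ X' U → ContDiffOn ℝ ∞ Y U →
    ∀ x ∈ U, g (X + X') Y x = g X Y x + g X' Y x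
  smul : ∀ (f : E → ℝ) X Y, ContDiffOn ℝ ∞ f U → ContDiffOn ℝ ∞ X U → ContDiffOn ℝ ∞ Y U →
    ∀ x ∈ U, g (f • X) Y x = f x * g X Y x
  pos : ∀ X, ContDiffOn ℝ ∞ X U → ∀ x ∈ U, X x ≠ 0 → 0 < g X X x

/-- `C X Y = ∇_X Y` is an affine connection on `U` (Koszul's axioms). -/
structure IsAffineConnection (U : Set E) (C : (E → E) → (E → E) → E → E) : Prop where
  smooth : ∀ X Y, ContDiffOn ℝ ∞ X U → ContDiffOn ℝ ∞ Y U → ContDiffOn ℝ ∞ (C X Y) U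
  add_left : ∀ X X' Y, ContDiffOn ℝ ∞ X U → ContDiffOn ℝ ∞ X' U → ContDiffOn ℝ ∞ Y U →
    ∀ x ∈ U, C (X + X') Y x = C X Y x + C X' Y x
  smul_left : ∀ (f : E → ℝ) X Y, ContDiffOn ℝ ∞ f U → ContDiffOn ℝ ∞ X U →
    ContDiffOn ℝ ∞ Y U → ∀ x ∈ U, C (f • X) Y x = f x • C X Y x
  add_right : ∀ X Y Y', ContDiffOn ℝ ∞ X U → ContDiffOn ℝ ∞ Y U → ContDiffOn ℝ ∞ Y' U →
    ∀ x ∈ U, C X (Y + Y') x = C X Y x + C X Y' x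
  leibniz : ∀ (f : E → ℝ) X Y, ContDiffOn ℝ ∞ f U → ContDiffOn ℝ ∞ X U →
    ContDiffOn ℝ ∞ Y U → ∀ x ∈ U, C X (f • Y) x = along X f x • Y x + f x • C X Y x

/-- The torsion `T(X, Y) = ∇_X Y - ∇_Y X - [X, Y]`. -/
def torsion (C : (E → E) → (E → E) → E → E) (X Y : E → E) : E → E :=
  C X Y - C Y X - VectorField.lieBracket ℝ X Y

/-- The curvature `R(X, Y) Z = ∇_X ∇_Y Z - ∇_Y ∇_X Z - ∇_[X, Y] Z`. -/
def curvature (C : (E → E) → (E → E) → E → E) (X Y Z : E → E) : E → E :=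
  C X (C Y Z) - C Y (C X Z) - C (VectorField.lieBracket ℝ X Y) Z

/-- A connection is flat on `U` when its torsion and its curvature vanish identically. -/
def IsFlat (U : Set E) (C : (E → E) → (E → E) → E → E) : Prop :=
  (∀ X Y, ContDiffOn ℝ ∞ X U → ContDiffOn ℝ ∞ Y U → ∀ x ∈ U, torsion C X Y x = 0) ∧
  (∀ X Y Z, ContDiffOn ℝ ∞ X U → ContDiffOn ℝ ∞ Y U → ContDiffOn ℝ ∞ Z U →
    ∀ x ∈ U, curvature C X Y Z x = 0)

/-- `(g, ∇, ∇*)` is a dualistic structure on `U`: a Riemannian metric and two affine connections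
with `X g(Y, Z) = g(∇_X Y, Z) + g(Y, ∇*_X Z)`. -/
structure IsDualistic (U : Set E) (g : (E → E) → (E → E) → E → ℝ)
    (C C' : (E → E) → (E → E) → E → E) : Prop where
  metric : IsRiemannianMetric U g
  connection : IsAffineConnection U C
  connection' : IsAffineConnection U C'
  dual : ∀ X Y Z, ContDiffOn ℝ ∞ X U → ContDiffOn ℝ ∞ Y U → ContDiffOn ℝ ∞ Z U →
    ∀ x ∈ U, along X (g Y Z) x = g (C X Y) Z x + g Y (C' X Z) x

/-- `(U, g, ∇, ∇*)` is dually flat: a dualistic structure both of whose connections are flat. -/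
structure IsDuallyFlat (U : Set E) (g : (E → E) → (E → E) → E → ℝ)
    (C C' : (E → E) → (E → E) → E → E) : Prop extends IsDualistic U g C C' where
  flat : IsFlat U C
  flat' : IsFlat U C'

/-! Eguchi's construction from a divergence `D p q`. -/

/-- `D((XY)_p ‖ q)` at `p = q = x`. -/
def eguchiMetric (D : E → E → ℝ) (X Y : E → E) (x : E) : ℝ :=
  along X (along Y fun p => D p x) x

/-- `D((XY)_p ‖ (Z)_q)` at `p = q = x`: first `Z` acts on `q`, where `q` is then set to `x`, and
next `Y` and `X` act on `p`. -/
def jetXYZ (D : E → E → ℝ) (X Y Z : E → E) (x : E) : ℝ :=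
  along X (along Y fun p => along Z (fun q => D p q) x) x

/-- The vector field `W` on `U` with `g(W, Z) = φ(Z)` for all `Z` (it is unique on `U` when `g` is a
Riemannian metric). -/
def representing (U : Set E) (g : (E → E) → (E → E) → E → ℝ) (φ : (E → E) → E → ℝ) : E → E :=
  open Classical in
  if h : ∃ W : E → E, ContDiffOn ℝ ∞ W U ∧
      ∀ Z, ContDiffOn ℝ ∞ Z U → ∀ x ∈ U, g W Z x = φ Z x then h.choose else 0

/-- The connection `∇` with `g(∇_X Y, Z) = -D((XY)_p ‖ (Z)_q)` at `p = q`. -/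
def eguchiConnection (U : Set E) (D : E → E → ℝ) (X Y : E → E) : E → E :=
  representing U (eguchiMetric D) fun Z x => -jetXYZ D X Y Z x

/-- The connection `∇*` with `g(∇*_X Y, Z) = -D((Z)_p ‖ (XY)_q)` at `p = q`. -/
def eguchiDualConnection (U : Set E) (D : E → E → ℝ) (X Y : E → E) : E → E :=
  representing U (eguchiMetric D) fun Z x => -jetXYZ (fun q p => D p q) X Y Z x

end Geometry

section Quantum

/-- The faithful density operators on `ℂⁿ`. -/
def stateSpace (n : ℕ) : Set (Matrix (Fin n) (Fin n) ℂ) := {ρ | ρ.PosDef ∧ ρ.trace = 1}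

/-- The real vector space of traceless Hermitian matrices, the tangent space of `stateSpace n`
at each of its points. -/
def Tangent (n : ℕ) : Submodule ℝ (Matrix (Fin n) (Fin n) ℂ) where
  carrier := {A | A.IsHermitian ∧ A.trace = 0}
  add_mem' := fun ha hb => ⟨ha.1.add hb.1, by simp [Matrix.trace_add, ha.2, hb.2]⟩
  zero_mem' := by simp
  smul_mem' := fun c A hA => ⟨by
    have := hA.1
    simp [Matrix.IsHermitian, Matrix.conjTranspose_smul, this.eq], by
    simp [Matrix.trace_smul, hA.2]⟩

/-- The point `I / n + x` with coordinate `x` in the affine hyperplane of Hermitian matrices with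
trace one. -/
def toMatrix {n : ℕ} (x : Tangent n) : Matrix (Fin n) (Fin n) ℂ :=
  (n : ℂ)⁻¹ • (1 : Matrix (Fin n) (Fin n) ℂ) + (x : Matrix (Fin n) (Fin n) ℂ)

/-- The state space in the global affine chart `toMatrix`, an open subset of `Tangent n`. -/
def stateDomain (n : ℕ) : Set (Tangent n) := {x | toMatrix x ∈ stateSpace n}

/-- `toMatrix` is a global parametrization of the state space. -/
theorem bijOn_toMatrix {n : ℕ} (hn : n ≠ 0) :
    Set.BijOn toMatrix (stateDomain n) (stateSpace n) := by
  refine ⟨fun x hx => hx, fun x _ y _ h => ?_, fun ρ hρ => ?_⟩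
  · exact Subtype.ext (add_left_cancel h)
  · refine ⟨⟨ρ - (n : ℂ)⁻¹ • 1, ?_, ?_⟩, ?_, ?_⟩
    · exact hρ.1.isHermitian.sub (by simp [Matrix.IsHermitian, Matrix.conjTranspose_smul])
    · have : (n : ℂ) ≠ 0 := by exact_mod_cast hn
      rw [Matrix.trace_sub, Matrix.trace_smul, hρ.2]
      simp [this]
    · simpa [stateDomain, toMatrix] using hρ
    · simp [toMatrix]

/-- The real power `A ^ s` of a positive definite matrix. -/
def mpow {n : ℕ} (A : Matrix (Fin n) (Fin n) ℂ) (s : ℝ) : Matrix (Fin n) (Fin n) ℂ :=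
  cfc (fun t : ℝ => t ^ s) A

/-- The logarithm of a positive definite matrix. -/
def mlog {n : ℕ} (A : Matrix (Fin n) (Fin n) ℂ) : Matrix (Fin n) (Fin n) ℂ :=
  cfc Real.log A

/-- The rescaled sandwiched Rényi `α`-divergence for `α ∉ {0, 1}`; on states the trace is a positive
real number. -/
def sandwichedRenyi {n : ℕ} (α : ℝ) (ρ σ : Matrix (Fin n) (Fin n) ℂ) : ℝ :=
  1 / (α * (α - 1)) *
    Real.log (mpow (mpow σ ((1 - α) / (2 * α)) * ρ * mpow σ ((1 - α) / (2 * α))) α).trace.re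

/-- The divergence `D_α` for `α ≠ 0`, extended to `α = 1` as a limit. -/
def renyiDiv {n : ℕ} (α : ℝ) (ρ σ : Matrix (Fin n) (Fin n) ℂ) : ℝ :=
  open Classical in
  if α = 1 then limUnder (𝓝[≠] (1 : ℝ)) fun β => sandwichedRenyi β ρ σ
  else sandwichedRenyi α ρ σ

/-- The Umegaki relative entropy `Tr ρ (log ρ - log σ)`. -/
def umegaki {n : ℕ} (ρ σ : Matrix (Fin n) (Fin n) ℂ) : ℝ := (ρ * (mlog ρ - mlog σ)).trace.re

/-- `D_α` in the global chart. -/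
def chartDiv (n : ℕ) (α : ℝ) (x y : Tangent n) : ℝ := renyiDiv α (toMatrix x) (toMatrix y)

/-- The metric `g^(D_α)` on the state space. -/
def renyiMetric (n : ℕ) (α : ℝ) :
    (Tangent n → Tangent n) → (Tangent n → Tangent n) → Tangent n → ℝ :=
  eguchiMetric (chartDiv n α)

/-- The connection `∇^(D_α)` on the state space. -/
def renyiConnection (n : ℕ) (α : ℝ) :
    (Tangent n → Tangent n) → (Tangent n → Tangent n) → Tangent n → Tangent n :=
  eguchiConnection (stateDomain n) (chartDiv n α)

/-- The connection `∇^(D_α)*` on the state space. -/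
def renyiDualConnection (n : ℕ) (α : ℝ) :
    (Tangent n → Tangent n) → (Tangent n → Tangent n) → Tangent n → Tangent n :=
  eguchiDualConnection (stateDomain n) (chartDiv n α)

end Quantum

end InfoGeom

end

/-!
The divergence `D_α` is a contrast function `D`, smooth on `U × U`: on the diagonal it vanishes
together with its gradient, and its second derivative in the first argument is positive definite
there. For any such `D`, Eguchi's equations define a metric and two torsion-free, mutually dual
connections (`IsContrast.isDualistic`), and the curvatures of the two connections are adjoint to
each other, so that only the curvature of `∇` matters (`IsContrast.metricAt_curvature`).

**Contrast property.** Logarithms and real powers of positive definite matrices are smooth because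
the exponential is a local diffeomorphism from the Hermitian matrices to the positive definite ones
(`contDiffAt_mlog`, `contDiffAt_mpow`). The derivative of `Tr f(N)` comes from Klein's inequality
(`hasDerivAt_trace_cfc`), and positivity of the second derivative from the monotonicity of
`f' = log` or a power (`trace_mul_deriv_cfc_pos`). Both inequalities are termwise consequences of a
double spectral sum (`exists_weights`).

**The case `α = 1`.** The trace in `D_β` equals `1` at `β = 1`, and its derivative there is the
relative entropy, which is therefore the limit (`tendsto_sandwichedRenyi`). The derivative of
`Tr ρ (log ρ - log σ)` in `ρ` is a difference of a function of `ρ` and a function of `σ`. Hence the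
third derivative that defines `∇` vanishes, `∇` is the flat affine connection of the chart, and
`∇*` is flat by duality.

**The case `α ≠ 1`.** Write `D_α = κ log Q`. The logarithm contributes only a totally symmetric term
to the curvature, so flatness is a symmetry of derivatives of `Q`
(`IsContrast.d4_quasi_symm_of_flat`), which fails at the maximally mixed state.
* For `n ≥ 3` restrict to diagonal directions, where `Q = ∑ p ^ α q ^ (1 - α)`. The symmetry applied
  to `C, C, A, A` with `A = diag(1, -1, 0, …)` and `C = diag(1, 1, -2, 0, …)` would give
  `Tr A² Tr C² = (Tr A C)²`, that is, `12 = 0` (`not_isFlat_of_three_le`).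
* For `n = 2` the diagonal gives no information. Here `Q` is even (`quasi_neg`), so the third
  derivatives vanish at the centre and flatness makes the fourth derivative, twice in each argument,
  a totally symmetric quartic form. On traceless involutions it is the classical value
  `16 α² (α - 1)²`; being constant on the circle through the Pauli matrices `Z` and `X`, it would
  take a third of that value at `(Z, Z, X, X)`. But `Q` can be differentiated in the direction `X`
  at the states `1/2 + u Z`, because the powers of a `2 × 2` matrix commute with it
  (`d2_quasi_pauliX`), and the expansion in `u` gives `16 (α - 1)² (α² + 2) / 3` instead
  (`d4_quasi_pauli`).
-/

-- instances on iterated spaces of continuous linear maps, for derivatives up to the fourth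
set_option maxSynthPendingDepth 8

noncomputable section

namespace InfoGeom

/-! ### Iterated derivatives of a smooth function on an open set -/

section Jets

variable {V : Type*} [NormedAddCommGroup V] [NormedSpace ℝ V]

/-- The second derivative `d²Φ`, as a bilinear form at each point. -/
abbrev d2 (Φ : V → ℝ) : V → V →L[ℝ] V →L[ℝ] ℝ := fderiv ℝ (fderiv ℝ Φ)

/-- The third derivative `d³Φ`; in `d3 Φ z a b c` the derivative along `c` is taken first. -/
abbrev d3 (Φ : V → ℝ) : V → V →L[ℝ] V →L[ℝ] V →L[ℝ] ℝ := fderiv ℝ (d2 Φ)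

/-- The fourth derivative `d⁴Φ`; in `d4 Φ z a b c d` the derivative along `d` is taken first. -/
abbrev d4 (Φ : V → ℝ) : V → V →L[ℝ] V →L[ℝ] V →L[ℝ] V →L[ℝ] ℝ := fderiv ℝ (d3 Φ)

variable {W : Type*} [NormedAddCommGroup W] [NormedSpace ℝ W] {Ω : Set V} {Φ : V → ℝ}

theorem smooth_fderiv {f : V → W} (hΩ : IsOpen Ω) (h : ContDiffOn ℝ ∞ f Ω) :
    ContDiffOn ℝ ∞ (fderiv ℝ f) Ω :=
  h.fderiv_of_isOpen hΩ (by simp)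

theorem differentiableAt_of_smooth {f : V → W} (hΩ : IsOpen Ω) (h : ContDiffOn ℝ ∞ f Ω) {z : V}
    (hz : z ∈ Ω) : DifferentiableAt ℝ f z :=
  (h.contDiffAt (hΩ.mem_nhds hz)).differentiableAt (by simp)

theorem fderiv_fderiv_symm {f : V → W} (hΩ : IsOpen Ω) (h : ContDiffOn ℝ ∞ f Ω) {z : V}
    (hz : z ∈ Ω) (a b : V) : fderiv ℝ (fderiv ℝ f) z a b = fderiv ℝ (fderiv ℝ f) z b a :=
  (h.contDiffAt (hΩ.mem_nhds hz)).isSymmSndFDerivAt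
    (by simpa using WithTop.coe_le_coe.2 (le_top : (2 : ℕ∞) ≤ ⊤)) a b

theorem d2_symm (hΩ : IsOpen Ω) (h : ContDiffOn ℝ ∞ Φ Ω) {z : V} (hz : z ∈ Ω) (a b : V) :
    d2 Φ z a b = d2 Φ z b a := fderiv_fderiv_symm hΩ h hz a b

/-- A symmetry of bilinear-form valued maps persists under differentiation. -/
theorem fderiv_swap_apply {f : V → V →L[ℝ] V →L[ℝ] W} (hΩ : IsOpen Ω) (h : ContDiffOn ℝ ∞ f Ω)
    {z : V} (hz : z ∈ Ω) (b c : V) (hs : ∀ y ∈ Ω, f y b c = f y c b) (a : V) :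
    fderiv ℝ f z a b c = fderiv ℝ f z a c b := by
  have hd := differentiableAt_of_smooth hΩ h hz
  have key : ∀ b c, fderiv ℝ (fun y => f y b c) z a = fderiv ℝ f z a b c := fun b c => by
    have h1 : HasFDerivAt (fun y => f y b c)
        (((ContinuousLinearMap.apply ℝ W c).comp
          (ContinuousLinearMap.apply ℝ (V →L[ℝ] W) b)).comp (fderiv ℝ f z)) z :=
      ((ContinuousLinearMap.apply ℝ W c).comp
          (ContinuousLinearMap.apply ℝ (V →L[ℝ] W) b)).hasFDerivAt (x := f z) |>.comp z hd.hasFDerivAt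
    rw [h1.fderiv]; rfl
  rw [← key b c, ← key c b]
  have : (fun y => f y b c) =ᶠ[𝓝 z] fun y => f y c b := by
    filter_upwards [hΩ.mem_nhds hz] with y hy using hs y hy
  rw [this.fderiv_eq]

theorem d3_symm_left (hΩ : IsOpen Ω) (h : ContDiffOn ℝ ∞ Φ Ω) {z : V} (hz : z ∈ Ω) (a b c : V) :
    d3 Φ z a b c = d3 Φ z b a c :=
  congrArg (· c) (fderiv_fderiv_symm hΩ (smooth_fderiv hΩ h) hz a b)

theorem d3_symm_right (hΩ : IsOpen Ω) (h : ContDiffOn ℝ ∞ Φ Ω) {z : V} (hz : z ∈ Ω) (a b c : V) :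
    d3 Φ z a b c = d3 Φ z a c b :=
  fderiv_swap_apply hΩ (smooth_fderiv hΩ (smooth_fderiv hΩ h)) hz b c
    (fun _ hy => d2_symm hΩ h hy b c) a

theorem d4_symm_left (hΩ : IsOpen Ω) (h : ContDiffOn ℝ ∞ Φ Ω) {z : V} (hz : z ∈ Ω)
    (a b c d : V) : d4 Φ z a b c d = d4 Φ z b a c d :=
  congrArg (fun L : V →L[ℝ] V →L[ℝ] ℝ => L c d)
    (fderiv_fderiv_symm hΩ (smooth_fderiv hΩ (smooth_fderiv hΩ h)) hz a b)

theorem d4_symm_mid (hΩ : IsOpen Ω) (h : ContDiffOn ℝ ∞ Φ Ω) {z : V} (hz : z ∈ Ω)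
    (a b c d : V) : d4 Φ z a b c d = d4 Φ z a c b d := by
  have := fderiv_swap_apply hΩ (smooth_fderiv hΩ (smooth_fderiv hΩ (smooth_fderiv hΩ h))) hz b c
    (fun y hy => by
      ext d; exact d3_symm_left hΩ h hy b c d) a
  exact congrArg (fun L : V →L[ℝ] ℝ => L d) this

/-- The derivative of `z ↦ f z b` along `a`, for `f` valued in linear maps. -/
theorem fderiv_apply_const {f : V → V →L[ℝ] W} {z : V} (h : DifferentiableAt ℝ f z) (a b : V) :
    fderiv ℝ (fun y => f y b) z a = fderiv ℝ f z a b := by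
  have h1 : HasFDerivAt (fun y => f y b)
      ((ContinuousLinearMap.apply ℝ W b).comp (fderiv ℝ f z)) z :=
    (ContinuousLinearMap.apply ℝ W b).hasFDerivAt.comp z h.hasFDerivAt
  rw [h1.fderiv]; rfl

theorem d4_symm_right (hΩ : IsOpen Ω) (h : ContDiffOn ℝ ∞ Φ Ω) {z : V} (hz : z ∈ Ω)
    (a b c d : V) : d4 Φ z a b c d = d4 Φ z a b d c := by
  have s3 := smooth_fderiv hΩ (smooth_fderiv hΩ (smooth_fderiv hΩ h))
  have h3 := differentiableAt_of_smooth hΩ s3 hz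
  have s : ContDiffOn ℝ ∞ (fun y => d3 Φ y b) Ω := s3.clm_apply contDiffOn_const
  have := fderiv_swap_apply hΩ s hz c d (fun y hy => d3_symm_right hΩ h hy b c d) a
  rwa [fderiv_apply_const h3] at this

/-- The derivative of `f` along a line. -/
theorem hasDerivAt_line {f : V → W} {z : V} (v : V) (h : DifferentiableAt ℝ f z) :
    HasDerivAt (fun t : ℝ => f (z + t • v)) (fderiv ℝ f z v) 0 := by
  have h1 : HasDerivAt (fun t : ℝ => z + t • v) v 0 := by
    simpa using ((hasDerivAt_id (0 : ℝ)).smul_const v).const_add z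
  have h2 : HasFDerivAt f (fderiv ℝ f z) (z + (0 : ℝ) • v) := by simpa using h.hasFDerivAt
  exact h2.comp_hasDerivAt 0 h1

end Jets

/-! ### Eguchi's construction for a smooth contrast function -/

section Eguchi

variable {E : Type*} [NormedAddCommGroup E] [NormedSpace ℝ E]

/-- `D` is a smooth contrast function on `U`: on the diagonal it vanishes together with its first
derivative, and its second derivative in the first argument is positive definite there. -/
structure IsContrast (U : Set E) (D : E → E → ℝ) : Prop where
  isOpen : IsOpen U
  smooth : ContDiffOn ℝ ∞ (Function.uncurry D) (U ×ˢ U)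
  self : ∀ x ∈ U, D x x = 0
  grad : ∀ x ∈ U, ∀ v, fderiv ℝ (Function.uncurry D) (x, x) (v, 0) = 0
  pos : ∀ x ∈ U, ∀ v, v ≠ 0 → 0 < d2 (Function.uncurry D) (x, x) (v, 0) (v, 0)

namespace IsContrast

variable {U : Set E} {D : E → E → ℝ} {W : Type*} [NormedAddCommGroup W] [NormedSpace ℝ W]

theorem isOpen_prod (h : IsContrast U D) : IsOpen (U ×ˢ U) := h.isOpen.prod h.isOpen

theorem smooth1 (h : IsContrast U D) :
    ContDiffOn ℝ ∞ (fderiv ℝ (Function.uncurry D)) (U ×ˢ U) := smooth_fderiv h.isOpen_prod h.smooth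

theorem smooth2 (h : IsContrast U D) : ContDiffOn ℝ ∞ (d2 (Function.uncurry D)) (U ×ˢ U) :=
  smooth_fderiv h.isOpen_prod h.smooth1

theorem smooth3 (h : IsContrast U D) : ContDiffOn ℝ ∞ (d3 (Function.uncurry D)) (U ×ˢ U) :=
  smooth_fderiv h.isOpen_prod h.smooth2

end IsContrast

section Slices

variable {U : Set E} {W : Type*} [NormedAddCommGroup W] [NormedSpace ℝ W] {f : E × E → W}

theorem hasFDerivAt_diag {x : E} (h : DifferentiableAt ℝ f (x, x)) :
    HasFDerivAt (fun y => f (y, y)) ((fderiv ℝ f (x, x)).comp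
      ((ContinuousLinearMap.id ℝ E).prod (ContinuousLinearMap.id ℝ E))) x :=
  HasFDerivAt.comp x (g := f) h.hasFDerivAt ((hasFDerivAt_id x).prodMk (hasFDerivAt_id x))

theorem hasFDerivAt_left {p x : E} (h : DifferentiableAt ℝ f (p, x)) :
    HasFDerivAt (fun y => f (y, x)) ((fderiv ℝ f (p, x)).comp
      (ContinuousLinearMap.inl ℝ E E)) p :=
  HasFDerivAt.comp p (g := f) h.hasFDerivAt (hasFDerivAt_prodMk_left p x)

theorem hasFDerivAt_right {p x : E} (h : DifferentiableAt ℝ f (p, x)) :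
    HasFDerivAt (fun y => f (p, y)) ((fderiv ℝ f (p, x)).comp
      (ContinuousLinearMap.inr ℝ E E)) x :=
  HasFDerivAt.comp x (g := f) h.hasFDerivAt (hasFDerivAt_prodMk_right p x)

theorem smoothOn_diag (h : ContDiffOn ℝ ∞ f (U ×ˢ U)) : ContDiffOn ℝ ∞ (fun y => f (y, y)) U :=
  h.comp (contDiff_id.prodMk contDiff_id).contDiffOn fun _ hy => ⟨hy, hy⟩

theorem fderiv_clm_apply_left {f : E × E → E × E →L[ℝ] W} {p x : E}
    (h : DifferentiableAt ℝ f (p, x)) {v : E → E × E} (hv : DifferentiableAt ℝ v p) (u : E) :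
    fderiv ℝ (fun y => f (y, x) (v y)) p u
      = fderiv ℝ f (p, x) (u, 0) (v p) + f (p, x) (fderiv ℝ v p u) := by
  rw [((hasFDerivAt_left h).clm_apply hv.hasFDerivAt).fderiv]
  simp [add_comm]

theorem fderiv_clm_apply_right {f : E × E → E × E →L[ℝ] W} {p x : E}
    (h : DifferentiableAt ℝ f (p, x)) {v : E → E × E} (hv : DifferentiableAt ℝ v x) (u : E) :
    fderiv ℝ (fun y => f (p, y) (v y)) x u
      = fderiv ℝ f (p, x) (0, u) (v x) + f (p, x) (fderiv ℝ v x u) := by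
  rw [((hasFDerivAt_right h).clm_apply hv.hasFDerivAt).fderiv]
  simp [add_comm]

theorem fderiv_prodMk_zero {Y : E → E} {x : E} (h : DifferentiableAt ℝ Y x) (u : E) :
    fderiv ℝ (fun y => (Y y, (0 : E))) x u = (fderiv ℝ Y x u, 0) := by
  rw [(h.hasFDerivAt.prodMk (hasFDerivAt_const (0 : E) x)).fderiv]; rfl

theorem fderiv_zero_prodMk {Y : E → E} {x : E} (h : DifferentiableAt ℝ Y x) (u : E) :
    fderiv ℝ (fun y => ((0 : E), Y y)) x u = (0, fderiv ℝ Y x u) := by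
  rw [((hasFDerivAt_const (0 : E) x).prodMk h.hasFDerivAt).fderiv]; rfl

end Slices

namespace IsContrast

variable {U : Set E} {D : E → E → ℝ}

theorem diff0 (h : IsContrast U D) {p q : E} (hp : p ∈ U) (hq : q ∈ U) :
    DifferentiableAt ℝ (Function.uncurry D) (p, q) :=
  differentiableAt_of_smooth h.isOpen_prod h.smooth ⟨hp, hq⟩

theorem diff1 (h : IsContrast U D) {p q : E} (hp : p ∈ U) (hq : q ∈ U) :
    DifferentiableAt ℝ (fderiv ℝ (Function.uncurry D)) (p, q) :=
  differentiableAt_of_smooth h.isOpen_prod h.smooth1 ⟨hp, hq⟩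

theorem diff2 (h : IsContrast U D) {p q : E} (hp : p ∈ U) (hq : q ∈ U) :
    DifferentiableAt ℝ (d2 (Function.uncurry D)) (p, q) :=
  differentiableAt_of_smooth h.isOpen_prod h.smooth2 ⟨hp, hq⟩

theorem diff3 (h : IsContrast U D) {p q : E} (hp : p ∈ U) (hq : q ∈ U) :
    DifferentiableAt ℝ (d3 (Function.uncurry D)) (p, q) :=
  differentiableAt_of_smooth h.isOpen_prod h.smooth3 ⟨hp, hq⟩

/-- The whole first derivative vanishes on the diagonal, since `D` vanishes there. -/
theorem grad_eq_zero (h : IsContrast U D) {x : E} (hx : x ∈ U) :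
    fderiv ℝ (Function.uncurry D) (x, x) = 0 := by
  refine ContinuousLinearMap.ext fun ⟨a, b⟩ => ?_
  have h1 := (hasFDerivAt_diag (h.diff0 hx hx)).fderiv
  have h2 : (fun y => Function.uncurry D (y, y)) =ᶠ[𝓝 x] fun _ => (0 : ℝ) := by
    filter_upwards [h.isOpen.mem_nhds hx] with y hy using h.self y hy
  have h3 : fderiv ℝ (Function.uncurry D) (x, x) (b, b) = 0 := by
    have := congrArg (· b) (h1.symm.trans h2.fderiv_eq)
    simpa using this
  have e : ((a, b) : E × E) = (b, b) + (a - b, 0) := by simp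
  rw [e, map_add, h3, h.grad x hx]; simp

theorem d2_diag (h : IsContrast U D) {x : E} (hx : x ∈ U) (a : E) :
    d2 (Function.uncurry D) (x, x) (a, a) = 0 := by
  have h1 := (hasFDerivAt_diag (h.diff1 hx hx)).fderiv
  have h2 : (fun y => fderiv ℝ (Function.uncurry D) (y, y)) =ᶠ[𝓝 x] fun _ => 0 := by
    filter_upwards [h.isOpen.mem_nhds hx] with y hy using h.grad_eq_zero hy
  have := congrArg (· a) (h1.symm.trans h2.fderiv_eq)
  simpa using this

theorem d2_right (h : IsContrast U D) {x : E} (hx : x ∈ U) (a : E) :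
    d2 (Function.uncurry D) (x, x) (0, a) = - d2 (Function.uncurry D) (x, x) (a, 0) := by
  have e : ((0, a) : E × E) = (a, a) - (a, 0) := by simp
  rw [e, map_sub, h.d2_diag hx, zero_sub]

theorem d2_comm (h : IsContrast U D) {x : E} (hx : x ∈ U) (a b : E × E) :
    d2 (Function.uncurry D) (x, x) a b = d2 (Function.uncurry D) (x, x) b a :=
  d2_symm h.isOpen_prod h.smooth ⟨hx, hx⟩ a b

/-- The metric tensor `D(uv ‖ ·)` at `x`. -/
def metricAt (D : E → E → ℝ) (x : E) : E →L[ℝ] E →L[ℝ] ℝ :=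
  (d2 (Function.uncurry D) (x, x)).bilinearComp (ContinuousLinearMap.inl ℝ E E)
    (ContinuousLinearMap.inl ℝ E E)

theorem metricAt_apply (x u v : E) :
    metricAt D x u v = d2 (Function.uncurry D) (x, x) (u, 0) (v, 0) := rfl

theorem metricAt_symm (h : IsContrast U D) {x : E} (hx : x ∈ U) (a b : E) :
    metricAt D x a b = metricAt D x b a := h.d2_comm hx _ _

theorem mixed_eq (h : IsContrast U D) {x : E} (hx : x ∈ U) (a b : E) :
    d2 (Function.uncurry D) (x, x) (a, 0) (0, b) = -metricAt D x a b := by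
  rw [h.d2_comm hx, h.d2_right hx, metricAt_apply, h.d2_comm hx (a, 0)]; rfl

theorem mixed_eq' (h : IsContrast U D) {x : E} (hx : x ∈ U) (a b : E) :
    d2 (Function.uncurry D) (x, x) (0, a) (b, 0) = -metricAt D x a b := by
  rw [h.d2_right hx]; rfl

theorem eguchiMetric_eq (h : IsContrast U D) {X Y : E → E} (hY : ContDiffOn ℝ ∞ Y U) {x : E}
    (hx : x ∈ U) : eguchiMetric D X Y x = metricAt D x (X x) (Y x) := by
  have hU := h.isOpen.mem_nhds hx
  have h1 : along Y (fun p => D p x)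
      =ᶠ[𝓝 x] fun p => fderiv ℝ (Function.uncurry D) (p, x) (Y p, 0) := by
    filter_upwards [hU] with p hp
    have := (hasFDerivAt_left (h.diff0 hp hx)).fderiv
    simp only [along]
    change fderiv ℝ (fun p => Function.uncurry D (p, x)) p (Y p) = _
    rw [this]; simp
  have hYd := differentiableAt_of_smooth h.isOpen hY hx
  rw [eguchiMetric, along, h1.fderiv_eq, fderiv_clm_apply_left (h.diff1 hx hx)
    (v := fun p => (Y p, (0 : E))) (hYd.prodMk (differentiableAt_const _)), h.grad_eq_zero hx]
  simp [metricAt_apply]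

theorem jetXYZ_eq (h : IsContrast U D) {X Y Z : E → E} (hY : ContDiffOn ℝ ∞ Y U) {x : E}
    (hx : x ∈ U) :
    jetXYZ D X Y Z x = d3 (Function.uncurry D) (x, x) (X x, 0) (Y x, 0) (0, Z x)
      - metricAt D x (fderiv ℝ Y x (X x)) (Z x) := by
  have h1 : ∀ p ∈ U, along Z (fun q => D p q) x
      = fderiv ℝ (Function.uncurry D) (p, x) (0, Z x) := fun p hp => by
    have := (hasFDerivAt_right (h.diff0 hp hx)).fderiv
    simp only [along]
    change fderiv ℝ (fun q => Function.uncurry D (p, q)) x (Z x) = _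
    rw [this]; simp
  have h2 : along Y (fun p => along Z (fun q => D p q) x)
      =ᶠ[𝓝 x] fun p => d2 (Function.uncurry D) (p, x) (Y p, 0) (0, Z x) := by
    filter_upwards [h.isOpen.mem_nhds hx] with p hp
    have e : (fun p => along Z (fun q => D p q) x)
        =ᶠ[𝓝 p] fun p => fderiv ℝ (Function.uncurry D) (p, x) (0, Z x) := by
      filter_upwards [h.isOpen.mem_nhds hp] with p hp using h1 p hp
    rw [along, e.fderiv_eq, fderiv_clm_apply_left (h.diff1 hp hx) (differentiableAt_const _)]
    simp
  have hYd := differentiableAt_of_smooth h.isOpen hY hx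
  have h3 := fderiv_clm_apply_left (h.diff2 hx hx)
    (v := fun p => (Y p, (0 : E))) (hYd.prodMk (differentiableAt_const _)) (X x)
  have h4 : DifferentiableAt ℝ (fun p => d2 (Function.uncurry D) (p, x) (Y p, 0)) x :=
    (hasFDerivAt_left (h.diff2 hx hx)).differentiableAt.clm_apply
      (hYd.prodMk (differentiableAt_const _))
  have h5 : fderiv ℝ (fun p => d2 (Function.uncurry D) (p, x) (Y p, 0) (0, Z x)) x (X x)
      = fderiv ℝ (fun p => d2 (Function.uncurry D) (p, x) (Y p, 0)) x (X x) (0, Z x) := by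
    rw [(h4.hasFDerivAt.clm_apply (hasFDerivAt_const _ x)).fderiv]; simp
  rw [jetXYZ, along, h2.fderiv_eq, h5, h3, fderiv_prodMk_zero hYd, add_apply,
    h.mixed_eq hx]
  ring

theorem jetXYZ_swap_eq (h : IsContrast U D) {X Y Z : E → E} (hY : ContDiffOn ℝ ∞ Y U) {x : E}
    (hx : x ∈ U) :
    jetXYZ (fun q p => D p q) X Y Z x
      = d3 (Function.uncurry D) (x, x) (0, X x) (0, Y x) (Z x, 0)
      - metricAt D x (fderiv ℝ Y x (X x)) (Z x) := by
  have h1 : ∀ q ∈ U, along Z (fun p => D p q) x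
      = fderiv ℝ (Function.uncurry D) (x, q) (Z x, 0) := fun q hq => by
    have := (hasFDerivAt_left (h.diff0 hx hq)).fderiv
    simp only [along]
    change fderiv ℝ (fun p => Function.uncurry D (p, q)) x (Z x) = _
    rw [this]; simp
  have h2 : along Y (fun q => along Z (fun p => D p q) x)
      =ᶠ[𝓝 x] fun q => d2 (Function.uncurry D) (x, q) (0, Y q) (Z x, 0) := by
    filter_upwards [h.isOpen.mem_nhds hx] with q hq
    have e : (fun q => along Z (fun p => D p q) x)
        =ᶠ[𝓝 q] fun q => fderiv ℝ (Function.uncurry D) (x, q) (Z x, 0) := by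
      filter_upwards [h.isOpen.mem_nhds hq] with q hq using h1 q hq
    rw [along, e.fderiv_eq, fderiv_clm_apply_right (h.diff1 hx hq) (differentiableAt_const _)]
    simp
  have hYd := differentiableAt_of_smooth h.isOpen hY hx
  have h3 := fderiv_clm_apply_right (h.diff2 hx hx)
    (v := fun p => ((0 : E), Y p)) ((differentiableAt_const _).prodMk hYd) (X x)
  have h4 : DifferentiableAt ℝ (fun q => d2 (Function.uncurry D) (x, q) (0, Y q)) x :=
    (hasFDerivAt_right (h.diff2 hx hx)).differentiableAt.clm_apply
      ((differentiableAt_const _).prodMk hYd)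
  have h5 : fderiv ℝ (fun q => d2 (Function.uncurry D) (x, q) (0, Y q) (Z x, 0)) x (X x)
      = fderiv ℝ (fun q => d2 (Function.uncurry D) (x, q) (0, Y q)) x (X x) (Z x, 0) := by
    rw [(h4.hasFDerivAt.clm_apply (hasFDerivAt_const _ x)).fderiv]; simp
  rw [jetXYZ, along, h2.fderiv_eq, h5, h3, fderiv_zero_prodMk hYd, add_apply,
    h.mixed_eq' hx]
  ring

theorem smooth_metricAt (h : IsContrast U D) [FiniteDimensional ℝ E] :
    ContDiffOn ℝ ∞ (metricAt D) U := by
  refine contDiffOn_clm_apply.2 fun u => contDiffOn_clm_apply.2 fun v => ?_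
  simp only [metricAt_apply]
  exact ((smoothOn_diag h.smooth2).clm_apply contDiffOn_const).clm_apply contDiffOn_const

theorem metricAt_pos (h : IsContrast U D) {x : E} (hx : x ∈ U) {v : E} (hv : v ≠ 0) :
    0 < metricAt D x v v := h.pos x hx v hv

theorem eq_of_metricAt (h : IsContrast U D) {x : E} (hx : x ∈ U) {u v : E}
    (huv : ∀ w, metricAt D x u w = metricAt D x v w) : u = v := by
  by_contra hne
  have := h.metricAt_pos hx (sub_ne_zero.2 hne)
  simp [huv] at this

theorem isInvertible_metricAt (h : IsContrast U D) [FiniteDimensional ℝ E] {x : E} (hx : x ∈ U) :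
    (metricAt D x).IsInvertible := by
  have inj : Function.Injective (metricAt D x).toLinearMap := fun u v huv =>
    h.eq_of_metricAt hx fun w => congrArg (fun f : E →L[ℝ] ℝ => f w) huv
  have dim : Module.finrank ℝ E = Module.finrank ℝ (E →L[ℝ] ℝ) := by
    rw [← LinearEquiv.finrank_eq (LinearMap.toContinuousLinearMap (𝕜 := ℝ) (E := E) (F' := ℝ))]
    exact Subspace.dual_finrank_eq.symm
  let e := (LinearEquiv.ofInjectiveOfFinrankEq _ inj dim).toContinuousLinearEquiv
  exact ⟨e, by ext; rfl⟩

/-- A smooth field of covectors is represented by a smooth vector field. -/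
theorem exists_representing (h : IsContrast U D) [FiniteDimensional ℝ E] {ψ : E → E →L[ℝ] ℝ}
    (hψ : ContDiffOn ℝ ∞ ψ U) :
    ∃ W : E → E, ContDiffOn ℝ ∞ W U ∧ ∀ x ∈ U, ∀ z, metricAt D x (W x) z = ψ x z := by
  refine ⟨fun x => (metricAt D x).inverse (ψ x), ?_, fun x hx z => ?_⟩
  · refine ContDiffOn.clm_apply (fun x hx => ?_) hψ
    exact ((h.isInvertible_metricAt hx).contDiffAt_map_inverse).comp_contDiffWithinAt x
      (h.smooth_metricAt x hx)
  · obtain ⟨e, he⟩ := h.isInvertible_metricAt hx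
    simp only [← he, ContinuousLinearMap.inverse_equiv]
    exact congrArg (· z) (e.apply_symm_apply (ψ x))

end IsContrast
end Eguchi

/-! ### The connections of a contrast function -/

section Connection

variable {E : Type*} [NormedAddCommGroup E] [NormedSpace ℝ E] {U : Set E} {D : E → E → ℝ}

/-- `C` is the connection with `g(C_X Y, Z) = g(dY(X), Z) - d³D(ι₁ X, ι₁ Y, ι₂ Z)` on `U`.  Eguchi's
two connections are the cases in which `ι₁` and `ι₂` are the two inclusions `E → E × E`. -/
def IsEguchi (U : Set E) (D : E → E → ℝ) (ι₁ ι₂ : E →L[ℝ] E × E)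
    (C : (E → E) → (E → E) → E → E) : Prop :=
  ∀ X Y, ContDiffOn ℝ ∞ X U → ContDiffOn ℝ ∞ Y U → ContDiffOn ℝ ∞ (C X Y) U ∧
    ∀ x ∈ U, ∀ z, IsContrast.metricAt D x (C X Y x) z
      = IsContrast.metricAt D x (fderiv ℝ Y x (X x)) z
        - d3 (Function.uncurry D) (x, x) (ι₁ (X x)) (ι₁ (Y x)) (ι₂ z)

theorem smooth_covariant {X Y : E → E} (hU : IsOpen U) (hX : ContDiffOn ℝ ∞ X U)
    (hY : ContDiffOn ℝ ∞ Y U) : ContDiffOn ℝ ∞ (fun x => fderiv ℝ Y x (X x)) U :=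
  (smooth_fderiv hU hY).clm_apply hX

theorem smooth_lieBracket {X Y : E → E} (hU : IsOpen U) (hX : ContDiffOn ℝ ∞ X U)
    (hY : ContDiffOn ℝ ∞ Y U) : ContDiffOn ℝ ∞ (VectorField.lieBracket ℝ X Y) U := by
  rw [VectorField.lieBracket_eq]
  exact (smooth_covariant hU hX hY).sub (smooth_covariant hU hY hX)

theorem along_along {X Y : E → E} {f : E → ℝ} (hU : IsOpen U)
    (hY : ContDiffOn ℝ ∞ Y U) (hf : ContDiffOn ℝ ∞ f U) {x : E} (hx : x ∈ U) :
    along X (along Y f) x = d2 f x (X x) (Y x) + fderiv ℝ f x (fderiv ℝ Y x (X x)) := by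
  have h1 := differentiableAt_of_smooth hU (smooth_fderiv hU hf) hx
  have h2 := differentiableAt_of_smooth hU hY hx
  unfold along
  rw [(h1.hasFDerivAt.clm_apply h2.hasFDerivAt).fderiv]
  simp [add_comm]

theorem along_commutator {X Y : E → E} {f : E → ℝ} (hU : IsOpen U) (hX : ContDiffOn ℝ ∞ X U)
    (hY : ContDiffOn ℝ ∞ Y U) (hf : ContDiffOn ℝ ∞ f U) {x : E} (hx : x ∈ U) :
    along X (along Y f) x - along Y (along X f) x = along (VectorField.lieBracket ℝ X Y) f x := by
  rw [along_along hU hY hf hx, along_along hU hX hf hx, d2_symm hU hf hx (X x)]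
  simp [along, VectorField.lieBracket_eq]

theorem along_congr {X : E → E} {f f' : E → ℝ} (hU : IsOpen U) (h : ∀ x ∈ U, f x = f' x) {x : E}
    (hx : x ∈ U) : along X f x = along X f' x := by
  have : f =ᶠ[𝓝 x] f' := by filter_upwards [hU.mem_nhds hx] with y hy using h y hy
  rw [along, along, this.fderiv_eq]

theorem along_add {X : E → E} {f f' : E → ℝ} (hU : IsOpen U) (hf : ContDiffOn ℝ ∞ f U)
    (hf' : ContDiffOn ℝ ∞ f' U) {x : E} (hx : x ∈ U) :
    along X (fun y => f y + f' y) x = along X f x + along X f' x := by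
  unfold along
  rw [fderiv_fun_add (differentiableAt_of_smooth hU hf hx) (differentiableAt_of_smooth hU hf' hx)]
  simp

namespace IsContrast

theorem isRiemannianMetric (h : IsContrast U D) [FiniteDimensional ℝ E] :
    IsRiemannianMetric U (eguchiMetric D) where
  smooth X Y hX hY := by
    refine ContDiffOn.congr ?_ fun x hx => h.eguchiMetric_eq hY hx
    exact (h.smooth_metricAt.clm_apply hX).clm_apply hY
  symm X Y hX hY x hx := by
    rw [h.eguchiMetric_eq hY hx, h.eguchiMetric_eq hX hx, h.metricAt_symm hx]
  add X X' Y _ _ hY x hx := by simp [h.eguchiMetric_eq hY hx]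
  smul f X Y _ _ hY x hx := by simp [h.eguchiMetric_eq hY hx]
  pos X hX x hx hne := by
    rw [h.eguchiMetric_eq hX hx]; exact h.metricAt_pos hx hne

theorem representing_spec (h : IsContrast U D) [FiniteDimensional ℝ E]
    {φ : (E → E) → E → ℝ} {ψ : E → E →L[ℝ] ℝ} (hψ : ContDiffOn ℝ ∞ ψ U)
    (hφ : ∀ Z, ContDiffOn ℝ ∞ Z U → ∀ x ∈ U, φ Z x = ψ x (Z x)) :
    ContDiffOn ℝ ∞ (representing U (eguchiMetric D) φ) U ∧
      ∀ x ∈ U, ∀ z, metricAt D x (representing U (eguchiMetric D) φ x) z = ψ x z := by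
  have hex : ∃ W : E → E, ContDiffOn ℝ ∞ W U ∧
      ∀ Z, ContDiffOn ℝ ∞ Z U → ∀ x ∈ U, eguchiMetric D W Z x = φ Z x := by
    obtain ⟨W, hW, hW'⟩ := h.exists_representing hψ
    exact ⟨W, hW, fun Z hZ x hx => by rw [h.eguchiMetric_eq hZ hx, hW' x hx, hφ Z hZ x hx]⟩
  have hs := hex.choose_spec
  rw [representing, dif_pos hex]
  refine ⟨hs.1, fun x hx z => ?_⟩
  have := hs.2 (fun _ => z) contDiffOn_const x hx
  rwa [h.eguchiMetric_eq contDiffOn_const hx, hφ _ contDiffOn_const x hx] at this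

theorem smooth_covector (h : IsContrast U D) [FiniteDimensional ℝ E] (ι₁ ι₂ : E →L[ℝ] E × E)
    {X Y : E → E} (hX : ContDiffOn ℝ ∞ X U) (hY : ContDiffOn ℝ ∞ Y U) :
    ContDiffOn ℝ ∞ (fun x => metricAt D x (fderiv ℝ Y x (X x))
      - (d3 (Function.uncurry D) (x, x) (ι₁ (X x)) (ι₁ (Y x))).comp ι₂) U := by
  refine (h.smooth_metricAt.clm_apply (smooth_covariant h.isOpen hX hY)).sub ?_
  refine ContDiffOn.clm_comp ?_ contDiffOn_const
  exact ((smoothOn_diag h.smooth3).clm_apply (ι₁.contDiff.comp_contDiffOn hX)).clm_apply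
    (ι₁.contDiff.comp_contDiffOn hY)

theorem isEguchi_connection (h : IsContrast U D) [FiniteDimensional ℝ E] :
    IsEguchi U D (ContinuousLinearMap.inl ℝ E E) (ContinuousLinearMap.inr ℝ E E)
      (eguchiConnection U D) := fun X Y hX hY =>
  h.representing_spec (h.smooth_covector _ _ hX hY) fun Z _ x hx => by
    rw [h.jetXYZ_eq hY hx]; simp

theorem isEguchi_dualConnection (h : IsContrast U D) [FiniteDimensional ℝ E] :
    IsEguchi U D (ContinuousLinearMap.inr ℝ E E) (ContinuousLinearMap.inl ℝ E E)
      (eguchiDualConnection U D) := fun X Y hX hY =>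
  h.representing_spec (h.smooth_covector _ _ hX hY) fun Z _ x hx => by
    rw [h.jetXYZ_swap_eq hY hx]; simp

theorem metric_connection (h : IsContrast U D) [FiniteDimensional ℝ E] {X Y Z : E → E}
    (hX : ContDiffOn ℝ ∞ X U) (hY : ContDiffOn ℝ ∞ Y U) (hZ : ContDiffOn ℝ ∞ Z U) {x : E}
    (hx : x ∈ U) : eguchiMetric D (eguchiConnection U D X Y) Z x = -jetXYZ D X Y Z x := by
  rw [h.eguchiMetric_eq hZ hx, (h.isEguchi_connection X Y hX hY).2 x hx, h.jetXYZ_eq hY hx]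
  simp

theorem metric_dualConnection (h : IsContrast U D) [FiniteDimensional ℝ E] {X Y Z : E → E}
    (hX : ContDiffOn ℝ ∞ X U) (hY : ContDiffOn ℝ ∞ Y U) (hZ : ContDiffOn ℝ ∞ Z U) {x : E}
    (hx : x ∈ U) :
    eguchiMetric D (eguchiDualConnection U D X Y) Z x = -jetXYZ (fun q p => D p q) X Y Z x := by
  rw [h.eguchiMetric_eq hZ hx, (h.isEguchi_dualConnection X Y hX hY).2 x hx,
    h.jetXYZ_swap_eq hY hx]
  simp

end IsContrast

variable {ι₁ ι₂ : E →L[ℝ] E × E} {C C' : (E → E) → (E → E) → E → E}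

theorem IsEguchi.isAffineConnection (hC : IsEguchi U D ι₁ ι₂ C) (h : IsContrast U D) :
    IsAffineConnection U C where
  smooth X Y hX hY := (hC X Y hX hY).1
  add_left X X' Y hX hX' hY x hx := h.eq_of_metricAt hx fun z => by
    rw [(hC (X + X') Y (hX.add hX') hY).2 x hx, map_add, add_apply, (hC _ _ hX hY).2 x hx,
      (hC _ _ hX' hY).2 x hx]
    simp only [Pi.add_apply, map_add, add_apply]
    ring
  smul_left f X Y hf hX hY x hx := h.eq_of_metricAt hx fun z => by
    rw [(hC _ _ (hf.smul hX) hY).2 x hx, map_smul, smul_apply, (hC _ _ hX hY).2 x hx]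
    simp only [Pi.smul_apply', map_smul, smul_apply, smul_eq_mul]
    ring
  add_right X Y Y' hX hY hY' x hx := h.eq_of_metricAt hx fun z => by
    rw [(hC X (Y + Y') hX (hY.add hY')).2 x hx, map_add, add_apply, (hC _ _ hX hY).2 x hx,
      (hC _ _ hX hY').2 x hx, fderiv_add (differentiableAt_of_smooth h.isOpen hY hx)
        (differentiableAt_of_smooth h.isOpen hY' hx)]
    simp only [Pi.add_apply, map_add, add_apply]
    ring
  leibniz f X Y hf hX hY x hx := h.eq_of_metricAt hx fun z => by
    rw [(hC _ _ hX (hf.smul hY)).2 x hx, map_add, add_apply, map_smul, map_smul, smul_apply,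
      smul_apply, (hC _ _ hX hY).2 x hx, fderiv_smul (differentiableAt_of_smooth h.isOpen hf hx)
        (differentiableAt_of_smooth h.isOpen hY hx)]
    simp only [Pi.smul_apply', map_add, map_smul, add_apply, smul_apply, smul_eq_mul, along,
      ContinuousLinearMap.smulRight_apply]
    ring

theorem IsEguchi.torsion_eq_zero (hC : IsEguchi U D ι₁ ι₂ C) (h : IsContrast U D)
    {X Y : E → E} (hX : ContDiffOn ℝ ∞ X U) (hY : ContDiffOn ℝ ∞ Y U) {x : E} (hx : x ∈ U) :
    torsion C X Y x = 0 := h.eq_of_metricAt hx fun z => by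
  simp only [torsion, Pi.sub_apply, VectorField.lieBracket_eq, map_sub, sub_apply, map_zero,
    zero_apply]
  rw [(hC X Y hX hY).2 x hx, (hC Y X hY hX).2 x hx,
    d3_symm_left h.isOpen_prod h.smooth ⟨hx, hx⟩ (ι₁ (X x))]
  ring

namespace IsContrast

/-- The derivative of the metric tensor splits into the two third derivatives that define Eguchi's
connections. -/
theorem d3_diag (h : IsContrast U D) {x : E} (hx : x ∈ U) (a b c : E) :
    d3 (Function.uncurry D) (x, x) (a, a) (b, 0) (c, 0)
      = -d3 (Function.uncurry D) (x, x) (a, 0) (b, 0) (0, c)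
        - d3 (Function.uncurry D) (x, x) (0, a) (0, c) (b, 0) := by
  have h0 : d3 (Function.uncurry D) (x, x) (a, a) (c, c) (b, 0) = 0 := by
    have e : (fun y => d2 (Function.uncurry D) (y, y) (c, c)) =ᶠ[𝓝 x] fun _ => 0 := by
      filter_upwards [h.isOpen.mem_nhds hx] with y hy using h.d2_diag hy c
    have h1 := ((hasFDerivAt_diag (h.diff2 hx hx)).clm_apply
      (hasFDerivAt_const ((c, c) : E × E) x)).fderiv
    have h2 := congrArg (fun L : E →L[ℝ] E × E →L[ℝ] ℝ => L a (b, 0)) (h1.symm.trans e.fderiv_eq)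
    simpa using h2
  have e1 : ((c, c) : E × E) = (c, 0) + (0, c) := by simp
  have e2 : ((a, a) : E × E) = (a, 0) + (0, a) := by simp
  have s : ∀ u v w, d3 (Function.uncurry D) (x, x) u v w = d3 (Function.uncurry D) (x, x) u w v :=
    fun u v w => d3_symm_right h.isOpen_prod h.smooth ⟨hx, hx⟩ u v w
  rw [e1, map_add, add_apply] at h0
  have h3 : d3 (Function.uncurry D) (x, x) (a, a) (0, c) (b, 0)
      = d3 (Function.uncurry D) (x, x) (a, 0) (b, 0) (0, c)
        + d3 (Function.uncurry D) (x, x) (0, a) (0, c) (b, 0) := by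
    rw [e2, map_add, add_apply, add_apply, s _ (b, 0)]
  rw [s _ (b, 0)]
  linarith

/-- The duality `X g(Y, Z) = g(∇_X Y, Z) + g(Y, ∇*_X Z)`. -/
theorem along_metricAt (h : IsContrast U D) [FiniteDimensional ℝ E]
    (hC : IsEguchi U D (ContinuousLinearMap.inl ℝ E E) (ContinuousLinearMap.inr ℝ E E) C)
    (hC' : IsEguchi U D (ContinuousLinearMap.inr ℝ E E) (ContinuousLinearMap.inl ℝ E E) C')
    {X Y Z : E → E} (hX : ContDiffOn ℝ ∞ X U) (hY : ContDiffOn ℝ ∞ Y U)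
    (hZ : ContDiffOn ℝ ∞ Z U) {x : E} (hx : x ∈ U) :
    along X (fun y => metricAt D y (Y y) (Z y)) x
      = metricAt D x (C X Y x) (Z x) + metricAt D x (Y x) (C' X Z x) := by
  have hYd := (differentiableAt_of_smooth h.isOpen hY hx).hasFDerivAt
  have hZd := (differentiableAt_of_smooth h.isOpen hZ hx).hasFDerivAt
  have h1 : HasFDerivAt (fun y => d2 (Function.uncurry D) (y, y) (Y y, 0) (Z y, 0)) _ x :=
    ((hasFDerivAt_diag (h.diff2 hx hx)).clm_apply
      (hYd.prodMk (hasFDerivAt_const (0 : E) x))).clm_apply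
      (hZd.prodMk (hasFDerivAt_const (0 : E) x))
  have h2 : along X (fun y => metricAt D y (Y y) (Z y)) x
      = d3 (Function.uncurry D) (x, x) (X x, X x) (Y x, 0) (Z x, 0)
        + metricAt D x (fderiv ℝ Y x (X x)) (Z x) + metricAt D x (Y x) (fderiv ℝ Z x (X x)) := by
    unfold along
    simp only [metricAt_apply]
    rw [h1.fderiv]
    simp
    ring
  rw [h2, h.d3_diag hx, (hC X Y hX hY).2 x hx, h.metricAt_symm hx (Y x) (C' X Z x),
    (hC' X Z hX hZ).2 x hx, h.metricAt_symm hx (Y x) (fderiv ℝ Z x (X x))]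
  simp
  ring

theorem isDualistic (h : IsContrast U D) [FiniteDimensional ℝ E] :
    IsDualistic U (eguchiMetric D) (eguchiConnection U D) (eguchiDualConnection U D) where
  metric := h.isRiemannianMetric
  connection := h.isEguchi_connection.isAffineConnection h
  connection' := h.isEguchi_dualConnection.isAffineConnection h
  dual X Y Z hX hY hZ x hx := by
    have hZ' := (h.isEguchi_dualConnection X Z hX hZ).1
    rw [h.eguchiMetric_eq hZ hx, h.eguchiMetric_eq hZ' hx,
      ← h.along_metricAt h.isEguchi_connection h.isEguchi_dualConnection hX hY hZ hx]
    exact along_congr h.isOpen (fun y hy => h.eguchiMetric_eq hZ hy) hx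

/-- The curvatures of dual connections are adjoint up to sign. -/
theorem metricAt_curvature (h : IsContrast U D) [FiniteDimensional ℝ E]
    (hC : IsEguchi U D (ContinuousLinearMap.inl ℝ E E) (ContinuousLinearMap.inr ℝ E E) C)
    (hC' : IsEguchi U D (ContinuousLinearMap.inr ℝ E E) (ContinuousLinearMap.inl ℝ E E) C')
    {X Y Z W : E → E} (hX : ContDiffOn ℝ ∞ X U) (hY : ContDiffOn ℝ ∞ Y U)
    (hZ : ContDiffOn ℝ ∞ Z U) (hW : ContDiffOn ℝ ∞ W U) {x : E} (hx : x ∈ U) :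
    metricAt D x (curvature C X Y Z x) (W x) = -metricAt D x (Z x) (curvature C' X Y W x) := by
  have sm : ∀ {A B : E → E}, ContDiffOn ℝ ∞ A U → ContDiffOn ℝ ∞ B U →
      ContDiffOn ℝ ∞ (fun y => metricAt D y (A y) (B y)) U := fun hA hB =>
    (h.smooth_metricAt.clm_apply hA).clm_apply hB
  have second : ∀ {X Y : E → E}, ContDiffOn ℝ ∞ X U → ContDiffOn ℝ ∞ Y U →
      along X (along Y fun y => metricAt D y (Z y) (W y)) x
        = metricAt D x (C X (C Y Z) x) (W x) + metricAt D x (C Y Z x) (C' X W x)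
          + (metricAt D x (C X Z x) (C' Y W x) + metricAt D x (Z x) (C' X (C' Y W) x)) := by
    intro X Y hX hY
    have hYZ := (hC Y Z hY hZ).1
    have hYW := (hC' Y W hY hW).1
    rw [← h.along_metricAt hC hC' hX hYZ hW hx, ← h.along_metricAt hC hC' hX hZ hYW hx,
      ← along_add h.isOpen (sm hYZ hW) (sm hZ hYW) hx]
    exact along_congr h.isOpen (fun y hy => h.along_metricAt hC hC' hY hZ hW hy) hx
  have h1 := along_commutator h.isOpen hX hY (sm hZ hW) hx
  rw [second hX hY, second hY hX,
    h.along_metricAt hC hC' (smooth_lieBracket h.isOpen hX hY) hZ hW hx] at h1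
  simp only [curvature, Pi.sub_apply, map_sub, sub_apply]
  linarith

/-- If `d³D(u, v ‖ w)` vanishes on the diagonal then `∇` is the flat affine connection of the chart,
and then `∇*` is flat as well. -/
theorem isDuallyFlat_of_d3_eq_zero (h : IsContrast U D) [FiniteDimensional ℝ E]
    (h3 : ∀ x ∈ U, ∀ a b c, d3 (Function.uncurry D) (x, x) (a, 0) (b, 0) (0, c) = 0) :
    IsDuallyFlat U (eguchiMetric D) (eguchiConnection U D) (eguchiDualConnection U D) := by
  have hC := h.isEguchi_connection
  have hC' := h.isEguchi_dualConnection
  have cov : ∀ X Y, ContDiffOn ℝ ∞ X U → ContDiffOn ℝ ∞ Y U → ∀ x ∈ U,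
      eguchiConnection U D X Y x = fderiv ℝ Y x (X x) := fun X Y hX hY x hx =>
    h.eq_of_metricAt hx fun z => by
      rw [(hC X Y hX hY).2 x hx]; simp [h3 x hx]
  have cov2 : ∀ X Y Z, ContDiffOn ℝ ∞ X U → ContDiffOn ℝ ∞ Y U → ContDiffOn ℝ ∞ Z U → ∀ x ∈ U,
      eguchiConnection U D X (eguchiConnection U D Y Z) x
        = fderiv ℝ (fderiv ℝ Z) x (X x) (Y x) + fderiv ℝ Z x (fderiv ℝ Y x (X x)) := by
    intro X Y Z hX hY hZ x hx
    have e : eguchiConnection U D Y Z =ᶠ[𝓝 x] fun y => fderiv ℝ Z y (Y y) := by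
      filter_upwards [h.isOpen.mem_nhds hx] with y hy using cov Y Z hY hZ y hy
    have h1 := differentiableAt_of_smooth h.isOpen (smooth_fderiv h.isOpen hZ) hx
    have h2 := differentiableAt_of_smooth h.isOpen hY hx
    rw [cov _ _ hX (hC Y Z hY hZ).1 x hx, e.fderiv_eq,
      (h1.hasFDerivAt.clm_apply h2.hasFDerivAt).fderiv]
    simp [add_comm]
  have flat : ∀ X Y Z, ContDiffOn ℝ ∞ X U → ContDiffOn ℝ ∞ Y U → ContDiffOn ℝ ∞ Z U → ∀ x ∈ U,
      curvature (eguchiConnection U D) X Y Z x = 0 := by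
    intro X Y Z hX hY hZ x hx
    simp only [curvature, Pi.sub_apply]
    rw [cov2 X Y Z hX hY hZ x hx, cov2 Y X Z hY hX hZ x hx,
      cov _ Z (smooth_lieBracket h.isOpen hX hY) hZ x hx,
      fderiv_fderiv_symm h.isOpen hZ hx (X x)]
    simp [VectorField.lieBracket_eq]
  refine ⟨h.isDualistic, ⟨fun X Y hX hY x hx => hC.torsion_eq_zero h hX hY hx, flat⟩,
    ⟨fun X Y hX hY x hx => hC'.torsion_eq_zero h hX hY hx, fun X Y W hX hY hW x hx => ?_⟩⟩
  refine h.eq_of_metricAt hx fun z => ?_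
  have := h.metricAt_curvature hC hC' hX hY (Z := fun _ => z) contDiffOn_const hW hx
  rw [flat X Y _ hX hY contDiffOn_const x hx] at this
  rw [h.metricAt_symm hx]
  simpa using this.symm

/-- The vanishing of the curvature of `∇`, in terms of the derivatives of `D` at a point of the
diagonal.  The vectors `Γ i j` are the values of `∇_i j` for the constant fields `i` and `j`. -/
theorem d4_symm_of_flat (h : IsContrast U D) [FiniteDimensional ℝ E]
    (hflat : IsFlat U (eguchiConnection U D)) {x : E} (hx : x ∈ U) :
    ∃ Γ : E → E → E, (∀ i j k, metricAt D x (Γ i j) k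
        = -d3 (Function.uncurry D) (x, x) (i, 0) (j, 0) (0, k)) ∧
      ∀ l i j k, d4 (Function.uncurry D) (x, x) (0, l) (i, 0) (j, 0) (0, k)
          - d3 (Function.uncurry D) (x, x) (0, l) (0, k) (Γ i j, 0)
        = d4 (Function.uncurry D) (x, x) (0, i) (l, 0) (j, 0) (0, k)
          - d3 (Function.uncurry D) (x, x) (0, i) (0, k) (Γ l j, 0) := by
  have hC := h.isEguchi_connection
  have hC' := h.isEguchi_dualConnection
  have cc : ∀ v : E, ContDiffOn ℝ ∞ (fun _ : E => v) U := fun v => contDiffOn_const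
  have first : ∀ i j k, ∀ y ∈ U,
      metricAt D y (eguchiConnection U D (fun _ => i) (fun _ => j) y) k
        = -d3 (Function.uncurry D) (y, y) (i, 0) (j, 0) (0, k) := fun i j k y hy => by
    rw [(hC _ _ (cc i) (cc j)).2 y hy]; simp
  have first' : ∀ l k v, metricAt D x v (eguchiDualConnection U D (fun _ => l) (fun _ => k) x)
        = -d3 (Function.uncurry D) (x, x) (0, l) (0, k) (v, 0) := fun l k v => by
    rw [h.metricAt_symm hx, (hC' _ _ (cc l) (cc k)).2 x hx]; simp
  have deriv : ∀ l i j k, along (fun _ => l) (fun y =>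
      metricAt D y (eguchiConnection U D (fun _ => i) (fun _ => j) y) k) x
        = -d4 (Function.uncurry D) (x, x) (l, l) (i, 0) (j, 0) (0, k) := fun l i j k => by
    rw [along_congr h.isOpen (first i j k) hx]
    have h1 : HasFDerivAt
        (fun y => d3 (Function.uncurry D) (y, y) (i, 0) (j, 0) (0, k)) _ x :=
      (((hasFDerivAt_diag (h.diff3 hx hx)).clm_apply
      (hasFDerivAt_const ((i, 0) : E × E) x)).clm_apply
      (hasFDerivAt_const ((j, 0) : E × E) x)).clm_apply (hasFDerivAt_const ((0, k) : E × E) x)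
    unfold along
    rw [h1.fun_neg.fderiv]
    simp
  have curv : ∀ l i j k, metricAt D x (eguchiConnection U D (fun _ => l)
      (eguchiConnection U D (fun _ => i) (fun _ => j)) x) k
        = metricAt D x (eguchiConnection U D (fun _ => i)
      (eguchiConnection U D (fun _ => l) (fun _ => j)) x) k := by
    intro l i j k
    have h0 := hflat.2 _ _ _ (cc l) (cc i) (cc j) x hx
    have hb : VectorField.lieBracket ℝ (fun _ : E => l) (fun _ => i) = fun _ => 0 := by
      rw [VectorField.lieBracket_eq]; simp
    have hz : eguchiConnection U D (fun _ => 0) (fun _ => j) x = 0 :=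
      h.eq_of_metricAt hx fun z => by
        rw [first 0 j z x hx, show ((0 : E), (0 : E)) = 0 from rfl, map_zero]; simp
    simp only [curvature, Pi.sub_apply, hb, hz, sub_zero] at h0
    rw [sub_eq_zero.1 h0]
  refine ⟨fun i j => eguchiConnection U D (fun _ => i) (fun _ => j) x,
    fun i j k => first i j k x hx, fun l i j k => ?_⟩
  have e : ∀ l i, metricAt D x (eguchiConnection U D (fun _ => l)
      (eguchiConnection U D (fun _ => i) (fun _ => j)) x) k
      = -d4 (Function.uncurry D) (x, x) (l, l) (i, 0) (j, 0) (0, k)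
        + d3 (Function.uncurry D) (x, x) (0, l) (0, k)
          (eguchiConnection U D (fun _ => i) (fun _ => j) x, 0) := fun l i => by
    have := h.along_metricAt hC hC' (cc l) (hC _ _ (cc i) (cc j)).1 (cc k) hx
    rw [deriv, first'] at this
    linarith
  have e2 : ∀ l : E, ((l, l) : E × E) = (l, 0) + (0, l) := fun l => by simp
  have := curv l i j k
  rw [e, e, e2 l, e2 i] at this
  simp only [map_add, add_apply] at this
  rw [d4_symm_left h.isOpen_prod h.smooth ⟨hx, hx⟩ (l, 0) (i, 0)] at this
  linarith

end IsContrast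
end Connection

/-! ### Derivatives along lines and derivatives of an exponential -/

section Lines

variable {V : Type*} [NormedAddCommGroup V] [NormedSpace ℝ V] {Ω : Set V} {Φ : V → ℝ}

theorem eventually_line_mem (hΩ : IsOpen Ω) {z : V} (hz : z ∈ Ω) (v : V) :
    ∀ᶠ t : ℝ in 𝓝 0, z + t • v ∈ Ω := by
  have : Tendsto (fun t : ℝ => z + t • v) (𝓝 0) (𝓝 z) := by
    have h : Continuous fun t : ℝ => z + t • v := by fun_prop
    simpa using h.tendsto 0
  exact this.eventually (hΩ.mem_nhds hz)

theorem hasDerivAt_line0 (hΩ : IsOpen Ω) (h : ContDiffOn ℝ ∞ Φ Ω) {z : V} (hz : z ∈ Ω) (v : V) :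
    HasDerivAt (fun t : ℝ => Φ (z + t • v)) (fderiv ℝ Φ z v) 0 :=
  hasDerivAt_line v (differentiableAt_of_smooth hΩ h hz)

theorem hasDerivAt_line1 (hΩ : IsOpen Ω) (h : ContDiffOn ℝ ∞ Φ Ω) {z : V} (hz : z ∈ Ω)
    (v a : V) : HasDerivAt (fun t : ℝ => fderiv ℝ Φ (z + t • v) a) (d2 Φ z v a) 0 := by
  have := hasDerivAt_line v (differentiableAt_of_smooth hΩ (smooth_fderiv hΩ h) hz)
  simpa using this.clm_apply (hasDerivAt_const (0 : ℝ) a)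

theorem hasDerivAt_line2 (hΩ : IsOpen Ω) (h : ContDiffOn ℝ ∞ Φ Ω) {z : V} (hz : z ∈ Ω)
    (v a b : V) : HasDerivAt (fun t : ℝ => d2 Φ (z + t • v) a b) (d3 Φ z v a b) 0 := by
  have := hasDerivAt_line v
    (differentiableAt_of_smooth hΩ (smooth_fderiv hΩ (smooth_fderiv hΩ h)) hz)
  simpa using (this.clm_apply (hasDerivAt_const (0 : ℝ) a)).clm_apply (hasDerivAt_const (0 : ℝ) b)

theorem hasDerivAt_line3 (hΩ : IsOpen Ω) (h : ContDiffOn ℝ ∞ Φ Ω) {z : V} (hz : z ∈ Ω)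
    (v a b c : V) : HasDerivAt (fun t : ℝ => d3 Φ (z + t • v) a b c) (d4 Φ z v a b c) 0 := by
  have := hasDerivAt_line v (differentiableAt_of_smooth hΩ
    (smooth_fderiv hΩ (smooth_fderiv hΩ (smooth_fderiv hΩ h))) hz)
  simpa using ((this.clm_apply (hasDerivAt_const (0 : ℝ) a)).clm_apply
    (hasDerivAt_const (0 : ℝ) b)).clm_apply (hasDerivAt_const (0 : ℝ) c)

/-- Two functions of `t` that agree near `0` have the same derivative there. -/
theorem deriv_unique_of_eventually {f g : ℝ → ℝ} {f' g' t : ℝ} (hf : HasDerivAt f f' t)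
    (hg : HasDerivAt g g' t) (h : ∀ᶠ s in 𝓝 t, f s = g s) : f' = g' :=
  hf.unique (hg.congr_of_eventuallyEq h)

variable {L Q : V → ℝ}

theorem fderiv_of_exp (hΩ : IsOpen Ω) (hL : ContDiffOn ℝ ∞ L Ω) (hQ : ContDiffOn ℝ ∞ Q Ω)
    (hQL : ∀ z ∈ Ω, Q z = Real.exp (L z)) {z : V} (hz : z ∈ Ω) (a : V) :
    fderiv ℝ Q z a = Q z * fderiv ℝ L z a := by
  refine deriv_unique_of_eventually (hasDerivAt_line0 hΩ hQ hz a)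
    (g := fun t => Real.exp (L (z + t • a))) ?_ ?_
  · simpa [hQL z hz] using (hasDerivAt_line0 hΩ hL hz a).exp
  · filter_upwards [eventually_line_mem hΩ hz a] with t ht using hQL _ ht

theorem d2_of_exp (hΩ : IsOpen Ω) (hL : ContDiffOn ℝ ∞ L Ω) (hQ : ContDiffOn ℝ ∞ Q Ω)
    (hQL : ∀ z ∈ Ω, Q z = Real.exp (L z)) {z : V} (hz : z ∈ Ω) (a b : V) :
    d2 Q z a b = fderiv ℝ Q z a * fderiv ℝ L z b + Q z * d2 L z a b := by
  refine deriv_unique_of_eventually (hasDerivAt_line1 hΩ hQ hz a b)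
    (g := fun t => Q (z + t • a) * fderiv ℝ L (z + t • a) b) ?_ ?_
  · simpa using (hasDerivAt_line0 hΩ hQ hz a).fun_mul (hasDerivAt_line1 hΩ hL hz a b)
  · filter_upwards [eventually_line_mem hΩ hz a] with t ht using fderiv_of_exp hΩ hL hQ hQL ht b

theorem d3_of_exp (hΩ : IsOpen Ω) (hL : ContDiffOn ℝ ∞ L Ω) (hQ : ContDiffOn ℝ ∞ Q Ω)
    (hQL : ∀ z ∈ Ω, Q z = Real.exp (L z)) {z : V} (hz : z ∈ Ω) (a b c : V) :
    d3 Q z a b c = (d2 Q z a b * fderiv ℝ L z c + fderiv ℝ Q z b * d2 L z a c)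
      + (fderiv ℝ Q z a * d2 L z b c + Q z * d3 L z a b c) := by
  refine deriv_unique_of_eventually (hasDerivAt_line2 hΩ hQ hz a b c)
    (g := fun t => fderiv ℝ Q (z + t • a) b * fderiv ℝ L (z + t • a) c
      + Q (z + t • a) * d2 L (z + t • a) b c) ?_ ?_
  · simpa using ((hasDerivAt_line1 hΩ hQ hz a b).fun_mul (hasDerivAt_line1 hΩ hL hz a c)).fun_add
      ((hasDerivAt_line0 hΩ hQ hz a).fun_mul (hasDerivAt_line2 hΩ hL hz a b c))
  · filter_upwards [eventually_line_mem hΩ hz a] with t ht using d2_of_exp hΩ hL hQ hQL ht b c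

/-- The fourth derivative of `exp L` at a critical point of `L`. -/
theorem d4_of_exp (hΩ : IsOpen Ω) (hL : ContDiffOn ℝ ∞ L Ω) (hQ : ContDiffOn ℝ ∞ Q Ω)
    (hQL : ∀ z ∈ Ω, Q z = Real.exp (L z)) {z : V} (hz : z ∈ Ω) (h0 : L z = 0)
    (h1 : fderiv ℝ L z = 0) (a b c d : V) :
    d4 Q z a b c d = d4 L z a b c d
      + (d2 L z a b * d2 L z c d + d2 L z a c * d2 L z b d + d2 L z a d * d2 L z b c) := by
  have hQ0 : Q z = 1 := by rw [hQL z hz, h0, Real.exp_zero]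
  have hQ1 : ∀ v, fderiv ℝ Q z v = 0 := fun v => by rw [fderiv_of_exp hΩ hL hQ hQL hz, h1]; simp
  have hQ2 : ∀ v w, d2 Q z v w = d2 L z v w := fun v w => by
    rw [d2_of_exp hΩ hL hQ hQL hz, hQ1, hQ0]; ring
  have key := deriv_unique_of_eventually (hasDerivAt_line3 hΩ hQ hz a b c d)
    (g := fun t => (d2 Q (z + t • a) b c * fderiv ℝ L (z + t • a) d
        + fderiv ℝ Q (z + t • a) c * d2 L (z + t • a) b d)
      + (fderiv ℝ Q (z + t • a) b * d2 L (z + t • a) c d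
        + Q (z + t • a) * d3 L (z + t • a) b c d))
    (((hasDerivAt_line2 hΩ hQ hz a b c).fun_mul (hasDerivAt_line1 hΩ hL hz a d)).fun_add
      ((hasDerivAt_line1 hΩ hQ hz a c).fun_mul (hasDerivAt_line2 hΩ hL hz a b d)) |>.fun_add
      (((hasDerivAt_line1 hΩ hQ hz a b).fun_mul (hasDerivAt_line2 hΩ hL hz a c d)).fun_add
      ((hasDerivAt_line0 hΩ hQ hz a).fun_mul (hasDerivAt_line3 hΩ hL hz a b c d))))
    (by filter_upwards [eventually_line_mem hΩ hz a] with t ht using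
        d3_of_exp hΩ hL hQ hQL ht b c d)
  rw [key]
  simp only [zero_smul, add_zero, hQ1, hQ2, hQ0, h1, zero_apply]
  ring

end Lines

section LogQuasi

variable {E : Type*} [NormedAddCommGroup E] [NormedSpace ℝ E] {U : Set E} {D : E → E → ℝ}
  {Q : E × E → ℝ} {κ : ℝ}

namespace IsContrast

/-- For a contrast function `κ log Q`, flatness of `∇` in terms of the derivatives of `Q`: the
logarithm contributes to the fourth derivative only a totally symmetric term. -/
theorem d4_quasi_symm_of_flat (h : IsContrast U D) [FiniteDimensional ℝ E]
    (hflat : IsFlat U (eguchiConnection U D)) (hκ : κ ≠ 0) (hQ : ContDiffOn ℝ ∞ Q (U ×ˢ U))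
    (hpos : ∀ z ∈ U ×ˢ U, 0 < Q z)
    (hD : ∀ z ∈ U ×ˢ U, Function.uncurry D z = κ * Real.log (Q z)) {x : E} (hx : x ∈ U) :
    ∃ Γ : E → E → E, (∀ i j k, d2 Q (x, x) (Γ i j, 0) (k, 0)
        = -d3 Q (x, x) (i, 0) (j, 0) (0, k)) ∧
      ∀ l i j k, d4 Q (x, x) (0, l) (i, 0) (j, 0) (0, k)
          - d3 Q (x, x) (0, l) (0, k) (Γ i j, 0)
        = d4 Q (x, x) (0, i) (l, 0) (j, 0) (0, k)
          - d3 Q (x, x) (0, i) (0, k) (Γ l j, 0) := by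
  obtain ⟨Γ, h1, h2⟩ := h.d4_symm_of_flat hflat hx
  set F := Function.uncurry D with hF
  set L : E × E → ℝ := fun z => κ⁻¹ * F z with hLdef
  have hΩ := h.isOpen_prod
  have hz : (x, x) ∈ U ×ˢ U := ⟨hx, hx⟩
  have hL : ContDiffOn ℝ ∞ L (U ×ˢ U) := contDiffOn_const.mul h.smooth
  have hFL : ∀ z ∈ U ×ˢ U, F z = κ * L z := fun z _ => by simp [hLdef, hκ]
  have hQL : ∀ z ∈ U ×ˢ U, Q z = Real.exp (L z) := fun z hz => by
    rw [hLdef]; simp only; rw [hD z hz, inv_mul_cancel_left₀ hκ, Real.exp_log (hpos z hz)]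
  have hF1 : ∀ z ∈ U ×ˢ U, ∀ a, fderiv ℝ F z a = κ * fderiv ℝ L z a := fun z hz a =>
    deriv_unique_of_eventually (hasDerivAt_line0 hΩ h.smooth hz a)
      ((hasDerivAt_line0 hΩ hL hz a).const_mul κ)
      (by filter_upwards [eventually_line_mem hΩ hz a] with t ht using hFL _ ht)
  have hF2 : ∀ z ∈ U ×ˢ U, ∀ a b, d2 F z a b = κ * d2 L z a b := fun z hz a b =>
    deriv_unique_of_eventually (hasDerivAt_line1 hΩ h.smooth hz a b)
      ((hasDerivAt_line1 hΩ hL hz a b).const_mul κ)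
      (by filter_upwards [eventually_line_mem hΩ hz a] with t ht using hF1 _ ht b)
  have hF3 : ∀ z ∈ U ×ˢ U, ∀ a b c, d3 F z a b c = κ * d3 L z a b c := fun z hz a b c =>
    deriv_unique_of_eventually (hasDerivAt_line2 hΩ h.smooth hz a b c)
      ((hasDerivAt_line2 hΩ hL hz a b c).const_mul κ)
      (by filter_upwards [eventually_line_mem hΩ hz a] with t ht using hF2 _ ht b c)
  have hF4 : ∀ z ∈ U ×ˢ U, ∀ a b c d, d4 F z a b c d = κ * d4 L z a b c d := fun z hz a b c d =>
    deriv_unique_of_eventually (hasDerivAt_line3 hΩ h.smooth hz a b c d)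
      ((hasDerivAt_line3 hΩ hL hz a b c d).const_mul κ)
      (by filter_upwards [eventually_line_mem hΩ hz a] with t ht using hF3 _ ht b c d)
  have L0 : L (x, x) = 0 := by
    have : F (x, x) = 0 := h.self x hx
    simp [hLdef, this]
  have L1 : fderiv ℝ L (x, x) = 0 := by
    refine ContinuousLinearMap.ext fun a => ?_
    have := hF1 _ hz a
    rw [h.grad_eq_zero hx] at this
    simpa [hκ] using this.symm
  have Q1 : ∀ v, fderiv ℝ Q (x, x) v = 0 := fun v => by
    rw [fderiv_of_exp hΩ hL hQ hQL hz, L1]; simp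
  have Q0 : Q (x, x) = 1 := by rw [hQL _ hz, L0, Real.exp_zero]
  have Q2 : ∀ a b, d2 Q (x, x) a b = κ⁻¹ * d2 F (x, x) a b := fun a b => by
    rw [d2_of_exp hΩ hL hQ hQL hz, Q1, Q0, hF2 _ hz]; field_simp; ring
  have Q3 : ∀ a b c, d3 Q (x, x) a b c = κ⁻¹ * d3 F (x, x) a b c := fun a b c => by
    rw [d3_of_exp hΩ hL hQ hQL hz, Q1, Q1, Q0, L1, hF3 _ hz]
    simp only [zero_apply]
    field_simp; ring
  have Q4 : ∀ a b c d, d4 Q (x, x) a b c d = κ⁻¹ * d4 F (x, x) a b c d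
      + (d2 L (x, x) a b * d2 L (x, x) c d + d2 L (x, x) a c * d2 L (x, x) b d
        + d2 L (x, x) a d * d2 L (x, x) b c) := fun a b c d => by
    rw [d4_of_exp hΩ hL hQ hQL hz L0 L1, hF4 _ hz, inv_mul_cancel_left₀ hκ]
  have L2 : ∀ a b, d2 L (x, x) a b = κ⁻¹ * d2 F (x, x) a b := fun a b => by
    rw [hF2 _ hz, inv_mul_cancel_left₀ hκ]
  refine ⟨Γ, fun i j k => ?_, fun l i j k => ?_⟩
  · rw [Q2, Q3]
    have := h1 i j k
    rw [metricAt_apply] at this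
    rw [this]; ring
  · have := h2 l i j k
    rw [Q4, Q4, Q3, Q3]
    simp only [L2]
    have e1 : ∀ a b : E, d2 F (x, x) (0, a) (b, 0) = -d2 F (x, x) (a, 0) (b, 0) :=
      fun a b => h.mixed_eq' hx a b
    have e2 : ∀ a b : E, d2 F (x, x) (a, 0) (0, b) = -d2 F (x, x) (a, 0) (b, 0) :=
      fun a b => h.mixed_eq hx a b
    have e3 : ∀ a b : E, d2 F (x, x) (0, a) (0, b) = d2 F (x, x) (a, 0) (b, 0) := fun a b => by
      rw [h.d2_right hx, neg_apply, e2, neg_neg]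
    simp only [e1, e2, e3]
    rw [h.d2_comm hx (l, 0) (i, 0)]
    linear_combination κ⁻¹ * this

end IsContrast
end LogQuasi

/-! ### Traces of products of functions of two Hermitian matrices -/

section Weights

variable {n : ℕ} {N N' : Matrix (Fin n) (Fin n) ℂ}

/-- Every function is continuous on the finite spectrum of a matrix. -/
theorem continuousOn_spectrum (f : ℝ → ℝ) (A : Matrix (Fin n) (Fin n) ℂ) :
    ContinuousOn f (spectrum ℝ A) := A.finite_real_spectrum.continuousOn f

/-- The double spectral sum: the weights are the squared moduli of the inner products of the two
eigenbases. -/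
theorem exists_weights (hN : N.IsHermitian) (hN' : N'.IsHermitian) :
    ∃ w : Fin n → Fin n → ℝ, (∀ a b, 0 ≤ w a b) ∧ ∀ f g : ℝ → ℝ,
      (cfc f N * cfc g N').trace.re
        = ∑ a, ∑ b, w a b * (f (hN.eigenvalues a) * g (hN'.eigenvalues b)) := by
  set S : Matrix (Fin n) (Fin n) ℂ :=
    star (hN.eigenvectorUnitary : Matrix (Fin n) (Fin n) ℂ) * hN'.eigenvectorUnitary with hS
  refine ⟨fun a b => Complex.normSq (S a b), fun a b => Complex.normSq_nonneg _, fun f g => ?_⟩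
  rw [hN.cfc_eq, hN'.cfc_eq, Matrix.IsHermitian.cfc, Matrix.IsHermitian.cfc,
    Unitary.conjStarAlgAut_apply, Unitary.conjStarAlgAut_apply]
  have e : ∀ d d' : Matrix (Fin n) (Fin n) ℂ,
      ((hN.eigenvectorUnitary : Matrix (Fin n) (Fin n) ℂ) * d
        * star (hN.eigenvectorUnitary : Matrix (Fin n) (Fin n) ℂ)
        * ((hN'.eigenvectorUnitary : Matrix (Fin n) (Fin n) ℂ) * d'
        * star (hN'.eigenvectorUnitary : Matrix (Fin n) (Fin n) ℂ))).trace
        = (d * S * (d' * star S)).trace := fun d d' => by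
    rw [hS, star_mul, star_star, mul_assoc, mul_assoc, Matrix.trace_mul_comm]
    simp only [mul_assoc]
  rw [e, Matrix.trace, Complex.re_sum]
  refine Finset.sum_congr rfl fun a _ => ?_
  rw [Matrix.diag_apply, Matrix.mul_apply, Complex.re_sum]
  refine Finset.sum_congr rfl fun b _ => ?_
  rw [Matrix.diagonal_mul, Matrix.diagonal_mul, Matrix.star_apply]
  simp only [Function.comp_apply]
  have : S a b * star (S a b) = (Complex.normSq (S a b) : ℂ) := Complex.mul_conj _
  rw [show ((RCLike.ofReal (f (hN.eigenvalues a)) : ℂ) * S a b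
      * ((RCLike.ofReal (g (hN'.eigenvalues b)) : ℂ) * star (S a b)))
      = ((Complex.normSq (S a b) * (f (hN.eigenvalues a) * g (hN'.eigenvalues b)) : ℝ) : ℂ) by
    rw [show ∀ p q s s' : ℂ, p * s * (q * s') = s * s' * (p * q) by intros; ring, this]
    push_cast; rfl]
  exact Complex.ofReal_re _

theorem cfc_id_fun (hN : N.IsHermitian) : cfc (fun t : ℝ => t) N = N :=
  cfc_id' ℝ N (ha := (hN : IsSelfAdjoint N))

theorem cfc_mul_self (hN : N.IsHermitian) (f : ℝ → ℝ) :
    cfc f N * N = cfc (fun t => f t * t) N := by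
  rw [cfc_mul f (fun t => t) N (continuousOn_spectrum _ _) (continuousOn_spectrum _ _),
    cfc_id_fun hN]

theorem cfc_one' (N : Matrix (Fin n) (Fin n) ℂ) (hN : N.IsHermitian) :
    cfc (fun _ : ℝ => (1 : ℝ)) N = 1 := cfc_const_one ℝ N (ha := (hN : IsSelfAdjoint N))

/-- Klein's inequality. -/
theorem klein_inequality (hN : N.IsHermitian) (hN' : N'.IsHermitian) (f f' : ℝ → ℝ)
    (hf : ∀ a b, 0 ≤ f (hN'.eigenvalues b) - f (hN.eigenvalues a)
      - f' (hN.eigenvalues a) * (hN'.eigenvalues b - hN.eigenvalues a)) :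
    0 ≤ (cfc f N').trace.re - (cfc f N).trace.re - (cfc f' N * (N' - N)).trace.re := by
  obtain ⟨w, hw, h⟩ := exists_weights hN hN'
  have e1 := h (fun _ => 1) f
  simp only [cfc_one' N hN, one_mul] at e1
  have e2 := h f (fun _ => 1)
  simp only [cfc_one' N' hN', mul_one] at e2
  have e3 := h f' (fun t => t)
  simp only [cfc_id_fun hN'] at e3
  have e4 := h (fun t => f' t * t) (fun _ => 1)
  simp only [cfc_one' N' hN', ← cfc_mul_self hN, mul_one] at e4
  rw [mul_sub, Matrix.trace_sub, Complex.sub_re, e1, e2, e3, e4]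
  simp only [← Finset.sum_sub_distrib]
  refine Finset.sum_nonneg fun a _ => Finset.sum_nonneg fun b _ => ?_
  have := mul_nonneg (hw a b) (hf a b)
  linarith

/-- A function with increments bounded below has increments bounded below on matrices. -/
theorem trace_increment_ge (hN : N.IsHermitian) (hN' : N'.IsHermitian) (f : ℝ → ℝ) (m : ℝ)
    (hf : ∀ a b, m * (hN'.eigenvalues b - hN.eigenvalues a) ^ 2
      ≤ (hN'.eigenvalues b - hN.eigenvalues a) * (f (hN'.eigenvalues b) - f (hN.eigenvalues a))) :
    m * ((N' - N) * (N' - N)).trace.re ≤ ((N' - N) * (cfc f N' - cfc f N)).trace.re := by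
  obtain ⟨w, hw, h⟩ := exists_weights hN hN'
  have key : ∀ f : ℝ → ℝ, ((N' - N) * (cfc f N' - cfc f N)).trace.re
      = ∑ a, ∑ b, w a b * ((hN'.eigenvalues b - hN.eigenvalues a)
        * (f (hN'.eigenvalues b) - f (hN.eigenvalues a))) := fun f => by
    have e1 := h (fun _ => 1) (fun t => f t * t)
    simp only [cfc_one' N hN, ← cfc_mul_self hN', one_mul] at e1
    have e2 := h (fun t => t) f
    simp only [cfc_id_fun hN] at e2
    have e3 := h f (fun t => t)
    simp only [cfc_id_fun hN'] at e3
    have e4 := h (fun t => f t * t) (fun _ => 1)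
    simp only [cfc_one' N' hN', ← cfc_mul_self hN, mul_one] at e4
    rw [mul_sub, sub_mul, sub_mul, Matrix.trace_sub, Matrix.trace_sub, Matrix.trace_sub,
      Matrix.trace_mul_comm N' (cfc f N'), Matrix.trace_mul_comm N' (cfc f N),
      Matrix.trace_mul_comm N (cfc f N)]
    simp only [Complex.sub_re]
    rw [e1, e2, e3, e4]
    simp only [← Finset.sum_sub_distrib]
    refine Finset.sum_congr rfl fun a _ => Finset.sum_congr rfl fun b _ => ?_
    ring
  have h2 := key (fun t => t)
  rw [cfc_id_fun hN, cfc_id_fun hN'] at h2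
  rw [h2, key f, Finset.mul_sum]
  refine Finset.sum_le_sum fun a _ => ?_
  rw [Finset.mul_sum]
  refine Finset.sum_le_sum fun b _ => ?_
  have := mul_le_mul_of_nonneg_left (hf a b) (hw a b)
  linarith

theorem trace_mul_self_pos {H : Matrix (Fin n) (Fin n) ℂ} (hH : H.IsHermitian) (h0 : H ≠ 0) :
    0 < (H * H).trace.re := by
  have e : (H * H).trace.re = ∑ i, ∑ j, Complex.normSq (H i j) := by
    rw [Matrix.trace, Complex.re_sum]
    refine Finset.sum_congr rfl fun i _ => ?_
    rw [Matrix.diag_apply, Matrix.mul_apply, Complex.re_sum]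
    refine Finset.sum_congr rfl fun j _ => ?_
    rw [← hH.apply j i, show star (H i j) = (starRingEnd ℂ) (H i j) from rfl, Complex.mul_conj]
    exact Complex.ofReal_re _
  rw [e]
  have hex : ∃ i j, H i j ≠ 0 := by
    by_contra hne
    push Not at hne
    exact h0 (Matrix.ext hne)
  obtain ⟨i, j, hij⟩ := hex
  refine Finset.sum_pos' (fun i _ => Finset.sum_nonneg fun j _ => Complex.normSq_nonneg _)
    ⟨i, Finset.mem_univ _, ?_⟩
  exact Finset.sum_pos' (fun j _ => Complex.normSq_nonneg _)
    ⟨j, Finset.mem_univ _, Complex.normSq_pos.2 hij⟩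

open scoped MatrixOrder in
theorem posDef_iff_spectrum {A : Matrix (Fin n) (Fin n) ℂ} (hA : A.IsHermitian) :
    A.PosDef ↔ ∀ t ∈ spectrum ℝ A, 0 < t := by
  rw [← Matrix.isStrictlyPositive_iff_posDef]
  exact StarOrderedRing.isStrictlyPositive_iff_spectrum_pos A (ha := hA)

theorem isHermitian_cfc (f : ℝ → ℝ) (A : Matrix (Fin n) (Fin n) ℂ) : (cfc f A).IsHermitian :=
  cfc_predicate (p := IsSelfAdjoint) f A

theorem spectrum_cfc {A : Matrix (Fin n) (Fin n) ℂ} (hA : A.IsHermitian) (f : ℝ → ℝ) :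
    spectrum ℝ (cfc f A) = f '' spectrum ℝ A :=
  cfc_map_spectrum (p := IsSelfAdjoint) f A hA (continuousOn_spectrum _ _)

theorem posDef_cfc {A : Matrix (Fin n) (Fin n) ℂ} (hA : A.PosDef) {f : ℝ → ℝ}
    (hf : ∀ t, 0 < t → 0 < f t) : (cfc f A).PosDef := by
  rw [posDef_iff_spectrum (isHermitian_cfc f A),
    spectrum_cfc hA.isHermitian]
  rintro _ ⟨t, ht, rfl⟩
  exact hf t ((posDef_iff_spectrum hA.isHermitian).1 hA t ht)

theorem posDef_exp {K : Matrix (Fin n) (Fin n) ℂ} (hK : K.IsHermitian) :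
    (NormedSpace.exp K).PosDef := by
  rw [← CFC.real_exp_eq_normedSpace_exp (a := K) hK, posDef_iff_spectrum (isHermitian_cfc _ _),
    spectrum_cfc hK]
  rintro _ ⟨t, -, rfl⟩
  exact Real.exp_pos t

theorem mlog_exp {K : Matrix (Fin n) (Fin n) ℂ} (hK : K.IsHermitian) :
    mlog (NormedSpace.exp K) = K := CFC.log_exp K hK

open scoped MatrixOrder in
theorem exp_mlog {A : Matrix (Fin n) (Fin n) ℂ} (hA : A.PosDef) :
    NormedSpace.exp (mlog A) = A := CFC.exp_log A hA.isStrictlyPositive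

theorem isHermitian_mlog (A : Matrix (Fin n) (Fin n) ℂ) : (mlog A).IsHermitian :=
  isHermitian_cfc _ A

theorem isHermitian_mpow (A : Matrix (Fin n) (Fin n) ℂ) (s : ℝ) : (mpow A s).IsHermitian :=
  isHermitian_cfc _ A

theorem posDef_mpow {A : Matrix (Fin n) (Fin n) ℂ} (hA : A.PosDef) (s : ℝ) : (mpow A s).PosDef :=
  posDef_cfc hA fun _ ht => Real.rpow_pos_of_pos ht s

theorem cfc_congr_pos {A : Matrix (Fin n) (Fin n) ℂ} (hA : A.PosDef) {f g : ℝ → ℝ}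
    (h : ∀ t, 0 < t → f t = g t) : cfc f A = cfc g A :=
  cfc_congr fun t ht => h t ((posDef_iff_spectrum hA.isHermitian).1 hA t ht)

theorem cfc_comp_any {A : Matrix (Fin n) (Fin n) ℂ} (hA : A.IsHermitian) (f g : ℝ → ℝ) :
    cfc g (cfc f A) = cfc (fun t => g (f t)) A :=
  (cfc_comp' g f A ((A.finite_real_spectrum.image f).continuousOn g) (continuousOn_spectrum _ _)
    hA).symm

theorem mpow_eq_exp {A : Matrix (Fin n) (Fin n) ℂ} (hA : A.PosDef) (s : ℝ) :
    mpow A s = NormedSpace.exp (s • mlog A) := by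
  have h1 : s • mlog A = cfc (fun t => s * Real.log t) A := by
    rw [mlog, cfc_const_mul s Real.log A (continuousOn_spectrum _ _)]
  rw [h1, ← CFC.real_exp_eq_normedSpace_exp (isHermitian_cfc _ _),
    cfc_comp_any hA.isHermitian]
  exact cfc_congr_pos hA fun t ht => by rw [Real.rpow_def_of_pos ht, mul_comm]

theorem mpow_mul_mpow {A : Matrix (Fin n) (Fin n) ℂ} (hA : A.PosDef) (s t : ℝ) :
    mpow A s * mpow A t = mpow A (s + t) := by
  rw [mpow, mpow, ← cfc_mul _ _ A (continuousOn_spectrum _ _) (continuousOn_spectrum _ _)]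
  exact cfc_congr_pos hA fun x hx => (Real.rpow_add hx s t).symm

theorem mpow_mpow {A : Matrix (Fin n) (Fin n) ℂ} (hA : A.PosDef) (s t : ℝ) :
    mpow (mpow A s) t = mpow A (s * t) := by
  rw [mpow, mpow, cfc_comp_any hA.isHermitian]
  exact cfc_congr_pos hA fun x hx => (Real.rpow_mul hx.le s t).symm

theorem mpow_one {A : Matrix (Fin n) (Fin n) ℂ} (hA : A.PosDef) : mpow A 1 = A := by
  rw [mpow]; simp only [Real.rpow_one]; exact cfc_id_fun hA.isHermitian

theorem mpow_zero {A : Matrix (Fin n) (Fin n) ℂ} (hA : A.PosDef) : mpow A 0 = 1 := by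
  rw [mpow]; simp only [Real.rpow_zero]; exact cfc_one' A hA.isHermitian

end Weights

/-! ### Smoothness of logarithms and powers of positive definite matrices -/

section Smooth

variable {n : ℕ}

/-- The real part of the trace, as a continuous real linear form. -/
def traceRe (n : ℕ) : Matrix (Fin n) (Fin n) ℂ →L[ℝ] ℝ :=
  LinearMap.toContinuousLinearMap
    { toFun := fun M => M.trace.re
      map_add' := fun A B => by simp [Matrix.trace_add]
      map_smul' := fun c A => by simp [Matrix.trace_smul] }

theorem traceRe_apply (M : Matrix (Fin n) (Fin n) ℂ) : traceRe n M = M.trace.re := rfl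

theorem le_deriv_of_eventually {g : ℝ → ℝ} {g' m : ℝ} (hg : HasDerivAt g g' 0)
    (h : ∀ᶠ t in 𝓝[>] (0 : ℝ), m * t ≤ g t - g 0) : m ≤ g' := by
  have h1 : Tendsto (fun t => t⁻¹ • (g (0 + t) - g 0)) (𝓝[>] (0 : ℝ)) (𝓝 g') :=
    (hasDerivAt_iff_tendsto_slope_zero.1 hg).mono_left
      (nhdsWithin_mono (0 : ℝ) fun t (ht : 0 < t) => ht.ne')
  refine ge_of_tendsto h1 ?_
  filter_upwards [h, self_mem_nhdsWithin] with t ht (ht0 : 0 < t)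
  rw [zero_add, smul_eq_mul, ← div_eq_inv_mul, le_div_iff₀ ht0]
  exact ht

theorem abs_eigenvalues_le {N : Matrix (Fin n) (Fin n) ℂ} (hN : N.IsHermitian) (a : Fin n) :
    |hN.eigenvalues a| ≤ ‖N‖ * ‖(1 : Matrix (Fin n) (Fin n) ℂ)‖ :=
  spectrum.norm_le_norm_mul_of_mem (hN.eigenvalues_mem_spectrum_real a)

theorem exp_increment_ge {R x y : ℝ} (hx : -R ≤ x) (hy : -R ≤ y) :
    Real.exp (-R) * (y - x) ^ 2 ≤ (y - x) * (Real.exp y - Real.exp x) := by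
  have key : ∀ {x y : ℝ}, -R ≤ x → x ≤ y →
      Real.exp (-R) * (y - x) ≤ Real.exp y - Real.exp x := fun {x y} hx hxy => by
    have h1 : Real.exp y = Real.exp x * Real.exp (y - x) := by rw [← Real.exp_add]; ring_nf
    have h2 := Real.add_one_le_exp (y - x)
    have h3 : Real.exp (-R) ≤ Real.exp x := Real.exp_le_exp.2 hx
    have h4 := mul_le_mul_of_nonneg_left h2 (Real.exp_pos x).le
    have h5 := mul_le_mul_of_nonneg_right h3 (sub_nonneg.2 hxy)
    rw [h1]; linarith
  rcases le_total x y with h | h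
  · have := mul_le_mul_of_nonneg_left (key hx h) (sub_nonneg.2 h)
    linarith
  · have := mul_le_mul_of_nonneg_left (key hy h) (sub_nonneg.2 h)
    linarith

theorem contDiff_exp :
    ContDiff ℝ ∞ (NormedSpace.exp : Matrix (Fin n) (Fin n) ℂ → Matrix (Fin n) (Fin n) ℂ) :=
  contDiff_iff_contDiffAt.2 fun x => (NormedSpace.exp_analytic (𝕂 := ℝ) x).contDiffAt

theorem isHermitian_line {K H : Matrix (Fin n) (Fin n) ℂ} (hK : K.IsHermitian)
    (hH : H.IsHermitian) (t : ℝ) : (K + t • H).IsHermitian :=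
  hK.add (by simp [Matrix.IsHermitian, Matrix.conjTranspose_smul, hH.eq])

/-- The derivative of the exponential at a Hermitian matrix is injective on Hermitian matrices: the
increments of `exp` on a bounded interval are bounded below, and so are the traces
`Tr H (exp (K + t H) - exp K)`. -/
theorem fderiv_exp_injective {K H : Matrix (Fin n) (Fin n) ℂ} (hK : K.IsHermitian)
    (hH : H.IsHermitian) (h0 : fderiv ℝ NormedSpace.exp K H = 0) : H = 0 := by
  by_contra hne
  have hpos := trace_mul_self_pos hH hne
  set R := (‖K‖ + ‖H‖) * ‖(1 : Matrix (Fin n) (Fin n) ℂ)‖ with hR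
  have hd : HasDerivAt (fun t : ℝ => NormedSpace.exp (K + t • H)) 0 0 := by
    have := hasDerivAt_line H ((contDiff_exp (n := n)).contDiffAt (x := K)
      |>.differentiableAt (by simp))
    rwa [h0] at this
  have hg : HasDerivAt (fun t : ℝ => traceRe n (H * NormedSpace.exp (K + t • H))) 0 0 := by
    have := (traceRe n).hasFDerivAt.comp_hasDerivAt (0 : ℝ) (hd.const_mul H)
    simpa [Function.comp_def] using this
  have := le_deriv_of_eventually (m := Real.exp (-R) * (H * H).trace.re) hg ?_
  · have := mul_pos (Real.exp_pos (-R)) hpos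
    linarith
  · filter_upwards [Ioo_mem_nhdsGT (zero_lt_one' ℝ)] with t ht
    have hKt := isHermitian_line hK hH t
    have hnorm : ‖K + t • H‖ ≤ ‖K‖ + ‖H‖ := by
      refine (norm_add_le _ _).trans (add_le_add_right ?_ _)
      rw [norm_smul, Real.norm_of_nonneg ht.1.le]
      exact mul_le_of_le_one_left (norm_nonneg _) ht.2.le
    have h1 := trace_increment_ge hK hKt Real.exp (Real.exp (-R)) fun a b => by
      refine exp_increment_ge ?_ ?_
      · refine (abs_le.1 ((abs_eigenvalues_le hK a).trans ?_)).1
        exact mul_le_mul_of_nonneg_right (le_add_of_nonneg_right (norm_nonneg _)) (norm_nonneg _)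
      · refine (abs_le.1 ((abs_eigenvalues_le hKt b).trans ?_)).1
        exact mul_le_mul_of_nonneg_right hnorm (norm_nonneg _)
    rw [CFC.real_exp_eq_normedSpace_exp (a := K) hK,
      CFC.real_exp_eq_normedSpace_exp (a := K + t • H) hKt, add_sub_cancel_left] at h1
    simp only [smul_mul_assoc, mul_smul_comm, Matrix.trace_smul, Complex.smul_re,
      smul_eq_mul] at h1
    have h2 : Real.exp (-R) * (H * H).trace.re * t
        ≤ (H * (NormedSpace.exp (K + t • H) - NormedSpace.exp K)).trace.re := by
      refine le_of_mul_le_mul_left ?_ ht.1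
      linarith
    simp only [zero_smul, add_zero]
    rw [← map_sub, ← mul_sub, traceRe_apply]
    exact h2

/-- The real vector space of Hermitian matrices. -/
abbrev Herm (n : ℕ) : Submodule ℝ (Matrix (Fin n) (Fin n) ℂ) :=
  selfAdjoint.submodule ℝ (Matrix (Fin n) (Fin n) ℂ)

theorem exists_hermProj (n : ℕ) : ∃ P : Matrix (Fin n) (Fin n) ℂ →L[ℝ] Herm n,
    ∀ M : Matrix (Fin n) (Fin n) ℂ, M.IsHermitian → (P M : Matrix (Fin n) (Fin n) ℂ) = M := by
  obtain ⟨P, hP⟩ := Submodule.ClosedComplemented.of_finiteDimensional_quotient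
    (Submodule.closed_of_finiteDimensional (Herm n))
  exact ⟨P, fun M hM => congrArg Subtype.val (hP ⟨M, hM⟩)⟩

/-- The exponential is a local diffeomorphism from Hermitian to positive definite matrices, whose
inverse is the logarithm. -/
theorem contDiffAt_mlog_Herm {A : Herm n} (hA : (A : Matrix (Fin n) (Fin n) ℂ).PosDef) :
    (∀ᶠ B : Herm n in 𝓝 A, (B : Matrix (Fin n) (Fin n) ℂ).PosDef) ∧
      ContDiffAt ℝ ∞ (fun B : Herm n => mlog (B : Matrix (Fin n) (Fin n) ℂ)) A := by
  obtain ⟨P, hP⟩ := exists_hermProj n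
  set φ : Herm n → Herm n := fun K => P (NormedSpace.exp (K : Matrix (Fin n) (Fin n) ℂ)) with hφ
  have hφc : ContDiff ℝ ∞ φ := P.contDiff.comp (contDiff_exp.comp (Herm n).subtypeL.contDiff)
  have hφe : ∀ K : Herm n, (φ K : Matrix (Fin n) (Fin n) ℂ) = NormedSpace.exp (K : Matrix _ _ ℂ) :=
    fun K => hP _ (posDef_exp K.2).isHermitian
  set K₀ : Herm n := ⟨mlog A, isHermitian_mlog _⟩ with hK₀
  have hφK : φ K₀ = A := Subtype.ext (by rw [hφe]; exact exp_mlog hA)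
  have hinj : Function.Injective (fderiv ℝ φ K₀).toLinearMap := by
    rw [← LinearMap.ker_eq_bot, LinearMap.ker_eq_bot']
    intro H hH
    have h1 := hasDerivAt_line H (hφc.contDiffAt (x := K₀) |>.differentiableAt (by simp))
    have h2 := (Herm n).subtypeL.hasFDerivAt.comp_hasDerivAt (0 : ℝ) h1
    have h3 : HasDerivAt (fun t : ℝ => NormedSpace.exp ((K₀ : Matrix (Fin n) (Fin n) ℂ)
        + t • (H : Matrix (Fin n) (Fin n) ℂ)))
        ((fderiv ℝ φ K₀ H : Herm n) : Matrix (Fin n) (Fin n) ℂ) 0 := by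
      refine h2.congr_of_eventuallyEq (Eventually.of_forall fun t => ?_)
      exact (hφe (K₀ + t • H)).symm
    have h4 := h3.unique (hasDerivAt_line (H : Matrix (Fin n) (Fin n) ℂ)
      ((contDiff_exp (n := n)).contDiffAt.differentiableAt (by simp)))
    have h5 : fderiv ℝ φ K₀ H = 0 := hH
    rw [h5] at h4
    exact Subtype.ext (fderiv_exp_injective K₀.2 H.2 h4.symm)
  let e := (LinearEquiv.ofInjectiveEndo _ hinj).toContinuousLinearEquiv
  have he : HasFDerivAt φ (e : Herm n →L[ℝ] Herm n) K₀ :=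
    (hφc.contDiffAt (x := K₀) |>.differentiableAt (by simp)).hasFDerivAt
  have hs : HasStrictFDerivAt φ (e : Herm n →L[ℝ] Herm n) K₀ :=
    (hφc.contDiffAt (x := K₀)).hasStrictFDerivAt' he (by simp)
  have hr : ∀ᶠ B in 𝓝 A, φ (hs.localInverse φ e K₀ B) = B := by
    simpa [hφK] using hs.eventually_right_inverse
  have hψ : ContDiffAt ℝ ∞ (hs.localInverse φ e K₀) A := by
    have := (hφc.contDiffAt (x := K₀)).to_localInverse he (by simp)
    rw [hφK] at this
    exact this
  refine ⟨?_, ?_⟩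
  · filter_upwards [hr] with B hB
    rw [← hB, hφe]
    exact posDef_exp (Subtype.prop _)
  · refine ((Herm n).subtypeL.contDiff.contDiffAt.comp A hψ).congr_of_eventuallyEq ?_
    filter_upwards [hr] with B hB
    conv_lhs => rw [← hB, hφe, mlog_exp (hs.localInverse φ e K₀ B).2]
    rfl

variable {E : Type*} [NormedAddCommGroup E] {f : E → Matrix (Fin n) (Fin n) ℂ} {x : E}

theorem eventually_posDef (hf : ContinuousAt f x) (hH : ∀ᶠ y in 𝓝 x, (f y).IsHermitian)
    (hx : (f x).PosDef) : ∀ᶠ y in 𝓝 x, (f y).PosDef := by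
  obtain ⟨P, hP⟩ := exists_hermProj n
  have h1 : Tendsto (fun y => P (f y)) (𝓝 x) (𝓝 (P (f x))) :=
    (P.continuous.continuousAt).comp hf
  have hx' : ((P (f x) : Herm n) : Matrix (Fin n) (Fin n) ℂ).PosDef := by
    rwa [hP _ hx.isHermitian]
  filter_upwards [h1.eventually (contDiffAt_mlog_Herm hx').1, hH] with y hy hyH
  rwa [hP _ hyH] at hy

variable [NormedSpace ℝ E]

theorem contDiffAt_mlog (hf : ContDiffAt ℝ ∞ f x) (hH : ∀ᶠ y in 𝓝 x, (f y).IsHermitian)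
    (hx : (f x).PosDef) : ContDiffAt ℝ ∞ (fun y => mlog (f y)) x := by
  obtain ⟨P, hP⟩ := exists_hermProj n
  have hx' : ((P (f x) : Herm n) : Matrix (Fin n) (Fin n) ℂ).PosDef := by
    rwa [hP _ hx.isHermitian]
  have h1 : ContDiffAt ℝ ∞ (fun y => P (f y)) x := P.contDiff.contDiffAt.comp x hf
  refine ((contDiffAt_mlog_Herm hx').2.comp x h1).congr_of_eventuallyEq ?_
  filter_upwards [hH] with y hy
  simp only [Function.comp_apply]
  rw [hP _ hy]

theorem contDiffAt_mpow {s : E → ℝ} (hf : ContDiffAt ℝ ∞ f x) (hs : ContDiffAt ℝ ∞ s x)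
    (hH : ∀ᶠ y in 𝓝 x, (f y).IsHermitian)
    (hx : (f x).PosDef) : ContDiffAt ℝ ∞ (fun y => mpow (f y) (s y)) x := by
  have h1 : ContDiffAt ℝ ∞ (fun y => NormedSpace.exp (s y • mlog (f y))) x :=
    contDiff_exp.contDiffAt.comp x (hs.smul (contDiffAt_mlog hf hH hx))
  refine h1.congr_of_eventuallyEq ?_
  filter_upwards [eventually_posDef hf.continuousAt hH hx] with y hy using mpow_eq_exp hy _

end Smooth

/-! ### Derivatives of traces of matrix functions -/

section TraceDerivatives

variable {n : ℕ}

/-- Mean value form of the tangent line inequality for a function with monotone derivative. -/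
theorem tangent_line_le {f f' : ℝ → ℝ} (hf : ∀ x, 0 < x → HasDerivAt f (f' x) x)
    (hmono : MonotoneOn f' (Set.Ioi 0)) {x y : ℝ} (hx : 0 < x) (hy : 0 < y) :
    0 ≤ f y - f x - f' x * (y - x) := by
  rcases lt_trichotomy x y with h | h | h
  · obtain ⟨c, hc, hc'⟩ := exists_hasDerivAt_eq_slope f f' h
      (fun t ht => (hf t (hx.trans_le ht.1)).continuousAt.continuousWithinAt)
      (fun t ht => hf t (hx.trans ht.1))
    have h1 : f' x ≤ f' c := hmono hx (hx.trans hc.1) hc.1.le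
    rw [hc', le_div_iff₀ (sub_pos.2 h)] at h1
    linarith
  · subst h; simp
  · obtain ⟨c, hc, hc'⟩ := exists_hasDerivAt_eq_slope f f' h
      (fun t ht => (hf t (hy.trans_le ht.1)).continuousAt.continuousWithinAt)
      (fun t ht => hf t (hy.trans ht.1))
    have h1 : f' c ≤ f' x := hmono (hy.trans hc.1) hx hc.2.le
    rw [hc', div_le_iff₀ (sub_pos.2 h)] at h1
    linarith

/-- First derivative of `Tr f(N)`: by Klein's inequality the difference to its candidate linear
part has a minimum, so no bound on the second order term is needed. -/
theorem hasDerivAt_trace_cfc {N : ℝ → Matrix (Fin n) (Fin n) ℂ} {H : Matrix (Fin n) (Fin n) ℂ}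
    (hN : HasDerivAt N H 0) (hpos : ∀ᶠ t in 𝓝 0, (N t).PosDef) {f f' : ℝ → ℝ}
    (hf : ∀ x, 0 < x → HasDerivAt f (f' x) x) (hmono : MonotoneOn f' (Set.Ioi 0))
    (hd : DifferentiableAt ℝ (fun t => traceRe n (cfc f (N t))) 0) :
    HasDerivAt (fun t => traceRe n (cfc f (N t))) (traceRe n (cfc f' (N 0) * H)) 0 := by
  have h0 : (N 0).PosDef := hpos.self_of_nhds
  have h1 : HasDerivAt (fun t => traceRe n (cfc f' (N 0) * (N t - N 0)))
      (traceRe n (cfc f' (N 0) * H)) 0 := by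
    have := (traceRe n).hasFDerivAt.comp_hasDerivAt (0 : ℝ)
      ((hN.sub_const (N 0)).const_mul (cfc f' (N 0)))
    simpa [Function.comp_def] using this
  have h2 := hd.hasDerivAt.sub h1
  have h3 : IsLocalMin ((fun t => traceRe n (cfc f (N t)))
      - fun t => traceRe n (cfc f' (N 0) * (N t - N 0))) 0 := by
    filter_upwards [hpos] with t ht
    have := klein_inequality h0.isHermitian ht.isHermitian f f' fun a b =>
      tangent_line_le hf hmono (h0.eigenvalues_pos a) (ht.eigenvalues_pos b)
    simp only [Pi.sub_apply, sub_self, mul_zero, traceRe_apply, Matrix.trace_zero, Complex.zero_re]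
    linarith
  have h4 := h3.hasDerivAt_eq_zero h2
  rw [sub_eq_zero] at h4
  rw [← h4]
  exact hd.hasDerivAt

theorem hasDerivAt_trace_mpow {α : ℝ} (hα0 : α ≠ 0) (hα1 : α ≠ 1)
    {N : ℝ → Matrix (Fin n) (Fin n) ℂ} {H : Matrix (Fin n) (Fin n) ℂ}
    (hN : HasDerivAt N H 0) (hpos : ∀ᶠ t in 𝓝 0, (N t).PosDef) (hs : ContDiffAt ℝ ∞ N 0) :
    HasDerivAt (fun t => traceRe n (mpow (N t) α)) (α * traceRe n (mpow (N 0) (α - 1) * H)) 0 := by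
  set c := α * (α - 1) with hc
  have hc0 : c ≠ 0 := mul_ne_zero hα0 (sub_ne_zero.2 hα1)
  have e1 : ∀ (A : Matrix (Fin n) (Fin n) ℂ) (d p : ℝ),
      cfc (fun t : ℝ => d * t ^ p) A = d • mpow A p := fun A d p =>
    cfc_const_mul d _ A (continuousOn_spectrum _ _)
  have hd : DifferentiableAt ℝ (fun t => traceRe n (mpow (N t) α)) 0 :=
    (traceRe n).differentiableAt.comp (0 : ℝ) ((contDiffAt_mpow hs contDiffAt_const
      (hpos.mono fun _ h => h.isHermitian) hpos.self_of_nhds).differentiableAt (by simp))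
  have h := hasDerivAt_trace_cfc hN hpos (f := fun t => c * t ^ α)
    (f' := fun t => c * α * t ^ (α - 1))
    (fun x hx => by
      simpa [mul_assoc] using (Real.hasDerivAt_rpow_const (p := α) (Or.inl hx.ne')).const_mul c)
    (fun x hx y hy hxy => by
      have key : (α - 1) * x ^ (α - 1) ≤ (α - 1) * y ^ (α - 1) := by
        rcases le_total 0 (α - 1) with h | h
        · exact mul_le_mul_of_nonneg_left (Real.rpow_le_rpow (le_of_lt hx) hxy h) h
        · exact mul_le_mul_of_nonpos_left (Real.rpow_le_rpow_of_nonpos hx hxy h) h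
      have := mul_le_mul_of_nonneg_left key (sq_nonneg α)
      simp only [hc]
      linarith)
    (by simp only [e1, map_smul]; exact hd.const_smul c)
  simp only [e1, map_smul, smul_mul_assoc, smul_eq_mul] at h
  have h2 := h.const_mul c⁻¹
  simpa [← mul_assoc, hc0] using h2

theorem cfc_mul_log {A : Matrix (Fin n) (Fin n) ℂ} (hA : A.IsHermitian) :
    cfc (fun t => t * Real.log t) A = A * mlog A := by
  rw [cfc_mul (fun t => t) Real.log A (continuousOn_spectrum _ _) (continuousOn_spectrum _ _),
    cfc_id_fun hA, mlog]

theorem hasDerivAt_trace_mul_mlog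
    {N : ℝ → Matrix (Fin n) (Fin n) ℂ} {H : Matrix (Fin n) (Fin n) ℂ}
    (hN : HasDerivAt N H 0) (hpos : ∀ᶠ t in 𝓝 0, (N t).PosDef) (hs : ContDiffAt ℝ ∞ N 0) :
    HasDerivAt (fun t => traceRe n (N t * mlog (N t))) (traceRe n ((mlog (N 0) + 1) * H)) 0 := by
  have hH : ∀ᶠ t in 𝓝 0, (N t).IsHermitian := hpos.mono fun _ h => h.isHermitian
  have hd : DifferentiableAt ℝ (fun t => traceRe n (N t * mlog (N t))) 0 :=
    (traceRe n).differentiableAt.comp (0 : ℝ)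
      ((hs.mul (contDiffAt_mlog hs hH hpos.self_of_nhds)).differentiableAt (by simp))
  have e : (fun t => traceRe n (cfc (fun t => t * Real.log t) (N t)))
      =ᶠ[𝓝 0] fun t => traceRe n (N t * mlog (N t)) := by
    filter_upwards [hH] with t ht
    rw [cfc_mul_log ht]
  have h := hasDerivAt_trace_cfc hN hpos (f := fun t => t * Real.log t)
    (f' := fun t => Real.log t + 1) (fun x hx => Real.hasDerivAt_mul_log hx.ne')
    (fun x hx y hy hxy => by
      have := Real.log_le_log hx hxy
      simpa using this) (hd.congr_of_eventuallyEq e)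
  have h0 : cfc (fun t => Real.log t + 1) (N 0) = mlog (N 0) + 1 := by
    rw [cfc_add (N 0) Real.log (fun _ => 1) (continuousOn_spectrum _ _) (continuousOn_spectrum _ _),
      cfc_one' _ hH.self_of_nhds, mlog]
  rw [h0] at h
  exact h.congr_of_eventuallyEq e.symm

theorem eventually_norm_le {F : Type*} [NormedAddCommGroup F] {g : ℝ → F}
    (hg : ContinuousAt g 0) : ∀ᶠ t in 𝓝 0, ‖g t‖ ≤ ‖g 0‖ + 1 :=
  (hg.norm.eventually (gt_mem_nhds (lt_add_one _))).mono fun _ h => le_of_lt h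

/-- Along a line of positive definite matrices the eigenvalues stay in a compact subset of the
positive half-line. -/
theorem exists_eigenvalue_bounds {N : ℝ → Matrix (Fin n) (Fin n) ℂ}
    (hpos : ∀ᶠ t in 𝓝 0, (N t).PosDef) (hs : ContDiffAt ℝ ∞ N 0) :
    ∃ δ R : ℝ, 0 < δ ∧ ∀ᶠ t in 𝓝 0, ∀ x ∈ spectrum ℝ (N t), x ∈ Set.Icc δ R := by
  have hinv : ContDiffAt ℝ ∞ (fun t => mpow (N t) (-1)) 0 := contDiffAt_mpow hs contDiffAt_const
    (hpos.mono fun _ h => h.isHermitian) hpos.self_of_nhds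
  set o := ‖(1 : Matrix (Fin n) (Fin n) ℂ)‖ with ho
  set R₁ := (‖mpow (N 0) (-1)‖ + 1) * o + 1 with hR₁
  have hR₁pos : 0 < R₁ := by positivity
  refine ⟨R₁⁻¹, (‖N 0‖ + 1) * o, inv_pos.2 hR₁pos, ?_⟩
  filter_upwards [hpos, eventually_norm_le hs.continuousAt, eventually_norm_le hinv.continuousAt]
    with t ht h1 h2 x hx
  have hx0 := (posDef_iff_spectrum ht.isHermitian).1 ht x hx
  refine ⟨?_, ?_⟩
  · have h3 : x ^ (-1 : ℝ) ∈ spectrum ℝ (mpow (N t) (-1)) := by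
      rw [mpow, spectrum_cfc ht.isHermitian]
      exact ⟨x, hx, rfl⟩
    have h4 := (le_abs_self _).trans (spectrum.norm_le_norm_mul_of_mem h3)
    rw [Real.rpow_neg_one] at h4
    rw [inv_le_comm₀ hR₁pos hx0]
    have h5 := mul_le_mul_of_nonneg_right h2 (norm_nonneg (1 : Matrix (Fin n) (Fin n) ℂ))
    linarith
  · have h4 := (le_abs_self _).trans (spectrum.norm_le_norm_mul_of_mem hx)
    exact h4.trans (mul_le_mul_of_nonneg_right h1 (norm_nonneg _))

/-- The derivative of a strictly increasing function on positive definite matrices is positive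
definite for the trace form. -/
theorem trace_mul_deriv_cfc_pos {A H : Matrix (Fin n) (Fin n) ℂ} (hA : A.PosDef)
    (hH : H.IsHermitian) (hne : H ≠ 0) {f f' : ℝ → ℝ} (hf : ∀ x, 0 < x → HasDerivAt f (f' x) x)
    (hf' : ∀ x, 0 < x → 0 < f' x) (hcont : ContinuousOn f' (Set.Ioi 0)) {d : ℝ}
    (hd : HasDerivAt (fun t : ℝ => traceRe n (H * cfc f (A + t • H))) d 0) : 0 < d := by
  have hs : ContDiffAt ℝ ∞ (fun t : ℝ => A + t • H) 0 := by fun_prop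
  have hherm : ∀ t : ℝ, (A + t • H).IsHermitian := isHermitian_line hA.isHermitian hH
  have hpos : ∀ᶠ t : ℝ in 𝓝 0, (A + t • H).PosDef :=
    eventually_posDef hs.continuousAt (Eventually.of_forall hherm) (by simpa using hA)
  obtain ⟨δ, R, hδ, hev⟩ := exists_eigenvalue_bounds hpos hs
  obtain ⟨m, hm, hmf⟩ : ∃ m, 0 < m ∧ ∀ x ∈ Set.Icc δ R, m ≤ f' x := by
    have hsub : Set.Icc δ R ⊆ Set.Ioi 0 := fun x hx => hδ.trans_le hx.1
    rcases (Set.Icc δ R).eq_empty_or_nonempty with he | hne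
    · exact ⟨1, one_pos, fun x hx => by simp [he] at hx⟩
    · obtain ⟨x₀, hx₀, hmin⟩ := isCompact_Icc.exists_isMinOn hne (hcont.mono hsub)
      exact ⟨f' x₀, hf' x₀ (hsub hx₀), fun x hx => hmin hx⟩
  have hinc : ∀ {x y : ℝ}, x ∈ Set.Icc δ R → y ∈ Set.Icc δ R → x ≤ y →
      m * (y - x) ≤ f y - f x := fun {x y} hx hy hxy =>
    (convex_Icc δ R).mul_sub_le_image_sub_of_le_deriv
      (fun t ht => (hf t (hδ.trans_le ht.1)).continuousAt.continuousWithinAt)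
      (fun t ht => (hf t (hδ.trans_le (interior_subset ht).1)).differentiableAt.differentiableWithinAt)
      (fun t ht => by
        rw [(hf t (hδ.trans_le (interior_subset ht).1)).deriv]
        exact hmf t (interior_subset ht)) x hx y hy hxy
  have hinc2 : ∀ {x y : ℝ}, x ∈ Set.Icc δ R → y ∈ Set.Icc δ R →
      m * (y - x) ^ 2 ≤ (y - x) * (f y - f x) := fun {x y} hx hy => by
    rcases le_total x y with h | h
    · have := mul_le_mul_of_nonneg_left (hinc hx hy h) (sub_nonneg.2 h)
      linarith
    · have := mul_le_mul_of_nonneg_left (hinc hy hx h) (sub_nonneg.2 h)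
      linarith
  have h0 := hev.self_of_nhds
  simp only [zero_smul, add_zero] at h0
  have key : m * (H * H).trace.re ≤ d := by
    refine le_deriv_of_eventually hd ?_
    filter_upwards [hev.filter_mono nhdsWithin_le_nhds, self_mem_nhdsWithin] with t ht (ht0 : 0 < t)
    have h1 := trace_increment_ge hA.isHermitian (hherm t) f m fun a b =>
      hinc2 (h0 _ (hA.isHermitian.eigenvalues_mem_spectrum_real a))
        (ht _ ((hherm t).eigenvalues_mem_spectrum_real b))
    rw [add_sub_cancel_left] at h1
    simp only [smul_mul_assoc, mul_smul_comm, Matrix.trace_smul, Complex.smul_re,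
      smul_eq_mul] at h1
    simp only [zero_smul, add_zero]
    rw [← map_sub, ← mul_sub, traceRe_apply]
    refine le_of_mul_le_mul_left ?_ ht0
    linarith
  exact (mul_pos hm (trace_mul_self_pos hH hne)).trans_le key

theorem trace_mul_deriv_mlog_pos {A H : Matrix (Fin n) (Fin n) ℂ} (hA : A.PosDef)
    (hH : H.IsHermitian) (hne : H ≠ 0) {d : ℝ}
    (hd : HasDerivAt (fun t : ℝ => traceRe n (H * mlog (A + t • H))) d 0) : 0 < d :=
  trace_mul_deriv_cfc_pos hA hH hne (f := Real.log) (f' := fun x => x⁻¹)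
    (fun _ hx => Real.hasDerivAt_log hx.ne') (fun _ hx => inv_pos.2 hx)
    (continuousOn_inv₀.mono fun _ hx => ne_of_gt hx) hd

theorem trace_mul_deriv_mpow_pos {A H : Matrix (Fin n) (Fin n) ℂ} (hA : A.PosDef)
    (hH : H.IsHermitian) (hne : H ≠ 0) {p d : ℝ} (hp : p ≠ 0)
    (hd : HasDerivAt (fun t : ℝ => traceRe n (H * mpow (A + t • H) p)) d 0) : 0 < p * d := by
  refine trace_mul_deriv_cfc_pos hA hH hne (f := fun x => p * x ^ p)
    (f' := fun x => p * (p * x ^ (p - 1)))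
    (fun x hx => (Real.hasDerivAt_rpow_const (Or.inl hx.ne')).const_mul p)
    (fun x hx => ?_) ?_ ?_
  · rw [← mul_assoc]
    exact mul_pos (mul_self_pos.2 hp) (Real.rpow_pos_of_pos hx _)
  · exact continuousOn_const.mul (continuousOn_const.mul
      (continuousOn_id.rpow_const fun x hx => Or.inl (ne_of_gt hx)))
  · have e : ∀ A : Matrix (Fin n) (Fin n) ℂ, cfc (fun x : ℝ => p * x ^ p) A = p • mpow A p :=
      fun A => cfc_const_mul p _ A (continuousOn_spectrum _ _)
    simp only [e, mul_smul_comm, map_smul, smul_eq_mul]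
    exact hd.const_mul p

end TraceDerivatives

/-! ### The sandwiched quasi-entropy in the global chart -/

section Chart

variable {n : ℕ}

theorem isHermitian_tangent (v : Tangent n) : (v : Matrix (Fin n) (Fin n) ℂ).IsHermitian := v.2.1

theorem isHermitian_toMatrix (x : Tangent n) : (toMatrix x).IsHermitian :=
  Matrix.IsHermitian.add (by simp [Matrix.IsHermitian, Matrix.conjTranspose_smul])
    (isHermitian_tangent x)

theorem trace_toMatrix (hn : n ≠ 0) (x : Tangent n) : (toMatrix x).trace = 1 := by
  have : (n : ℂ) ≠ 0 := by exact_mod_cast hn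
  have hx : (x : Matrix (Fin n) (Fin n) ℂ).trace = 0 := x.2.2
  simp [toMatrix, Matrix.trace_add, Matrix.trace_smul, hx, this]

theorem mem_stateDomain (hn : n ≠ 0) {x : Tangent n} :
    x ∈ stateDomain n ↔ (toMatrix x).PosDef :=
  ⟨fun h => h.1, fun h => ⟨h, trace_toMatrix hn x⟩⟩

theorem contDiff_toMatrix : ContDiff ℝ ∞ (toMatrix : Tangent n → Matrix (Fin n) (Fin n) ℂ) :=
  contDiff_const.add (Tangent n).subtypeL.contDiff

theorem toMatrix_line (x v : Tangent n) (t : ℝ) :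
    toMatrix (x + t • v) = toMatrix x + t • (v : Matrix (Fin n) (Fin n) ℂ) := by
  simp [toMatrix, add_assoc]

theorem isOpen_stateDomain (hn : n ≠ 0) : IsOpen (stateDomain n) := by
  rw [isOpen_iff_mem_nhds]
  intro x hx
  filter_upwards [eventually_posDef contDiff_toMatrix.continuous.continuousAt
    (Eventually.of_forall isHermitian_toMatrix) hx.1] with y hy using (mem_stateDomain hn).2 hy

/-- The operator `σ^s ρ σ^s` with `s = (1 - α) / (2 α)`. -/
def sandwich (α : ℝ) (ρ σ : Matrix (Fin n) (Fin n) ℂ) : Matrix (Fin n) (Fin n) ℂ :=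
  mpow σ ((1 - α) / (2 * α)) * ρ * mpow σ ((1 - α) / (2 * α))

theorem isHermitian_conj {A B : Matrix (Fin n) (Fin n) ℂ} (hA : A.IsHermitian)
    (hB : B.IsHermitian) : (A * B * A).IsHermitian := by
  have := Matrix.isHermitian_conjTranspose_mul_mul A hB
  rwa [hA.eq] at this

theorem posDef_conj {A B : Matrix (Fin n) (Fin n) ℂ} (hA : A.PosDef) (hB : B.PosDef) :
    (A * B * A).PosDef := by
  have := hB.conjTranspose_mul_mul_same (B := A)
    (Matrix.mulVec_injective_iff_isUnit.2 hA.isUnit)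
  rwa [hA.isHermitian.eq] at this

theorem posDef_sandwich {ρ σ : Matrix (Fin n) (Fin n) ℂ} (hρ : ρ.PosDef) (hσ : σ.PosDef) (α : ℝ) :
    (sandwich α ρ σ).PosDef := posDef_conj (posDef_mpow hσ _) hρ

theorem isHermitian_sandwich {ρ σ : Matrix (Fin n) (Fin n) ℂ} (hρ : ρ.IsHermitian) (α : ℝ) :
    (sandwich α ρ σ).IsHermitian := isHermitian_conj (isHermitian_mpow _ _) hρ

theorem sandwich_self {ρ : Matrix (Fin n) (Fin n) ℂ} (hρ : ρ.PosDef) {α : ℝ} (hα : α ≠ 0) :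
    sandwich α ρ ρ = mpow ρ (1 / α) := by
  have h1 : mpow ρ ((1 - α) / (2 * α)) * ρ = mpow ρ ((1 - α) / (2 * α) + 1) := by
    rw [← mpow_mul_mpow hρ, mpow_one hρ]
  rw [sandwich, h1, mpow_mul_mpow hρ]
  congr 1
  field_simp
  ring

/-- The trace whose logarithm defines `D_α`, as a function on the square of the chart domain. -/
def quasi (n : ℕ) (α : ℝ) (z : Tangent n × Tangent n) : ℝ :=
  traceRe n (mpow (sandwich α (toMatrix z.1) (toMatrix z.2)) α)

theorem contDiffAt_sandwich (α : ℝ) {z : Tangent n × Tangent n}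
    (hz : z ∈ stateDomain n ×ˢ stateDomain n) :
    ContDiffAt ℝ ∞ (fun z : Tangent n × Tangent n =>
      sandwich α (toMatrix z.1) (toMatrix z.2)) z := by
  have h1 : ContDiffAt ℝ ∞ (fun z : Tangent n × Tangent n => toMatrix z.1) z :=
    (contDiff_toMatrix.comp contDiff_fst).contDiffAt
  have h2 : ContDiffAt ℝ ∞ (fun z : Tangent n × Tangent n => toMatrix z.2) z :=
    (contDiff_toMatrix.comp contDiff_snd).contDiffAt
  have h3 := contDiffAt_mpow (s := fun _ => (1 - α) / (2 * α)) h2 contDiffAt_const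
    (Eventually.of_forall fun z => isHermitian_toMatrix _) hz.2.1
  exact (h3.mul h1).mul h3

theorem contDiffOn_quasi (α : ℝ) :
    ContDiffOn ℝ ∞ (quasi n α) (stateDomain n ×ˢ stateDomain n) := fun z hz => by
  refine ContDiffAt.contDiffWithinAt ?_
  exact (traceRe n).contDiff.contDiffAt.comp z (contDiffAt_mpow (contDiffAt_sandwich α hz)
    contDiffAt_const (Eventually.of_forall fun z => isHermitian_sandwich (isHermitian_toMatrix _) α)
    (posDef_sandwich hz.1.1 hz.2.1 α))

theorem quasi_pos (hn : n ≠ 0) (α : ℝ) {z : Tangent n × Tangent n}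
    (hz : z ∈ stateDomain n ×ˢ stateDomain n) : 0 < quasi n α z := by
  have : Nonempty (Fin n) := ⟨⟨0, Nat.pos_of_ne_zero hn⟩⟩
  have h := (posDef_mpow (posDef_sandwich hz.1.1 hz.2.1 α) α).trace_pos
  exact (Complex.pos_iff.1 h).1

theorem quasi_self (hn : n ≠ 0) {α : ℝ} (hα : α ≠ 0) {x : Tangent n} (hx : x ∈ stateDomain n) :
    quasi n α (x, x) = 1 := by
  simp only [quasi]
  rw [sandwich_self hx.1 hα, mpow_mpow hx.1, one_div_mul_cancel hα, mpow_one hx.1, traceRe_apply,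
    trace_toMatrix hn, Complex.one_re]

theorem sandwich_line (α t : ℝ) (x y v : Tangent n) :
    sandwich α (toMatrix (x + t • v)) (toMatrix y) = sandwich α (toMatrix x) (toMatrix y)
      + t • sandwich α (v : Matrix (Fin n) (Fin n) ℂ) (toMatrix y) := by
  rw [toMatrix_line]
  simp [sandwich, mul_add, add_mul]

/-- The derivative of the quasi-entropy in its first argument, in which the sandwich is linear. -/
theorem fderiv_quasi_left (hn : n ≠ 0) {α : ℝ} (hα0 : α ≠ 0) (hα1 : α ≠ 1) {x y : Tangent n}
    (hx : x ∈ stateDomain n) (hy : y ∈ stateDomain n) (v : Tangent n) :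
    fderiv ℝ (quasi n α) (x, y) (v, 0)
      = α * traceRe n (mpow (sandwich α (toMatrix x) (toMatrix y)) (α - 1)
        * sandwich α (v : Matrix (Fin n) (Fin n) ℂ) (toMatrix y)) := by
  have hU := isOpen_stateDomain hn
  set H := sandwich α (v : Matrix (Fin n) (Fin n) ℂ) (toMatrix y) with hH
  set M := sandwich α (toMatrix x) (toMatrix y) with hM
  have h1 := hasDerivAt_line0 (hU.prod hU) (contDiffOn_quasi α) (z := (x, y)) ⟨hx, hy⟩ (v, 0)
  have hMt : HasDerivAt (fun t : ℝ => M + t • H) H 0 := by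
    simpa using ((hasDerivAt_id (0 : ℝ)).smul_const H).const_add M
  have hs : ContDiffAt ℝ ∞ (fun t : ℝ => M + t • H) 0 := by fun_prop
  have hpos : ∀ᶠ t : ℝ in 𝓝 0, (M + t • H).PosDef := by
    refine eventually_posDef hs.continuousAt (Eventually.of_forall fun t => ?_) ?_
    · exact isHermitian_line (isHermitian_sandwich (isHermitian_toMatrix x) α)
        (isHermitian_sandwich (isHermitian_tangent v) α) t
    · simpa using posDef_sandwich hx.1 hy.1 α
  have h2 := hasDerivAt_trace_mpow hα0 hα1 hMt hpos hs
  refine deriv_unique_of_eventually h1 (by simpa using h2) (Eventually.of_forall fun t => ?_)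
  simp only [quasi, Prod.fst_add, Prod.smul_fst, Prod.snd_add, Prod.smul_snd, smul_zero, add_zero]
  rw [sandwich_line]

theorem fderiv_quasi_diag (hn : n ≠ 0) {α : ℝ} (hα0 : α ≠ 0) (hα1 : α ≠ 1) {x : Tangent n}
    (hx : x ∈ stateDomain n) (v : Tangent n) : fderiv ℝ (quasi n α) (x, x) (v, 0) = 0 := by
  rw [fderiv_quasi_left hn hα0 hα1 hx hx, sandwich_self hx.1 hα0, mpow_mpow hx.1, traceRe_apply,
    sandwich, ← mul_assoc, Matrix.trace_mul_comm, ← mul_assoc, ← mul_assoc, mpow_mul_mpow hx.1,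
    mpow_mul_mpow hx.1]
  have e : (1 - α) / (2 * α) + 1 / α * (α - 1) + (1 - α) / (2 * α) = 0 := by field_simp; ring
  have hv : (v : Matrix (Fin n) (Fin n) ℂ).trace = 0 := v.2.2
  rw [e, mpow_zero hx.1, one_mul, hv]
  simp

theorem sandwich_ne_zero {A σ : Matrix (Fin n) (Fin n) ℂ} (hσ : σ.PosDef) (hA : A ≠ 0) (α : ℝ) :
    sandwich α A σ ≠ 0 := fun h => hA <| by
  set s := (1 - α) / (2 * α)
  have e : mpow σ (-s) * sandwich α A σ * mpow σ (-s) = A := by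
    have e1 : mpow σ (-s) * mpow σ s = 1 := by rw [mpow_mul_mpow hσ, neg_add_cancel, mpow_zero hσ]
    have e2 : mpow σ s * mpow σ (-s) = 1 := by rw [mpow_mul_mpow hσ, add_neg_cancel, mpow_zero hσ]
    calc mpow σ (-s) * (mpow σ s * A * mpow σ s) * mpow σ (-s)
        = (mpow σ (-s) * mpow σ s) * A * (mpow σ s * mpow σ (-s)) := by simp only [mul_assoc]
      _ = A := by rw [e1, e2, one_mul, mul_one]
  rw [← e, h]; simp

theorem d2_quasi_pos (hn : n ≠ 0) {α : ℝ} (hα0 : α ≠ 0) (hα1 : α ≠ 1) {x : Tangent n}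
    (hx : x ∈ stateDomain n) {v : Tangent n} (hv : v ≠ 0) :
    0 < 1 / (α * (α - 1)) * d2 (quasi n α) (x, x) (v, 0) (v, 0) := by
  have hU := isOpen_stateDomain hn
  have h1 := hasDerivAt_line1 (hU.prod hU) (contDiffOn_quasi α) (z := (x, x)) ⟨hx, hx⟩ (v, 0)
    (v, 0)
  have hp : α - 1 ≠ 0 := sub_ne_zero.2 hα1
  set H := sandwich α (v : Matrix (Fin n) (Fin n) ℂ) (toMatrix x) with hH
  set M := sandwich α (toMatrix x) (toMatrix x) with hM
  have hHne : H ≠ 0 := sandwich_ne_zero hx.1 (fun h => hv (Subtype.ext h)) α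
  have h2 : HasDerivAt (fun t : ℝ => traceRe n (H * mpow (M + t • H) (α - 1)))
      (α⁻¹ * d2 (quasi n α) (x, x) (v, 0) (v, 0)) 0 := by
    refine (h1.const_mul α⁻¹).congr_of_eventuallyEq ?_
    filter_upwards [eventually_line_mem (hU.prod hU) (z := (x, x)) ⟨hx, hx⟩ (v, 0)] with t ht
    have e : (x, x) + t • (v, (0 : Tangent n)) = (x + t • v, x) := by simp
    rw [e] at ht ⊢
    rw [fderiv_quasi_left hn hα0 hα1 ht.1 hx, sandwich_line, inv_mul_cancel_left₀ hα0,
      traceRe_apply, traceRe_apply, Matrix.trace_mul_comm]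
  have h3 := trace_mul_deriv_mpow_pos (posDef_sandwich hx.1 hx.1 α)
    (isHermitian_sandwich (isHermitian_tangent v) α) hHne hp h2
  have h4 : 1 / (α * (α - 1)) * d2 (quasi n α) (x, x) (v, 0) (v, 0)
      = ((α - 1) * (α⁻¹ * d2 (quasi n α) (x, x) (v, 0) (v, 0))) * ((α - 1)⁻¹ * (α - 1)⁻¹) := by
    field_simp
  rw [h4]
  exact mul_pos h3 (mul_self_pos.2 (inv_ne_zero hp))

theorem chartDiv_eq {α : ℝ} (hα1 : α ≠ 1) (z : Tangent n × Tangent n) :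
    Function.uncurry (chartDiv n α) z = 1 / (α * (α - 1)) * Real.log (quasi n α z) := by
  simp only [Function.uncurry, chartDiv, renyiDiv, if_neg hα1]
  rfl

theorem isContrast_chartDiv (hn : n ≠ 0) {α : ℝ} (hα0 : α ≠ 0) (hα1 : α ≠ 1) :
    IsContrast (stateDomain n) (chartDiv n α) := by
  have hU := isOpen_stateDomain hn
  have hUU := hU.prod hU
  set κ := 1 / (α * (α - 1)) with hκ
  have hQ := contDiffOn_quasi (n := n) α
  have hsm : ContDiffOn ℝ ∞ (Function.uncurry (chartDiv n α)) (stateDomain n ×ˢ stateDomain n) := by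
    refine ContDiffOn.congr ?_ fun z _ => chartDiv_eq hα1 z
    exact contDiffOn_const.mul (hQ.log fun z hz => (quasi_pos hn α hz).ne')
  have hfd : ∀ z ∈ stateDomain n ×ˢ stateDomain n, ∀ a,
      fderiv ℝ (Function.uncurry (chartDiv n α)) z a
        = κ * (fderiv ℝ (quasi n α) z a / quasi n α z) := fun z hz a => by
    refine deriv_unique_of_eventually (hasDerivAt_line0 hUU hsm hz a)
      (g := fun t => κ * Real.log (quasi n α (z + t • a))) ?_
      (Eventually.of_forall fun t => chartDiv_eq hα1 _)
    have h1 := (hasDerivAt_line0 hUU hQ hz a).log (by simpa using (quasi_pos hn α hz).ne')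
    simpa using h1.const_mul κ
  refine ⟨hU, hsm, fun x hx => ?_, fun x hx v => ?_, fun x hx v hv => ?_⟩
  · change Function.uncurry (chartDiv n α) (x, x) = 0
    rw [chartDiv_eq hα1, quasi_self hn hα0 hx]; simp
  · rw [hfd _ ⟨hx, hx⟩, fderiv_quasi_diag hn hα0 hα1 hx]; simp
  · have h := d2_quasi_pos hn hα0 hα1 hx hv
    convert h using 1
    refine deriv_unique_of_eventually
      (hasDerivAt_line1 hUU hsm (z := (x, x)) ⟨hx, hx⟩ (v, 0) (v, 0))
      (g := fun t => κ * (fderiv ℝ (quasi n α) ((x, x) + t • (v, 0)) (v, 0)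
        / quasi n α ((x, x) + t • (v, 0)))) ?_ ?_
    · have h1 := ((hasDerivAt_line1 hUU hQ (z := (x, x)) ⟨hx, hx⟩ (v, 0) (v, 0)).div
        (hasDerivAt_line0 hUU hQ (z := (x, x)) ⟨hx, hx⟩ (v, 0))
        (by simp [quasi_self hn hα0 hx])).const_mul κ
      exact h1.congr_deriv (by simp [hκ, quasi_self hn hα0 hx, fderiv_quasi_diag hn hα0 hα1 hx])
    · filter_upwards [eventually_line_mem hUU (z := (x, x)) ⟨hx, hx⟩ (v, 0)] with t ht
        using hfd _ ht _

end Chart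

/-! ### The limit at one and the Umegaki relative entropy -/

section Limit

variable {n : ℕ}

/-- The derivative at `β = 1` of the trace in the definition of `D_β`, as the sum of the
contributions of the two occurrences of `β`. -/
theorem hasDerivAt_trace_sandwich {ρ σ : Matrix (Fin n) (Fin n) ℂ} (hρ : ρ.PosDef)
    (hσ : σ.PosDef) :
    HasDerivAt (fun β : ℝ => traceRe n (mpow (sandwich β ρ σ) β)) (umegaki ρ σ) 1 := by
  set h : ℝ × ℝ → ℝ := fun z => traceRe n (mpow (sandwich z.2 ρ σ) z.1) with hh
  have hs : ContDiffAt ℝ ∞ (fun z : ℝ × ℝ => (1 - z.2) / (2 * z.2)) (1, 1) :=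
    (contDiffAt_const.sub contDiffAt_snd).div (contDiffAt_const.mul contDiffAt_snd) (by simp)
  have hm : ContDiffAt ℝ ∞ (fun z : ℝ × ℝ => mpow σ ((1 - z.2) / (2 * z.2))) (1, 1) :=
    contDiffAt_mpow contDiffAt_const hs (Eventually.of_forall fun _ => hσ.isHermitian) hσ
  have hsand : ContDiffAt ℝ ∞ (fun z : ℝ × ℝ => sandwich z.2 ρ σ) (1, 1) :=
    (hm.mul contDiffAt_const).mul hm
  have hc : ContDiffAt ℝ ∞ h (1, 1) :=
    (traceRe n).contDiff.contDiffAt.comp (1, 1) (contDiffAt_mpow hsand contDiffAt_fst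
      (Eventually.of_forall fun z => isHermitian_sandwich hρ.isHermitian _)
      (posDef_sandwich hρ hσ _))
  have hd := (hc.differentiableAt (by simp)).hasFDerivAt
  have sand1 : sandwich 1 ρ σ = ρ := by
    simp [sandwich, mpow_zero hσ]
  -- the derivative with respect to the exponent outside the sandwich
  have d1 : fderiv ℝ h (1, 1) (1, 0) = traceRe n (ρ * mlog ρ) := by
    have e1 : HasDerivAt (fun t : ℝ => h (t, 1)) (fderiv ℝ h (1, 1) (1, 0)) 1 :=
      hd.comp_hasDerivAt (f := fun t : ℝ => (t, (1 : ℝ))) (1 : ℝ)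
        ((hasDerivAt_id (1 : ℝ)).prodMk (hasDerivAt_const (1 : ℝ) (1 : ℝ)))
    have e2 : HasDerivAt (fun t : ℝ => traceRe n (NormedSpace.exp (t • mlog ρ)))
        (traceRe n (NormedSpace.exp ((1 : ℝ) • mlog ρ) * mlog ρ)) 1 :=
      (traceRe n).hasFDerivAt.comp_hasDerivAt (1 : ℝ) (hasDerivAt_exp_smul_const (mlog ρ) (1 : ℝ))
    rw [one_smul, exp_mlog hρ] at e2
    exact deriv_unique_of_eventually e1 e2 (Eventually.of_forall fun t => by
      simp only [hh]; rw [sand1, mpow_eq_exp hρ])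
  -- the derivative with respect to the parameter of the sandwich
  have d2 : fderiv ℝ h (1, 1) (0, 1) = -traceRe n (ρ * mlog σ) := by
    have e1 : HasDerivAt (fun t : ℝ => h (1, t)) (fderiv ℝ h (1, 1) (0, 1)) 1 :=
      hd.comp_hasDerivAt (f := fun t : ℝ => ((1 : ℝ), t)) (1 : ℝ)
        ((hasDerivAt_const (1 : ℝ) (1 : ℝ)).prodMk (hasDerivAt_id (1 : ℝ)))
    have es : HasDerivAt (fun t : ℝ => (1 - t) / t) (-1) 1 := by
      have := ((hasDerivAt_id (1 : ℝ)).const_sub 1).fun_div (hasDerivAt_id (1 : ℝ)) (by simp)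
      simpa using this
    have e0 : HasDerivAt (fun u : ℝ => NormedSpace.exp (u • mlog σ))
        (NormedSpace.exp ((0 : ℝ) • mlog σ) * mlog σ) ((1 - (1 : ℝ)) / 1) := by
      simpa using hasDerivAt_exp_smul_const (mlog σ) (0 : ℝ)
    have e2 : HasDerivAt (fun t : ℝ => traceRe n (ρ * NormedSpace.exp (((1 - t) / t) • mlog σ)))
        (traceRe n (ρ * ((-1 : ℝ) • (NormedSpace.exp ((0 : ℝ) • mlog σ) * mlog σ)))) 1 :=
      (traceRe n).hasFDerivAt.comp_hasDerivAt (1 : ℝ)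
        ((HasDerivAt.scomp (h := fun t : ℝ => (1 - t) / t) (1 : ℝ) e0 es).const_mul ρ)
    have e3 := deriv_unique_of_eventually e1 e2 (by
      filter_upwards [eventually_ne_nhds one_ne_zero] with t ht
      simp only [hh]
      rw [mpow_one (posDef_sandwich hρ hσ t), traceRe_apply, traceRe_apply, sandwich,
        Matrix.trace_mul_comm, ← mul_assoc, mpow_mul_mpow hσ, Matrix.trace_mul_comm,
        mpow_eq_exp hσ]
      congr 6
      field_simp
      ring)
    rw [e3]
    simp
  have h3 : HasDerivAt (fun t : ℝ => h (t, t)) (fderiv ℝ h (1, 1) (1, 1)) 1 :=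
    hd.comp_hasDerivAt (f := fun t : ℝ => (t, t)) (1 : ℝ)
      ((hasDerivAt_id (1 : ℝ)).prodMk (hasDerivAt_id (1 : ℝ)))
  have e : ((1, 1) : ℝ × ℝ) = (1, 0) + (0, 1) := by simp
  have h4 : fderiv ℝ h (1, 1) (1, 1) = umegaki ρ σ := by
    have : fderiv ℝ h (1, 1) (1, 1) = fderiv ℝ h (1, 1) (1, 0) + fderiv ℝ h (1, 1) (0, 1) := by
      rw [← map_add]; simp
    rw [this, d1, d2, umegaki, ← traceRe_apply, mul_sub, map_sub, sub_eq_add_neg]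
  rw [h4] at h3
  exact h3

theorem tendsto_sandwichedRenyi {ρ σ : Matrix (Fin n) (Fin n) ℂ} (hρ : ρ ∈ stateSpace n)
    (hσ : σ ∈ stateSpace n) :
    Tendsto (fun β => sandwichedRenyi β ρ σ) (𝓝[≠] 1) (𝓝 (umegaki ρ σ)) := by
  have h1 := hasDerivAt_trace_sandwich hρ.1 hσ.1
  have e1 : traceRe n (mpow (sandwich 1 ρ σ) 1) = 1 := by
    rw [mpow_one (posDef_sandwich hρ.1 hσ.1 1)]
    simp [sandwich, mpow_zero hσ.1, traceRe_apply, hρ.2]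
  have h2 := h1.log (by rw [e1]; exact one_ne_zero)
  rw [e1, div_one, hasDerivAt_iff_tendsto_slope] at h2
  have h3 : Tendsto (fun β : ℝ => β⁻¹) (𝓝[≠] 1) (𝓝 1) := by
    have : ContinuousAt (fun β : ℝ => β⁻¹) 1 := continuousAt_inv₀ one_ne_zero
    simpa using this.tendsto.mono_left nhdsWithin_le_nhds
  have h4 := h3.mul h2
  rw [one_mul] at h4
  refine h4.congr fun β => ?_
  rw [slope_def_field, e1, Real.log_one, sub_zero, sandwichedRenyi, ← traceRe_apply]
  change _ = 1 / (β * (β - 1)) * Real.log (traceRe n (mpow (sandwich β ρ σ) β))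
  rw [one_div, mul_inv]
  ring

theorem renyiDiv_one {ρ σ : Matrix (Fin n) (Fin n) ℂ} (hρ : ρ ∈ stateSpace n)
    (hσ : σ ∈ stateSpace n) : renyiDiv 1 ρ σ = umegaki ρ σ := by
  rw [renyiDiv, if_pos rfl]
  exact (tendsto_sandwichedRenyi hρ hσ).limUnder_eq

theorem tendsto_renyiDiv {ρ σ : Matrix (Fin n) (Fin n) ℂ} (hρ : ρ ∈ stateSpace n)
    (hσ : σ ∈ stateSpace n) :
    Tendsto (fun β => renyiDiv β ρ σ) (𝓝[≠] 1) (𝓝 (renyiDiv 1 ρ σ)) := by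
  rw [renyiDiv_one hρ hσ]
  refine (tendsto_sandwichedRenyi hρ hσ).congr' ?_
  filter_upwards [self_mem_nhdsWithin] with β (hβ : β ≠ 1)
  rw [renyiDiv, if_neg hβ]

end Limit

section Umegaki

variable {n : ℕ}

theorem chartDiv_one_eq {z : Tangent n × Tangent n}
    (hz : z ∈ stateDomain n ×ˢ stateDomain n) :
    Function.uncurry (chartDiv n 1) z
      = traceRe n (toMatrix z.1 * (mlog (toMatrix z.1) - mlog (toMatrix z.2))) :=
  renyiDiv_one hz.1 hz.2

theorem contDiffAt_mlog_toMatrix {x : Tangent n} (hx : x ∈ stateDomain n) :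
    ContDiffAt ℝ ∞ (fun x : Tangent n => mlog (toMatrix x)) x :=
  contDiffAt_mlog contDiff_toMatrix.contDiffAt (Eventually.of_forall isHermitian_toMatrix) hx.1

theorem contDiffOn_chartDiv_one : ContDiffOn ℝ ∞ (Function.uncurry (chartDiv n 1))
    (stateDomain n ×ˢ stateDomain n) := by
  refine ContDiffOn.congr (fun z hz => ContDiffAt.contDiffWithinAt ?_) fun z hz =>
    chartDiv_one_eq hz
  have h1 : ContDiffAt ℝ ∞ (fun z : Tangent n × Tangent n => toMatrix z.1) z :=
    (contDiff_toMatrix.comp contDiff_fst).contDiffAt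
  have h2 : ContDiffAt ℝ ∞ (fun z : Tangent n × Tangent n => mlog (toMatrix z.1)) z :=
    (contDiffAt_mlog_toMatrix hz.1).comp z contDiffAt_fst
  have h3 : ContDiffAt ℝ ∞ (fun z : Tangent n × Tangent n => mlog (toMatrix z.2)) z :=
    (contDiffAt_mlog_toMatrix hz.2).comp z contDiffAt_snd
  exact (traceRe n).contDiff.contDiffAt.comp z (h1.mul (h2.sub h3))

theorem hasDerivAt_toMatrix_line (x v : Tangent n) :
    HasDerivAt (fun t : ℝ => toMatrix (x + t • v)) (v : Matrix (Fin n) (Fin n) ℂ) 0 := by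
  simp only [toMatrix_line]
  simpa using ((hasDerivAt_id (0 : ℝ)).smul_const (v : Matrix (Fin n) (Fin n) ℂ)).const_add
    (toMatrix x)

theorem contDiffAt_toMatrix_line (x v : Tangent n) :
    ContDiffAt ℝ ∞ (fun t : ℝ => toMatrix (x + t • v)) 0 := by
  simp only [toMatrix_line]
  fun_prop

theorem eventually_mem_line (hn : n ≠ 0) {x : Tangent n} (hx : x ∈ stateDomain n) (v : Tangent n) :
    ∀ᶠ t : ℝ in 𝓝 0, x + t • v ∈ stateDomain n := eventually_line_mem (isOpen_stateDomain hn) hx v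

theorem fderiv_chartDiv_one_left (hn : n ≠ 0) {x y : Tangent n} (hx : x ∈ stateDomain n)
    (hy : y ∈ stateDomain n) (v : Tangent n) :
    fderiv ℝ (Function.uncurry (chartDiv n 1)) (x, y) (v, 0)
      = traceRe n ((v : Matrix (Fin n) (Fin n) ℂ) * mlog (toMatrix x))
        - traceRe n ((v : Matrix (Fin n) (Fin n) ℂ) * mlog (toMatrix y)) := by
  have hU := isOpen_stateDomain hn
  have hev := eventually_mem_line hn hx v
  have h1 := hasDerivAt_trace_mul_mlog (hasDerivAt_toMatrix_line x v) (hev.mono fun _ h => h.1)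
    (contDiffAt_toMatrix_line x v)
  have h2 : HasDerivAt (fun t : ℝ => traceRe n (toMatrix (x + t • v) * mlog (toMatrix y)))
      (traceRe n ((v : Matrix (Fin n) (Fin n) ℂ) * mlog (toMatrix y))) 0 :=
    (traceRe n).hasFDerivAt.comp_hasDerivAt (0 : ℝ)
      ((hasDerivAt_toMatrix_line x v).mul_const (mlog (toMatrix y)))
  have h3 := deriv_unique_of_eventually (hasDerivAt_line0 (hU.prod hU) contDiffOn_chartDiv_one
    (z := (x, y)) ⟨hx, hy⟩ (v, 0)) (h1.fun_sub h2) (by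
      filter_upwards [hev] with t ht
      have e : (x, y) + t • (v, (0 : Tangent n)) = (x + t • v, y) := by simp
      rw [e, chartDiv_one_eq ⟨ht, hy⟩, mul_sub, map_sub])
  have hv : (v : Matrix (Fin n) (Fin n) ℂ).trace = 0 := v.2.2
  rw [h3, zero_smul, add_zero, add_mul, one_mul, map_add, traceRe_apply, traceRe_apply _,
    Matrix.trace_mul_comm, hv]
  simp [traceRe_apply]

theorem isContrast_chartDiv_one (hn : n ≠ 0) : IsContrast (stateDomain n) (chartDiv n 1) := by
  have hU := isOpen_stateDomain hn
  refine ⟨hU, contDiffOn_chartDiv_one, fun x hx => ?_, fun x hx v => ?_, fun x hx v hv => ?_⟩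
  · have := chartDiv_one_eq (z := (x, x)) ⟨hx, hx⟩
    simpa using this
  · rw [fderiv_chartDiv_one_left hn hx hx, sub_self]
  · refine trace_mul_deriv_mlog_pos hx.1 (isHermitian_tangent v) (fun h => hv (Subtype.ext h)) ?_
    have h1 := hasDerivAt_line1 (hU.prod hU) contDiffOn_chartDiv_one (z := (x, x)) ⟨hx, hx⟩ (v, 0)
      (v, 0)
    have h2 := h1.add_const (traceRe n ((v : Matrix (Fin n) (Fin n) ℂ) * mlog (toMatrix x)))
    refine h2.congr_of_eventuallyEq ?_
    filter_upwards [eventually_mem_line hn hx v] with t ht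
    have e : (x, x) + t • (v, (0 : Tangent n)) = (x + t • v, x) := by simp
    rw [e, fderiv_chartDiv_one_left hn ht hx, toMatrix_line]
    ring

/-- The relative entropy is affine in its first argument up to a function of that argument alone,
so its mixed third derivative vanishes. -/
theorem d3_chartDiv_one (hn : n ≠ 0) {x : Tangent n} (hx : x ∈ stateDomain n)
    (a b c : Tangent n) :
    d3 (Function.uncurry (chartDiv n 1)) (x, x) (a, 0) (b, 0) (0, c) = 0 := by
  have hU := isOpen_stateDomain hn
  have hUU := hU.prod hU
  have hsm := contDiffOn_chartDiv_one (n := n)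
  have hB : DifferentiableAt ℝ (fun t : ℝ => traceRe n ((b : Matrix (Fin n) (Fin n) ℂ)
      * mlog (toMatrix (x + t • c)))) 0 := by
    have h1 : ContDiffAt ℝ ∞ (fun t : ℝ => mlog (toMatrix (x + t • c))) 0 :=
      contDiffAt_mlog (contDiffAt_toMatrix_line x c)
        (Eventually.of_forall fun t => isHermitian_toMatrix _) (by simpa using hx.1)
    exact ((traceRe n).contDiff.contDiffAt.comp (0 : ℝ)
      (contDiffAt_const.mul h1)).differentiableAt (by simp)
  set L := deriv (fun t : ℝ => traceRe n ((b : Matrix (Fin n) (Fin n) ℂ)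
      * mlog (toMatrix (x + t • c)))) 0 with hL
  -- the mixed second derivative does not depend on the first argument
  have hmix : ∀ x' ∈ stateDomain n,
      d2 (Function.uncurry (chartDiv n 1)) (x', x) (0, c) (b, 0) = -L := fun x' hx' => by
    refine deriv_unique_of_eventually (hasDerivAt_line1 hUU hsm (z := (x', x)) ⟨hx', hx⟩ (0, c)
      (b, 0)) (hB.hasDerivAt.const_sub
        (traceRe n ((b : Matrix (Fin n) (Fin n) ℂ) * mlog (toMatrix x')))) ?_
    filter_upwards [eventually_mem_line hn hx c] with t ht
    have e : (x', x) + t • ((0 : Tangent n), c) = (x', x + t • c) := by simp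
    rw [e, fderiv_chartDiv_one_left hn hx' ht]
  rw [d3_symm_right hUU hsm (z := (x, x)) ⟨hx, hx⟩]
  refine deriv_unique_of_eventually (hasDerivAt_line2 hUU hsm (z := (x, x)) ⟨hx, hx⟩ (a, 0) (0, c)
    (b, 0)) (hasDerivAt_const (0 : ℝ) (-L)) ?_
  filter_upwards [eventually_mem_line hn hx a] with t ht
  have e : (x, x) + t • (a, (0 : Tangent n)) = (x + t • a, x) := by simp
  rw [e, hmix _ ht]

end Umegaki

/-! ### Functional calculus under algebra homomorphisms -/

section AlgHom

variable {n m : ℕ}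

/-- On a finite set of reals every function is a polynomial. -/
theorem exists_polynomial_eqOn {s : Set ℝ} (hs : s.Finite) (f : ℝ → ℝ) :
    ∃ p : Polynomial ℝ, ∀ t ∈ s, p.eval t = f t := by
  classical
  refine ⟨Lagrange.interpolate hs.toFinset id f, fun t ht => ?_⟩
  exact Lagrange.eval_interpolate_at_node f Function.injective_id.injOn (hs.mem_toFinset.2 ht)

theorem cfc_eq_aeval {A : Matrix (Fin n) (Fin n) ℂ} (hA : A.IsHermitian) {f : ℝ → ℝ}
    {p : Polynomial ℝ} (hp : ∀ t ∈ spectrum ℝ A, p.eval t = f t) :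
    cfc f A = Polynomial.aeval A p := by
  rw [← cfc_polynomial p A hA]
  exact cfc_congr fun t ht => (hp t ht).symm

/-- The functional calculus commutes with algebra homomorphisms that preserve the given Hermitian
matrix. -/
theorem map_cfc_of_algHom (θ : Matrix (Fin n) (Fin n) ℂ →ₐ[ℝ] Matrix (Fin n) (Fin n) ℂ)
    {A : Matrix (Fin n) (Fin n) ℂ} (hA : A.IsHermitian) (hθ : (θ A).IsHermitian) (f : ℝ → ℝ) :
    θ (cfc f A) = cfc f (θ A) := by
  obtain ⟨p, hp⟩ := exists_polynomial_eqOn A.finite_real_spectrum f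
  rw [cfc_eq_aeval hA hp,
    cfc_eq_aeval hθ (fun t ht => hp t (AlgHom.spectrum_apply_subset θ A ht)),
    Polynomial.aeval_algHom_apply]

variable {Θ : (Fin m → ℝ) →ₐ[ℝ] Matrix (Fin n) (Fin n) ℂ}

theorem spectrum_frame_subset (Θ : (Fin m → ℝ) →ₐ[ℝ] Matrix (Fin n) (Fin n) ℂ) (d : Fin m → ℝ) :
    spectrum ℝ (Θ d) ⊆ Set.range d := by
  refine (AlgHom.spectrum_apply_subset Θ d).trans ?_
  rw [Pi.spectrum_eq]
  intro t ht
  obtain ⟨i, hi⟩ := Set.mem_iUnion.1 ht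
  refine ⟨i, ?_⟩
  by_contra hne
  refine hi ?_
  change IsUnit _
  rw [isUnit_iff_ne_zero]
  exact sub_ne_zero.2 (Ne.symm hne)

/-- The functional calculus of a matrix in the image of an algebra of functions. Such an image,
here called a frame, is a family of simultaneously diagonalized matrices. -/
theorem cfc_frame {d : Fin m → ℝ} (hd : (Θ d).IsHermitian) (f : ℝ → ℝ) :
    cfc f (Θ d) = Θ fun a => f (d a) := by
  obtain ⟨p, hp⟩ := exists_polynomial_eqOn (Set.finite_range d) f
  rw [cfc_eq_aeval hd fun t ht => hp t (spectrum_frame_subset Θ d ht),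
    Polynomial.aeval_algHom_apply]
  congr 1
  ext a
  rw [Polynomial.aeval_pi_apply₂, Polynomial.coe_aeval_eq_eval]
  exact hp _ ⟨a, rfl⟩

theorem mpow_frame {d : Fin m → ℝ} (hd : (Θ d).IsHermitian) (s : ℝ) :
    mpow (Θ d) s = Θ fun a => d a ^ s := cfc_frame hd _

theorem posDef_frame {d : Fin m → ℝ} (hd : (Θ d).IsHermitian) (hpos : ∀ a, 0 < d a) :
    (Θ d).PosDef := by
  rw [posDef_iff_spectrum hd]
  intro t ht
  obtain ⟨a, rfl⟩ := spectrum_frame_subset Θ d ht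
  exact hpos a

/-- The weight of the index `a` in the trace against `A` of matrices in the image of `Θ`. -/
def frameWeight (Θ : (Fin m → ℝ) →ₐ[ℝ] Matrix (Fin n) (Fin n) ℂ)
    (A : Matrix (Fin n) (Fin n) ℂ) (a : Fin m) : ℝ := traceRe n (Θ (Pi.single a 1) * A)

theorem traceRe_frame_mul (d : Fin m → ℝ) (A : Matrix (Fin n) (Fin n) ℂ) :
    traceRe n (Θ d * A) = ∑ a, frameWeight Θ A a * d a := by
  have h : d = ∑ a, d a • Pi.single (M := fun _ => ℝ) a 1 := by
    ext b
    simp [Finset.sum_apply, Pi.single_apply]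
  conv_lhs => rw [h]
  simp only [map_sum, map_smul, Finset.sum_mul, smul_mul_assoc, smul_eq_mul, frameWeight]
  exact Finset.sum_congr rfl fun a _ => mul_comm _ _

theorem traceRe_frame (d : Fin m → ℝ) : traceRe n (Θ d) = ∑ a, frameWeight Θ 1 a * d a := by
  rw [← traceRe_frame_mul, mul_one]

end AlgHom

/-! ### The quasi-entropy on commuting states -/

section PowSum

variable {m : ℕ}

/-- The sum `∑ c p ^ e q ^ f`. -/
def powSum (c : Fin m → ℝ) (e f : ℝ) (p q : Fin m → ℝ) : ℝ := ∑ a, c a * (p a ^ e * q a ^ f)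

variable (c : Fin m → ℝ) (e f : ℝ) {p q : Fin m → ℝ}

theorem hasDerivAt_rpow_line {r : ℝ} (hr : 0 < r) (u e : ℝ) :
    HasDerivAt (fun t : ℝ => (r + t * u) ^ e) (e * u * r ^ (e - 1)) 0 := by
  have h1 : HasDerivAt (fun t : ℝ => r + t * u) u 0 := by
    simpa using ((hasDerivAt_id (0 : ℝ)).mul_const u).const_add r
  have := h1.rpow_const (p := e) (Or.inl (by simpa using hr.ne'))
  simpa [mul_comm u e] using this

theorem hasDerivAt_powSum_left (hp : ∀ a, 0 < p a) (u : Fin m → ℝ) :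
    HasDerivAt (fun t : ℝ => powSum c e f (p + t • u) q) (e * powSum (c * u) (e - 1) f p q) 0 := by
  have h : HasDerivAt (fun t : ℝ => powSum c e f (p + t • u) q)
      (∑ a, c a * (e * u a * p a ^ (e - 1) * q a ^ f)) 0 :=
    HasDerivAt.fun_sum fun a _ =>
      ((hasDerivAt_rpow_line (hp a) (u a) e).mul_const (q a ^ f)).const_mul (c a)
  refine h.congr_deriv ?_
  rw [powSum, Finset.mul_sum]
  exact Finset.sum_congr rfl fun a _ => by simp only [Pi.mul_apply]; ring

theorem hasDerivAt_powSum_right (hq : ∀ a, 0 < q a) (u : Fin m → ℝ) :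
    HasDerivAt (fun t : ℝ => powSum c e f p (q + t • u)) (f * powSum (c * u) e (f - 1) p q) 0 := by
  have h : HasDerivAt (fun t : ℝ => powSum c e f p (q + t • u))
      (∑ a, c a * (p a ^ e * (f * u a * q a ^ (f - 1)))) 0 :=
    HasDerivAt.fun_sum fun a _ =>
      ((hasDerivAt_rpow_line (hq a) (u a) f).const_mul (p a ^ e)).const_mul (c a)
  refine h.congr_deriv ?_
  rw [powSum, Finset.mul_sum]
  exact Finset.sum_congr rfl fun a _ => by simp only [Pi.mul_apply]; ring

theorem powSum_const {r : ℝ} (hr : 0 < r) :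
    powSum c e f (fun _ => r) (fun _ => r) = r ^ (e + f) * ∑ a, c a := by
  rw [powSum, Finset.mul_sum, Real.rpow_add hr]
  exact Finset.sum_congr rfl fun a _ => mul_comm _ _

theorem eventually_line_pos (hp : ∀ a, 0 < p a) (u : Fin m → ℝ) :
    ∀ᶠ t : ℝ in 𝓝 0, ∀ a, 0 < (p + t • u) a := by
  rw [eventually_all]
  intro a
  have : Tendsto (fun t : ℝ => (p + t • u) a) (𝓝 0) (𝓝 (p a)) := by
    have h : Continuous fun t : ℝ => p a + t * u a := by fun_prop
    simpa using h.tendsto 0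
  exact this.eventually (lt_mem_nhds (hp a))

end PowSum

section FrameJets

variable {n m : ℕ} {Θ : (Fin m → ℝ) →ₐ[ℝ] Matrix (Fin n) (Fin n) ℂ}

theorem toMatrix_frame_line {x v : Tangent n} {p u : Fin m → ℝ} (hx : toMatrix x = Θ p)
    (hv : (v : Matrix (Fin n) (Fin n) ℂ) = Θ u) (t : ℝ) :
    toMatrix (x + t • v) = Θ (p + t • u) := by
  rw [toMatrix_line, hx, hv, map_add, map_smul]

theorem toMatrix_zero_frame (Θ : (Fin m → ℝ) →ₐ[ℝ] Matrix (Fin n) (Fin n) ℂ) :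
    toMatrix (0 : Tangent n) = Θ fun _ => (n : ℝ)⁻¹ := by
  have h : (fun _ : Fin m => (n : ℝ)⁻¹) = (n : ℝ)⁻¹ • (1 : Fin m → ℝ) := by ext; simp
  rw [h, map_smul, map_one, toMatrix]
  ext i j
  simp [Matrix.smul_apply]

theorem mem_stateDomain_frame (hΘ : ∀ d, (Θ d).IsHermitian) (hn : n ≠ 0) {x : Tangent n}
    {p : Fin m → ℝ}
    (hx : toMatrix x = Θ p) (hp : ∀ a, 0 < p a) : x ∈ stateDomain n := by
  rw [mem_stateDomain hn, hx]
  exact posDef_frame (hΘ p) hp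

theorem zero_mem_stateDomain (hΘ : ∀ d, (Θ d).IsHermitian) (hn : n ≠ 0) :
    (0 : Tangent n) ∈ stateDomain n :=
  mem_stateDomain_frame hΘ hn (toMatrix_zero_frame Θ) fun _ => by positivity

theorem sandwich_frame (hΘ : ∀ d, (Θ d).IsHermitian) (α : ℝ) (p q : Fin m → ℝ) :
    sandwich α (Θ p) (Θ q) = Θ fun a =>
      q a ^ ((1 - α) / (2 * α)) * p a * q a ^ ((1 - α) / (2 * α)) := by
  rw [sandwich, mpow_frame (hΘ q), ← map_mul, ← map_mul]
  rfl

theorem quasi_frame (hΘ : ∀ d, (Θ d).IsHermitian) {α : ℝ} (hα0 : α ≠ 0) {x y : Tangent n}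
    {p q : Fin m → ℝ}
    (hx : toMatrix x = Θ p) (hy : toMatrix y = Θ q) (hp : ∀ a, 0 < p a) (hq : ∀ a, 0 < q a) :
    quasi n α (x, y) = powSum (frameWeight Θ 1) α (1 - α) p q := by
  rw [quasi, hx, hy, sandwich_frame hΘ, mpow_frame (hΘ _), traceRe_frame, powSum]
  refine Finset.sum_congr rfl fun a _ => ?_
  congr 1
  have hqs := Real.rpow_pos_of_pos (hq a) ((1 - α) / (2 * α))
  rw [Real.mul_rpow (mul_pos hqs (hp a)).le hqs.le, Real.mul_rpow hqs.le (hp a).le,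
    ← Real.rpow_mul (hq a).le, mul_comm _ (p a ^ α), mul_assoc, ← Real.rpow_add (hq a)]
  congr 2
  field_simp
  ring

theorem fderiv_quasi_right_frame (hΘ : ∀ d, (Θ d).IsHermitian) (hn : n ≠ 0) {α : ℝ} (hα0 : α ≠ 0)
    {x y k : Tangent n}
    {p q kk : Fin m → ℝ} (hx : toMatrix x = Θ p) (hy : toMatrix y = Θ q) (hp : ∀ a, 0 < p a)
    (hq : ∀ a, 0 < q a) (hk : (k : Matrix (Fin n) (Fin n) ℂ) = Θ kk) :
    fderiv ℝ (quasi n α) (x, y) (0, k)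
      = (1 - α) * powSum (frameWeight Θ 1 * kk) α (-α) p q := by
  have hU := isOpen_stateDomain hn
  have h1 := hasDerivAt_line0 (hU.prod hU) (contDiffOn_quasi α) (z := (x, y))
    ⟨mem_stateDomain_frame hΘ hn hx hp, mem_stateDomain_frame hΘ hn hy hq⟩ (0, k)
  have h2 := hasDerivAt_powSum_right (frameWeight Θ 1) α (1 - α) (p := p) hq kk
  rw [show (1 - α - 1 : ℝ) = -α by ring] at h2
  refine deriv_unique_of_eventually h1 h2 ?_
  filter_upwards [eventually_line_pos hq kk] with t ht
  have e : (x, y) + t • ((0 : Tangent n), k) = (x, y + t • k) := by simp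
  rw [e, quasi_frame hΘ hα0 hx (toMatrix_frame_line hy hk t) hp ht]

theorem d2_quasi_frame (hΘ : ∀ d, (Θ d).IsHermitian) (hn : n ≠ 0) {α : ℝ} (hα0 : α ≠ 0)
    {x y j k : Tangent n}
    {p q jj kk : Fin m → ℝ} (hx : toMatrix x = Θ p) (hy : toMatrix y = Θ q) (hp : ∀ a, 0 < p a)
    (hq : ∀ a, 0 < q a) (hj : (j : Matrix (Fin n) (Fin n) ℂ) = Θ jj)
    (hk : (k : Matrix (Fin n) (Fin n) ℂ) = Θ kk) :
    d2 (quasi n α) (x, y) (j, 0) (0, k)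
      = (1 - α) * (α * powSum (frameWeight Θ 1 * kk * jj) (α - 1) (-α) p q) := by
  have hU := isOpen_stateDomain hn
  have h1 := hasDerivAt_line1 (hU.prod hU) (contDiffOn_quasi α) (z := (x, y))
    ⟨mem_stateDomain_frame hΘ hn hx hp, mem_stateDomain_frame hΘ hn hy hq⟩ (j, 0) (0, k)
  refine deriv_unique_of_eventually h1
    ((hasDerivAt_powSum_left (frameWeight Θ 1 * kk) α (-α) hp jj).const_mul (1 - α)) ?_
  filter_upwards [eventually_line_pos hp jj] with t ht
  have e : (x, y) + t • (j, (0 : Tangent n)) = (x + t • j, y) := by simp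
  rw [e, fderiv_quasi_right_frame hΘ hn hα0 (toMatrix_frame_line hx hj t) hy ht hq hk]

theorem d3_quasi_frame (hΘ : ∀ d, (Θ d).IsHermitian) (hn : n ≠ 0) {α : ℝ} (hα0 : α ≠ 0)
    {x y i j k : Tangent n}
    {p q ii jj kk : Fin m → ℝ} (hx : toMatrix x = Θ p) (hy : toMatrix y = Θ q)
    (hp : ∀ a, 0 < p a) (hq : ∀ a, 0 < q a) (hi : (i : Matrix (Fin n) (Fin n) ℂ) = Θ ii)
    (hj : (j : Matrix (Fin n) (Fin n) ℂ) = Θ jj) (hk : (k : Matrix (Fin n) (Fin n) ℂ) = Θ kk) :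
    d3 (quasi n α) (x, y) (i, 0) (j, 0) (0, k)
      = (1 - α) * (α * ((α - 1) *
        powSum (frameWeight Θ 1 * kk * jj * ii) (α - 2) (-α) p q)) := by
  have hU := isOpen_stateDomain hn
  have h1 := hasDerivAt_line2 (hU.prod hU) (contDiffOn_quasi α) (z := (x, y))
    ⟨mem_stateDomain_frame hΘ hn hx hp, mem_stateDomain_frame hΘ hn hy hq⟩ (i, 0) (j, 0) (0, k)
  have h2 := hasDerivAt_powSum_left (q := q) (frameWeight Θ 1 * kk * jj) (α - 1) (-α) hp ii
  rw [show (α - 1 - 1 : ℝ) = α - 2 by ring] at h2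
  refine deriv_unique_of_eventually h1 ((h2.const_mul α).const_mul (1 - α)) ?_
  filter_upwards [eventually_line_pos hp ii] with t ht
  have e : (x, y) + t • (i, (0 : Tangent n)) = (x + t • i, y) := by simp
  rw [e, d2_quasi_frame hΘ hn hα0 (toMatrix_frame_line hx hi t) hy ht hq hj hk]

theorem d4_quasi_frame (hΘ : ∀ d, (Θ d).IsHermitian) (hn : n ≠ 0) {α : ℝ} (hα0 : α ≠ 0)
    {x y l i j k : Tangent n}
    {p q ll ii jj kk : Fin m → ℝ} (hx : toMatrix x = Θ p) (hy : toMatrix y = Θ q)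
    (hp : ∀ a, 0 < p a) (hq : ∀ a, 0 < q a) (hl : (l : Matrix (Fin n) (Fin n) ℂ) = Θ ll)
    (hi : (i : Matrix (Fin n) (Fin n) ℂ) = Θ ii) (hj : (j : Matrix (Fin n) (Fin n) ℂ) = Θ jj)
    (hk : (k : Matrix (Fin n) (Fin n) ℂ) = Θ kk) :
    d4 (quasi n α) (x, y) (0, l) (i, 0) (j, 0) (0, k)
      = (1 - α) * (α * ((α - 1) *
        (-α * powSum (frameWeight Θ 1 * kk * jj * ii * ll) (α - 2) (-α - 1) p q))) := by
  have hU := isOpen_stateDomain hn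
  have h1 := hasDerivAt_line3 (hU.prod hU) (contDiffOn_quasi α) (z := (x, y))
    ⟨mem_stateDomain_frame hΘ hn hx hp, mem_stateDomain_frame hΘ hn hy hq⟩ (0, l) (i, 0) (j, 0)
    (0, k)
  have h2 := hasDerivAt_powSum_right (p := p) (frameWeight Θ 1 * kk * jj * ii) (α - 2) (-α) hq ll
  refine deriv_unique_of_eventually h1 (((h2.const_mul (α - 1)).const_mul α).const_mul (1 - α)) ?_
  filter_upwards [eventually_line_pos hq ll] with t ht
  have e : (x, y) + t • ((0 : Tangent n), l) = (x, y + t • l) := by simp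
  rw [e, d3_quasi_frame hΘ hn hα0 hx (toMatrix_frame_line hy hl t) hp ht hi hj hk]

/-- At commuting states the derivative in the first argument along an arbitrary, possibly
non-commuting direction `v` only sees the diagonal part of `v`. -/
theorem fderiv_quasi_left_frame (hΘ : ∀ d, (Θ d).IsHermitian) (hn : n ≠ 0) {α : ℝ} (hα0 : α ≠ 0)
    (hα1 : α ≠ 1)
    {x y : Tangent n} {p q : Fin m → ℝ} (hx : toMatrix x = Θ p) (hy : toMatrix y = Θ q)
    (hp : ∀ a, 0 < p a) (hq : ∀ a, 0 < q a) (v : Tangent n) :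
    fderiv ℝ (quasi n α) (x, y) (v, 0) = α * powSum (frameWeight Θ v) (α - 1) (1 - α) p q := by
  rw [fderiv_quasi_left hn hα0 hα1 (mem_stateDomain_frame hΘ hn hx hp)
    (mem_stateDomain_frame hΘ hn hy hq), hx, hy, sandwich_frame hΘ, mpow_frame (hΘ _), sandwich,
    mpow_frame (hΘ _)]
  congr 1
  rw [← mul_assoc, traceRe_apply, Matrix.trace_mul_comm, ← mul_assoc, ← mul_assoc, ← map_mul,
    ← map_mul, ← traceRe_apply, traceRe_frame_mul, powSum]
  refine Finset.sum_congr rfl fun a _ => ?_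
  congr 1
  simp only [Pi.mul_apply]
  have hqs := Real.rpow_pos_of_pos (hq a) ((1 - α) / (2 * α))
  rw [Real.mul_rpow (mul_pos hqs (hp a)).le hqs.le, Real.mul_rpow hqs.le (hp a).le,
    ← Real.rpow_mul (hq a).le]
  have e : q a ^ ((1 - α) / (2 * α)) * (q a ^ ((1 - α) / (2 * α) * (α - 1)) * p a ^ (α - 1) *
      q a ^ ((1 - α) / (2 * α) * (α - 1))) * q a ^ ((1 - α) / (2 * α))
      = p a ^ (α - 1) * ((q a ^ ((1 - α) / (2 * α)) * q a ^ ((1 - α) / (2 * α) * (α - 1))) *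
        (q a ^ ((1 - α) / (2 * α) * (α - 1)) * q a ^ ((1 - α) / (2 * α)))) := by ring
  rw [e]
  simp only [← Real.rpow_add (hq a)]
  congr 2
  field_simp
  ring

theorem d2_quasi_mixed_frame (hΘ : ∀ d, (Θ d).IsHermitian) (hn : n ≠ 0) {α : ℝ} (hα0 : α ≠ 0)
    (hα1 : α ≠ 1)
    {x y w : Tangent n} {p q ww : Fin m → ℝ} (hx : toMatrix x = Θ p) (hy : toMatrix y = Θ q)
    (hp : ∀ a, 0 < p a) (hq : ∀ a, 0 < q a) (hw : (w : Matrix (Fin n) (Fin n) ℂ) = Θ ww)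
    (v : Tangent n) :
    d2 (quasi n α) (x, y) (0, w) (v, 0)
      = α * ((1 - α) * powSum (frameWeight Θ v * ww) (α - 1) (-α) p q) := by
  have hU := isOpen_stateDomain hn
  have h1 := hasDerivAt_line1 (hU.prod hU) (contDiffOn_quasi α) (z := (x, y))
    ⟨mem_stateDomain_frame hΘ hn hx hp, mem_stateDomain_frame hΘ hn hy hq⟩ (0, w) (v, 0)
  have h2 := hasDerivAt_powSum_right (p := p) (frameWeight Θ v) (α - 1) (1 - α) hq ww
  rw [show (1 - α - 1 : ℝ) = -α by ring] at h2
  refine deriv_unique_of_eventually h1 (h2.const_mul α) ?_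
  filter_upwards [eventually_line_pos hq ww] with t ht
  have e : (x, y) + t • ((0 : Tangent n), w) = (x, y + t • w) := by simp
  rw [e, fderiv_quasi_left_frame hΘ hn hα0 hα1 hx (toMatrix_frame_line hy hw t) hp ht]

theorem d3_quasi_mixed_frame (hΘ : ∀ d, (Θ d).IsHermitian) (hn : n ≠ 0) {α : ℝ} (hα0 : α ≠ 0)
    (hα1 : α ≠ 1)
    {x y l k : Tangent n} {p q ll kk : Fin m → ℝ} (hx : toMatrix x = Θ p) (hy : toMatrix y = Θ q)
    (hp : ∀ a, 0 < p a) (hq : ∀ a, 0 < q a) (hl : (l : Matrix (Fin n) (Fin n) ℂ) = Θ ll)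
    (hk : (k : Matrix (Fin n) (Fin n) ℂ) = Θ kk) (v : Tangent n) :
    d3 (quasi n α) (x, y) (0, l) (0, k) (v, 0)
      = α * ((1 - α) * (-α * powSum (frameWeight Θ v * kk * ll) (α - 1) (-α - 1) p q)) := by
  have hU := isOpen_stateDomain hn
  have h1 := hasDerivAt_line2 (hU.prod hU) (contDiffOn_quasi α) (z := (x, y))
    ⟨mem_stateDomain_frame hΘ hn hx hp, mem_stateDomain_frame hΘ hn hy hq⟩ (0, l) (0, k) (v, 0)
  have h2 := hasDerivAt_powSum_right (p := p) (frameWeight Θ v * kk) (α - 1) (-α) hq ll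
  refine deriv_unique_of_eventually h1 ((h2.const_mul (1 - α)).const_mul α) ?_
  filter_upwards [eventually_line_pos hq ll] with t ht
  have e : (x, y) + t • ((0 : Tangent n), l) = (x, y + t • l) := by simp
  rw [e, d2_quasi_mixed_frame hΘ hn hα0 hα1 hx (toMatrix_frame_line hy hl t) hp ht hk]

end FrameJets

/-! ### Curvature along diagonal directions in dimension at least three -/

section Diagonal

variable {n : ℕ}

/-- The real diagonal matrices as an algebra of functions. -/
def diagFrame (n : ℕ) : (Fin n → ℝ) →ₐ[ℝ] Matrix (Fin n) (Fin n) ℂ :=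
  (Matrix.diagonalAlgHom ℝ).comp ((Algebra.ofId ℝ ℂ).compLeft (Fin n))

theorem diagFrame_apply (d : Fin n → ℝ) :
    diagFrame n d = Matrix.diagonal fun a => (d a : ℂ) := rfl

theorem isHermitian_diagFrame (d : Fin n → ℝ) : (diagFrame n d).IsHermitian := by
  rw [diagFrame_apply, Matrix.isHermitian_diagonal_iff]
  intro a
  simp [isSelfAdjoint_iff]

theorem frameWeight_diagFrame_one : frameWeight (diagFrame n) 1 = 1 := by
  ext a
  rw [frameWeight, mul_one, diagFrame_apply, traceRe_apply, Matrix.trace_diagonal]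
  simp [Pi.single_apply]

/-- The traceless diagonal matrix with entries `d` as a tangent vector. -/
def diagTangent (d : Fin n → ℝ) (hd : ∑ a, d a = 0) : Tangent n :=
  ⟨diagFrame n d, isHermitian_diagFrame d, by
    rw [diagFrame_apply, Matrix.trace_diagonal, ← Complex.ofReal_sum, hd, Complex.ofReal_zero]⟩

theorem coe_diagTangent (d : Fin n → ℝ) (hd : ∑ a, d a = 0) :
    (diagTangent d hd : Matrix (Fin n) (Fin n) ℂ) = diagFrame n d := rfl

theorem zero_mem_stateDomain' (hn : n ≠ 0) : (0 : Tangent n) ∈ stateDomain n :=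
  zero_mem_stateDomain isHermitian_diagFrame hn

/-- The gradient of the quasi-entropy vanishes along the diagonal, which relates its second
derivatives. -/
theorem d2_quasi_left_left (hn : n ≠ 0) {α : ℝ} (hα0 : α ≠ 0) (hα1 : α ≠ 1) {x : Tangent n}
    (hx : x ∈ stateDomain n) (w v : Tangent n) :
    d2 (quasi n α) (x, x) (w, 0) (v, 0) = -d2 (quasi n α) (x, x) (0, w) (v, 0) := by
  have hU := isOpen_stateDomain hn
  have h1 := hasDerivAt_line1 (hU.prod hU) (contDiffOn_quasi α) (z := (x, x)) ⟨hx, hx⟩ (w, w)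
    (v, 0)
  have h2 := deriv_unique_of_eventually h1 (hasDerivAt_const (0 : ℝ) (0 : ℝ)) (by
    filter_upwards [eventually_line_mem hU hx w] with t ht
    have e : (x, x) + t • (w, w) = (x + t • w, x + t • w) := by simp
    rw [e, fderiv_quasi_diag hn hα0 hα1 ht])
  have e : ((w, w) : Tangent n × Tangent n) = (w, 0) + (0, w) := by simp
  rw [e, map_add, add_apply] at h2
  linarith

/-- The diagonal part of the Christoffel symbol `Γ` of two diagonal directions at the maximally
mixed state. -/
theorem sum_frameWeight_christoffel (hn : n ≠ 0) {α : ℝ} (hα0 : α ≠ 0) (hα1 : α ≠ 1)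
    {i j Γ : Tangent n} {ii jj : Fin n → ℝ}
    (hi : (i : Matrix (Fin n) (Fin n) ℂ) = diagFrame n ii)
    (hj : (j : Matrix (Fin n) (Fin n) ℂ) = diagFrame n jj)
    (hΓ : ∀ k, d2 (quasi n α) (0, 0) (Γ, 0) (k, 0) = -d3 (quasi n α) (0, 0) (i, 0) (j, 0) (0, k))
    (u : Fin n → ℝ) :
    ∑ a, frameWeight (diagFrame n) Γ a * u a
      = (α - 1) * (n * ∑ a, jj a * ii a * u a - (∑ a, jj a * ii a) * ∑ a, u a) := by
  have hU := isOpen_stateDomain hn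
  have hn' : (n : ℝ) ≠ 0 := by exact_mod_cast hn
  have hpos : 0 < (n : ℝ)⁻¹ := by positivity
  have h0 := zero_mem_stateDomain' hn
  set m : ℝ := (∑ a, u a) / n with hm
  -- the traceless part of `u`
  set w : Fin n → ℝ := fun a => u a - m with hw
  have hw0 : ∑ a, w a = 0 := by
    simp only [hw, Finset.sum_sub_distrib, Finset.sum_const, Finset.card_univ, Fintype.card_fin,
      nsmul_eq_mul, hm]
    field_simp; ring
  have hΓ0 : ∑ a, frameWeight (diagFrame n) Γ a * 1 = 0 := by
    have := traceRe_frame_mul (Θ := diagFrame n) (fun _ => 1) (Γ : Matrix (Fin n) (Fin n) ℂ)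
    rw [← this]
    have h1 : diagFrame n (fun _ => 1) = 1 := map_one _
    have hΓt : (Γ : Matrix (Fin n) (Fin n) ℂ).trace = 0 := Γ.2.2
    rw [h1, one_mul, traceRe_apply, hΓt, Complex.zero_re]
  have key := hΓ (diagTangent w hw0)
  have hz := toMatrix_zero_frame (diagFrame n)
  rw [d2_symm (hU.prod hU) (contDiffOn_quasi α) (z := (0, 0)) ⟨h0, h0⟩,
    d2_quasi_left_left hn hα0 hα1 h0,
    d2_quasi_mixed_frame isHermitian_diagFrame hn hα0 hα1 hz hz (fun _ => hpos) (fun _ => hpos)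
      (coe_diagTangent w hw0),
    d3_quasi_frame isHermitian_diagFrame hn hα0 hz hz (fun _ => hpos) (fun _ => hpos) hi hj
      (coe_diagTangent w hw0), powSum_const _ _ _ hpos, powSum_const _ _ _ hpos,
    frameWeight_diagFrame_one] at key
  have e1 : ((n : ℝ)⁻¹) ^ (α - 1 + -α) = n := by
    rw [show α - 1 + -α = (-1 : ℝ) by ring, Real.rpow_neg_one, inv_inv]
  have e2 : ((n : ℝ)⁻¹) ^ (α - 2 + -α) = n * n := by
    rw [show α - 2 + -α = (-1 : ℝ) + (-1) by ring, Real.rpow_add hpos, Real.rpow_neg_one, inv_inv]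
  rw [e1, e2] at key
  simp only [Pi.mul_apply, one_mul, hw, mul_sub, sub_mul, Finset.sum_sub_distrib]
    at key
  have e3 : ∑ a, frameWeight (diagFrame n) Γ a * m = 0 := by
    rw [← Finset.sum_mul, Finset.sum_congr rfl fun a _ => (mul_one _).symm, hΓ0, zero_mul]
  have e4 : ∑ a, m * jj a * ii a = m * ∑ a, jj a * ii a := by
    rw [Finset.mul_sum]; exact Finset.sum_congr rfl fun a _ => by ring
  have e5 : ∑ a, u a * jj a * ii a = ∑ a, jj a * ii a * u a :=
    Finset.sum_congr rfl fun a _ => by ring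
  rw [e3, e4, e5] at key
  have hm' : ∑ a, u a = n * m := by rw [hm]; field_simp
  rw [hm']
  have hα1' : 1 - α ≠ 0 := sub_ne_zero.2 (Ne.symm hα1)
  have hne : α * (1 - α) * n ≠ 0 := mul_ne_zero (mul_ne_zero hα0 hα1') hn'
  refine mul_left_cancel₀ hne ?_
  linear_combination -key

/-- Orthogonal traceless diagonal directions `A = (1, -1, 0, …)` and `C = (1, 1, -2, 0, …)`
with `A C = A`. -/
theorem exists_diagonal_directions (hn : 3 ≤ n) : ∃ A C : Fin n → ℝ,
    ∑ a, A a = 0 ∧ ∑ a, C a = 0 ∧ ∑ a, C a * A a = 0 ∧ ∑ a, C a * C a = 6 ∧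
    ∑ a, (A * A) a = 2 ∧ ∑ a, C a * C a * (A * A) a = 2 ∧ ∑ a, C a * A a * (A * C) a = 2 := by
  obtain ⟨m, rfl⟩ := Nat.exists_eq_add_of_le' hn
  refine ⟨Fin.cons 1 (Fin.cons (-1) fun _ => 0),
    Fin.cons 1 (Fin.cons 1 (Fin.cons (-2) fun _ => 0)), ?_, ?_, ?_, ?_, ?_, ?_, ?_⟩ <;>
  simp [Fin.sum_univ_succ] <;> norm_num

theorem not_isFlat_of_three_le (hn : 3 ≤ n) {α : ℝ} (hα0 : α ≠ 0) (hα1 : α ≠ 1) :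
    ¬ IsFlat (stateDomain n) (eguchiConnection (stateDomain n) (chartDiv n α)) := fun hflat => by
  have hn0 : n ≠ 0 := by omega
  have hα1' : α - 1 ≠ 0 := sub_ne_zero.2 hα1
  have hα1'' : 1 - α ≠ 0 := sub_ne_zero.2 (Ne.symm hα1)
  have hpos : 0 < (n : ℝ)⁻¹ := by positivity
  have h0 := zero_mem_stateDomain' hn0
  have hz := toMatrix_zero_frame (diagFrame n)
  obtain ⟨Γ, hΓ, hR⟩ := (isContrast_chartDiv hn0 hα0 hα1).d4_quasi_symm_of_flat hflat
    (κ := 1 / (α * (α - 1))) (one_div_ne_zero (mul_ne_zero hα0 hα1')) (contDiffOn_quasi α)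
    (fun z hz => quasi_pos hn0 α hz) (fun z _ => chartDiv_eq hα1 z) h0
  obtain ⟨A, C, hA0, hC0, s5, s3, s4, s1, s2⟩ := exists_diagonal_directions hn
  have hA' := coe_diagTangent A hA0
  have hC' := coe_diagTangent C hC0
  have key := hR (diagTangent A hA0) (diagTangent C hC0) (diagTangent C hC0) (diagTangent A hA0)
  have hp : ∀ _ : Fin n, 0 < (n : ℝ)⁻¹ := fun _ => hpos
  rw [d4_quasi_frame isHermitian_diagFrame hn0 hα0 hz hz hp hp hA' hC' hC' hA',
    d4_quasi_frame isHermitian_diagFrame hn0 hα0 hz hz hp hp hC' hA' hC' hA',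
    d3_quasi_mixed_frame isHermitian_diagFrame hn0 hα0 hα1 hz hz hp hp hA' hA',
    d3_quasi_mixed_frame isHermitian_diagFrame hn0 hα0 hα1 hz hz hp hp hC' hA',
    powSum_const _ _ _ hpos, powSum_const _ _ _ hpos, powSum_const _ _ _ hpos,
    powSum_const _ _ _ hpos] at key
  have e1 := sum_frameWeight_christoffel hn0 hα0 hα1 hC' hC' (hΓ _ _) (A * A)
  have e2 := sum_frameWeight_christoffel hn0 hα0 hα1 hA' hC' (hΓ _ _) (A * C)
  rw [s1, s3, s4] at e1
  rw [s2, s5] at e2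
  have f1 : ∀ w : Fin n → ℝ, ∑ a, (w * A * A) a = ∑ a, w a * (A * A) a := fun w =>
    Finset.sum_congr rfl fun a _ => by simp only [Pi.mul_apply]; ring
  have f2 : ∀ w : Fin n → ℝ, ∑ a, (w * A * C) a = ∑ a, w a * (A * C) a := fun w =>
    Finset.sum_congr rfl fun a _ => by simp only [Pi.mul_apply]; ring
  have f3 : ∀ w : Fin n → ℝ, ∑ a, (w * A * C * A * C) a = ∑ a, (w * A * C * C * A) a :=
    fun w => Finset.sum_congr rfl fun a _ => by simp only [Pi.mul_apply]; ring
  rw [f3, f1, f2, e1, e2] at key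
  have hfin : α * (1 - α) * α * (n : ℝ)⁻¹ ^ (α - 1 + (-α - 1)) * (α - 1) * 12 = 0 := by
    linear_combination -key
  exact (mul_ne_zero (mul_ne_zero (mul_ne_zero (mul_ne_zero (mul_ne_zero hα0 hα1'') hα0)
    (Real.rpow_pos_of_pos hpos _).ne') hα1') (by norm_num)) hfin

end Diagonal

/-! ### The symmetry of the qubit -/

section Flip

/-- The algebra homomorphism `A ↦ (adj A)ᴴ` of the `2 × 2` matrices. On Hermitian matrices of trace
one it is the reflection of the Bloch ball in its centre. -/
def spinFlip : Matrix (Fin 2) (Fin 2) ℂ →ₐ[ℝ] Matrix (Fin 2) (Fin 2) ℂ where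
  toFun A := A.adjugate.conjTranspose
  map_one' := by simp
  map_mul' A B := by rw [Matrix.adjugate_mul_distrib, Matrix.conjTranspose_mul]
  map_zero' := by simp
  map_add' A B := by
    ext i j
    fin_cases i <;> fin_cases j <;> simp [Matrix.adjugate_fin_two] <;> ring
  commutes' r := by
    ext i j
    fin_cases i <;> fin_cases j <;> simp [Matrix.adjugate_fin_two, Matrix.algebraMap_matrix_apply]

theorem spinFlip_apply (A : Matrix (Fin 2) (Fin 2) ℂ) : spinFlip A = A.adjugate.conjTranspose := rfl

theorem isHermitian_spinFlip {A : Matrix (Fin 2) (Fin 2) ℂ} (hA : A.IsHermitian) :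
    (spinFlip A).IsHermitian := by
  rw [spinFlip_apply, Matrix.IsHermitian, Matrix.adjugate_conjTranspose, hA.eq,
    Matrix.adjugate_conjTranspose, hA.eq]

theorem traceRe_spinFlip (A : Matrix (Fin 2) (Fin 2) ℂ) : traceRe 2 (spinFlip A) = traceRe 2 A := by
  rw [spinFlip_apply, traceRe_apply, traceRe_apply, Matrix.trace_fin_two, Matrix.trace_fin_two,
    Matrix.adjugate_fin_two]
  simp [add_comm]

theorem spinFlip_tangent (x : Tangent 2) :
    spinFlip (x : Matrix (Fin 2) (Fin 2) ℂ) = -(x : Matrix (Fin 2) (Fin 2) ℂ) := by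
  have h1 : (x : Matrix (Fin 2) (Fin 2) ℂ).trace = 0 := x.2.2
  rw [Matrix.trace_fin_two] at h1
  rw [spinFlip_apply, Matrix.adjugate_conjTranspose, (isHermitian_tangent x).eq,
    Matrix.adjugate_fin_two]
  ext i j
  fin_cases i <;> fin_cases j <;> simp
  · linear_combination h1
  · linear_combination h1

theorem spinFlip_toMatrix (x : Tangent 2) : spinFlip (toMatrix x) = toMatrix (-x) := by
  have h : ((2 : ℕ) : ℂ)⁻¹ • (1 : Matrix (Fin 2) (Fin 2) ℂ)
      = algebraMap ℝ (Matrix (Fin 2) (Fin 2) ℂ) (2⁻¹ : ℝ) := by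
    ext i j
    simp [Matrix.algebraMap_matrix_apply, Matrix.one_apply]
  rw [toMatrix, toMatrix, h, map_add, AlgHom.commutes, spinFlip_tangent]
  simp

theorem spinFlip_mpow {A : Matrix (Fin 2) (Fin 2) ℂ} (hA : A.IsHermitian) (s : ℝ) :
    spinFlip (mpow A s) = mpow (spinFlip A) s :=
  map_cfc_of_algHom spinFlip hA (isHermitian_spinFlip hA) _

/-- For a qubit the quasi-entropy is even around the maximally mixed state. -/
theorem quasi_neg (α : ℝ) (z : Tangent 2 × Tangent 2) : quasi 2 α (-z) = quasi 2 α z := by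
  rw [quasi, quasi, Prod.fst_neg, Prod.snd_neg, ← spinFlip_toMatrix, ← spinFlip_toMatrix]
  have h : sandwich α (spinFlip (toMatrix z.1)) (spinFlip (toMatrix z.2))
      = spinFlip (sandwich α (toMatrix z.1) (toMatrix z.2)) := by
    rw [sandwich, sandwich, map_mul, map_mul, spinFlip_mpow (isHermitian_toMatrix _)]
  rw [h, ← spinFlip_mpow (isHermitian_sandwich (isHermitian_toMatrix _) α), traceRe_spinFlip]

/-- Differentiation turns even functions (`s = 1`) into odd ones (`s = -1`), and conversely. -/
theorem fderiv_neg_of_even {V W : Type*} [NormedAddCommGroup V] [NormedSpace ℝ V]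
    [NormedAddCommGroup W] [NormedSpace ℝ W] {f : V → W} {s : ℝ} (h : ∀ z, f (-z) = s • f z) (z : V) :
    fderiv ℝ f (-z) = (-s) • fderiv ℝ f z := by
  have h1 := (ContinuousLinearEquiv.neg ℝ (M := V)).comp_right_fderiv (f := f) (x := z)
  rw [show f ∘ ContinuousLinearEquiv.neg ℝ = s • f from funext h, fderiv_const_smul_field] at h1
  ext v
  have h2 := congrArg (fun L : V →L[ℝ] W => L v) h1
  simp only [Pi.smul_apply, smul_apply, ContinuousLinearMap.comp_apply,
    ContinuousLinearEquiv.coe_coe, ContinuousLinearEquiv.neg_apply, map_neg] at h2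
  rw [smul_apply, neg_smul, h2, neg_neg]

theorem d3_quasi_two_zero (α : ℝ) (a b c : Tangent 2 × Tangent 2) :
    d3 (quasi 2 α) (0, 0) a b c = 0 := by
  have h1 := fderiv_neg_of_even (f := quasi 2 α) (s := 1) fun z => by rw [quasi_neg, one_smul]
  have h3 := fderiv_neg_of_even (fderiv_neg_of_even h1) (0, 0)
  simp only [Prod.neg_mk, neg_zero, neg_neg, neg_smul, one_smul] at h3
  have h4 := congrArg (fun L : Tangent 2 × Tangent 2 →L[ℝ] Tangent 2 × Tangent 2 →L[ℝ]
    Tangent 2 × Tangent 2 →L[ℝ] ℝ => L a b c) h3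
  simp only [neg_apply] at h4
  linarith

end Flip

section Involution

/-- The algebra of functions of an involution `V`: the function with values `d 0` at `1` and `d 1`
at `-1` is sent to its value at `V`. -/
def involutionFrame {n : ℕ} (V : Matrix (Fin n) (Fin n) ℂ) (hV : V * V = 1) :
    (Fin 2 → ℝ) →ₐ[ℝ] Matrix (Fin n) (Fin n) ℂ where
  toFun d := ((d 0 + d 1) / 2) • (1 : Matrix (Fin n) (Fin n) ℂ) + ((d 0 - d 1) / 2) • V
  map_one' := by simp
  map_mul' d e := by
    simp only [Pi.mul_apply, add_mul, mul_add, smul_mul_smul_comm, one_mul, mul_one, hV]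
    module
  map_zero' := by simp
  map_add' d e := by simp only [Pi.add_apply]; module
  commutes' r := by
    simp [Algebra.algebraMap_eq_smul_one, Pi.algebraMap_apply]

theorem involutionFrame_apply {n : ℕ} (V : Matrix (Fin n) (Fin n) ℂ) (hV : V * V = 1)
    (d : Fin 2 → ℝ) : involutionFrame V hV d
      = ((d 0 + d 1) / 2) • (1 : Matrix (Fin n) (Fin n) ℂ) + ((d 0 - d 1) / 2) • V := rfl

/-- The fourth derivative along a traceless involution at the maximally mixed state of a qubit. -/
theorem d4_quasi_involution {α : ℝ} (hα0 : α ≠ 0) (v : Tangent 2)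
    (hv : (v : Matrix (Fin 2) (Fin 2) ℂ) * v = 1) :
    d4 (quasi 2 α) (0, 0) (0, v) (v, 0) (v, 0) (0, v) = 16 * α ^ 2 * (α - 1) ^ 2 := by
  set Θ := involutionFrame (v : Matrix (Fin 2) (Fin 2) ℂ) hv with hΘdef
  have hΘ : ∀ d, (Θ d).IsHermitian := fun d => by
    rw [hΘdef, involutionFrame_apply]
    refine Matrix.IsHermitian.add ?_ ?_
    · simp [Matrix.IsHermitian, Matrix.conjTranspose_smul]
    · simp [Matrix.IsHermitian, Matrix.conjTranspose_smul, (isHermitian_tangent v).eq]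
  have hv' : (v : Matrix (Fin 2) (Fin 2) ℂ) = Θ ![1, -1] := by
    rw [hΘdef, involutionFrame_apply]; simp
  have hvt : (v : Matrix (Fin 2) (Fin 2) ℂ).trace = 0 := v.2.2
  have hw : ∀ a, frameWeight Θ 1 a = 1 := fun a => by
    rw [frameWeight, mul_one, hΘdef, involutionFrame_apply, map_add, map_smul, map_smul,
      traceRe_apply, traceRe_apply, hvt]
    fin_cases a <;> simp
  have hz := toMatrix_zero_frame Θ
  have hp : 0 < ((2 : ℕ) : ℝ)⁻¹ := by norm_num
  rw [d4_quasi_frame hΘ two_ne_zero hα0 hz hz (fun _ => hp) (fun _ => hp) hv' hv' hv' hv',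
    powSum_const _ _ _ hp]
  have e : ((2 : ℕ) : ℝ)⁻¹ ^ (α - 2 + (-α - 1)) = 8 := by
    rw [show α - 2 + (-α - 1) = ((-3 : ℤ) : ℝ) by push_cast; ring, Real.rpow_intCast]
    norm_num
  rw [e]
  simp [hw, Fin.sum_univ_two]
  ring

end Involution

section Quartic

variable {E : Type*} [AddCommGroup E] [Module ℝ E] {F : E → E → E → E → ℝ}

/-- A totally symmetric quartic form that takes the value `τ` on the unit circle of the plane of `x`
and `y` takes the value `τ / 3` at `(x, y, y, x)`. -/
theorem quartic_mixed (hlin : ∀ (a b : ℝ) x y i j k,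
      F (a • x + b • y) i j k = a * F x i j k + b * F y i j k)
    (h12 : ∀ l i j k, F l i j k = F i l j k) (h23 : ∀ l i j k, F l i j k = F l j i k)
    (h14 : ∀ l i j k, F l i j k = F k i j l) {x y : E} {τ : ℝ}
    (hτ : ∀ a b : ℝ, a ^ 2 + b ^ 2 = 1 → F (a • x + b • y) (a • x + b • y) (a • x + b • y)
      (a • x + b • y) = τ) : F x y y x = τ / 3 := by
  have hlin2 : ∀ (a b : ℝ) x y i j k,
      F i (a • x + b • y) j k = a * F i x j k + b * F i y j k := fun a b x y i j k => by
    rw [h12, hlin, h12 x, h12 y]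
  have hlin3 : ∀ (a b : ℝ) x y i j k,
      F i j (a • x + b • y) k = a * F i j x k + b * F i j y k := fun a b x y i j k => by
    rw [h23, hlin2, h23 i x, h23 i y]
  have h34 : ∀ l i j k, F l i j k = F l i k j := fun l i j k => by
    rw [h12 l i, h23 i l, h12 i j, h14 j, h12 k i, h23 i k, h12 i l]
  have hlin4 : ∀ (a b : ℝ) x y i j k,
      F i j k (a • x + b • y) = a * F i j k x + b * F i j k y := fun a b x y i j k => by
    rw [h34, hlin3, h34 i j x, h34 i j y]
  -- the odd terms cancel between the points `(3/5, 4/5)` and `(3/5, -4/5)` of the circle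
  have p1 := hτ 1 0 (by norm_num)
  have p2 := hτ 0 1 (by norm_num)
  have p3 := hτ (3 / 5) (4 / 5) (by norm_num)
  have p4 := hτ (3 / 5) (-4 / 5) (by norm_num)
  simp only [hlin, hlin2, hlin3, hlin4] at p1 p2 p3 p4
  have s2 : F x y x y = F x y y x := h34 x y x y
  have s1 : F x x y y = F x y y x := by rw [h23 x x y y, s2]
  have s3 : F y x x y = F x y y x := by rw [h12 y x x y, s2]
  have s4 : F y x y x = F x y y x := h12 y x y x
  have s5 : F y y x x = F x y y x := by rw [h23 y y x x, s4]
  rw [s1, s2, s3, s4, s5] at p3 p4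
  linarith

end Quartic

/-! ### The qubit: a mixed fourth derivative along anticommuting directions -/

section Expansion

/-- The `k`-th derivative of `u ↦ (1/2 + u) ^ e (1/2 - u) ^ f`. -/
def powProd : ℕ → ℝ → ℝ → ℝ → ℝ
  | 0, e, f, u => (1 / 2 + u) ^ e * (1 / 2 - u) ^ f
  | k + 1, e, f, u => e * powProd k (e - 1) f u - f * powProd k e (f - 1) u

theorem hasDerivAt_powProd (k : ℕ) (e f : ℝ) {u : ℝ} (h1 : 0 < 1 / 2 + u) (h2 : 0 < 1 / 2 - u) :
    HasDerivAt (powProd k e f) (powProd (k + 1) e f u) u := by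
  induction k generalizing e f with
  | zero =>
    have d1 := ((hasDerivAt_id u).const_add (1 / 2)).rpow_const (p := e) (Or.inl h1.ne')
    have d2 := ((hasDerivAt_id u).const_sub (1 / 2)).rpow_const (p := f) (Or.inl h2.ne')
    refine (d1.mul d2).congr_deriv ?_
    simp only [powProd, id]
    ring
  | succ k ih => exact ((ih (e - 1) f).const_mul e).sub ((ih e (f - 1)).const_mul f)

theorem powProd_zero_zero (e f : ℝ) : powProd 0 e f 0 = (1 / 2) ^ (e + f) := by
  simp only [powProd]
  rw [add_zero, sub_zero, ← Real.rpow_add (by norm_num)]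

theorem half_rpow_sub_one (e : ℝ) : (1 / 2 : ℝ) ^ (e - 1) = 2 * (1 / 2) ^ e := by
  rw [Real.rpow_sub_one (by norm_num)]; ring

theorem powProd_one_zero (e f : ℝ) : powProd 1 e f 0 = 2 * (e - f) * (1 / 2) ^ (e + f) := by
  rw [powProd, powProd_zero_zero, powProd_zero_zero, show e - 1 + f = e + f - 1 by ring,
    show e + (f - 1) = e + f - 1 by ring, half_rpow_sub_one]
  ring

theorem powProd_two_zero (e f : ℝ) : powProd 2 e f 0
    = 4 * (e * (e - 1) - 2 * e * f + f * (f - 1)) * (1 / 2) ^ (e + f) := by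
  rw [powProd, powProd_one_zero, powProd_one_zero, show e - 1 + f = e + f - 1 by ring,
    show e + (f - 1) = e + f - 1 by ring, half_rpow_sub_one]
  ring

theorem powProd_three_zero (e f : ℝ) : powProd 3 e f 0
    = 8 * (e * (e - 1) * (e - 2) - 3 * e * (e - 1) * f + 3 * e * f * (f - 1)
      - f * (f - 1) * (f - 2)) * (1 / 2) ^ (e + f) := by
  rw [powProd, powProd_two_zero, powProd_two_zero, show e - 1 + f = e + f - 1 by ring,
    show e + (f - 1) = e + f - 1 by ring, half_rpow_sub_one]
  ring

/-- The first and third derivatives at a zero of `d` of an identity `d q = r`. The third derivative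
of `q` drops out. -/
theorem leibniz_of_mul_eq {d r : ℕ → ℝ → ℝ} {q0 q1 q2 : ℝ → ℝ}
    (hd : ∀ᶠ u in 𝓝 0, ∀ k, HasDerivAt (d k) (d (k + 1) u) u)
    (hr : ∀ᶠ u in 𝓝 0, ∀ k, HasDerivAt (r k) (r (k + 1) u) u)
    (hq0 : ∀ᶠ u in 𝓝 0, HasDerivAt q0 (q1 u) u) (hq1 : ∀ᶠ u in 𝓝 0, HasDerivAt q1 (q2 u) u)
    (hq2 : DifferentiableAt ℝ q2 0) (h : ∀ᶠ u in 𝓝 0, d 0 u * q0 u = r 0 u) (h0 : d 0 0 = 0) :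
    d 1 0 * q0 0 = r 1 0 ∧ d 3 0 * q0 0 + 3 * d 2 0 * q1 0 + 3 * d 1 0 * q2 0 = r 3 0 := by
  have h1 : ∀ᶠ u in 𝓝 0, d 1 u * q0 u + d 0 u * q1 u = r 1 u := by
    filter_upwards [hd, hr, hq0, h.eventually_nhds] with u a b c e
    exact deriv_unique_of_eventually ((a 0).fun_mul c) (b 0) e
  have h2 : ∀ᶠ u in 𝓝 0, (d 2 u * q0 u + d 1 u * q1 u) + (d 1 u * q1 u + d 0 u * q2 u) = r 2 u := by
    filter_upwards [hd, hr, hq0, hq1, h1.eventually_nhds] with u a b c c' e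
    exact deriv_unique_of_eventually (((a 1).fun_mul c).fun_add ((a 0).fun_mul c')) (b 1) e
  have a := hd.self_of_nhds
  have b := hr.self_of_nhds
  have c := hq0.self_of_nhds
  have c' := hq1.self_of_nhds
  have h3 := deriv_unique_of_eventually ((((a 2).fun_mul c).fun_add ((a 1).fun_mul c')).fun_add
    (((a 1).fun_mul c').fun_add ((a 0).fun_mul hq2.hasDerivAt))) (b 2) h2
  have e1 := h1.self_of_nhds
  simp only [h0, zero_mul, add_zero] at e1 h3
  exact ⟨e1, by linarith⟩

end Expansion

section Rays

variable {V : Type*} [NormedAddCommGroup V] [NormedSpace ℝ V] {Ω : Set V} {Φ : V → ℝ}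

theorem hasDerivAt_ray {W : Type*} [NormedAddCommGroup W] [NormedSpace ℝ W] {f : V → W}
    (hΩ : IsOpen Ω) (h : ContDiffOn ℝ ∞ f Ω) {v : V} {u : ℝ} (hu : u • v ∈ Ω) :
    HasDerivAt (fun u : ℝ => f (u • v)) (fderiv ℝ f (u • v) v) u := by
  have h1 : HasDerivAt (fun u : ℝ => u • v) v u := by
    simpa using (hasDerivAt_id u).smul_const v
  exact (differentiableAt_of_smooth hΩ h hu).hasFDerivAt.comp_hasDerivAt u h1

theorem hasDerivAt_ray2 (hΩ : IsOpen Ω) (h : ContDiffOn ℝ ∞ Φ Ω) {v : V} {u : ℝ} (hu : u • v ∈ Ω)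
    (a b : V) : HasDerivAt (fun u : ℝ => d2 Φ (u • v) a b) (d3 Φ (u • v) v a b) u := by
  have := hasDerivAt_ray hΩ (smooth_fderiv hΩ (smooth_fderiv hΩ h)) hu
  simpa using (this.clm_apply (hasDerivAt_const u a)).clm_apply (hasDerivAt_const u b)

theorem hasDerivAt_ray3 (hΩ : IsOpen Ω) (h : ContDiffOn ℝ ∞ Φ Ω) {v : V} {u : ℝ} (hu : u • v ∈ Ω)
    (a b c : V) : HasDerivAt (fun u : ℝ => d3 Φ (u • v) a b c) (d4 Φ (u • v) v a b c) u := by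
  have := hasDerivAt_ray hΩ (smooth_fderiv hΩ (smooth_fderiv hΩ (smooth_fderiv hΩ h))) hu
  simpa using ((this.clm_apply (hasDerivAt_const u a)).clm_apply (hasDerivAt_const u b)).clm_apply
    (hasDerivAt_const u c)

theorem differentiableAt_ray4 (hΩ : IsOpen Ω) (h : ContDiffOn ℝ ∞ Φ Ω) {v : V} {u : ℝ}
    (hu : u • v ∈ Ω) (a b c d : V) : DifferentiableAt ℝ (fun u : ℝ => d4 Φ (u • v) a b c d) u := by
  have h4 := smooth_fderiv hΩ (smooth_fderiv hΩ (smooth_fderiv hΩ (smooth_fderiv hΩ h)))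
  exact ((((hasDerivAt_ray hΩ h4 hu).differentiableAt.clm_apply
    (differentiableAt_const a)).clm_apply (differentiableAt_const b)).clm_apply
    (differentiableAt_const c)).clm_apply (differentiableAt_const d)

/-- A linear relation between the second derivatives of `Φ` along a ray determines its fourth
derivative at the origin of the ray, if the relation degenerates there to first order. -/
theorem leibniz_ray (hΩ : IsOpen Ω) (h : ContDiffOn ℝ ∞ Φ Ω) {z : V} (hz : z = 0) (h0 : z ∈ Ω)
    {v a : V} (h3 : d3 Φ z v a a = 0) {d r : ℕ → ℝ → ℝ}
    (hd : ∀ᶠ u in 𝓝 0, ∀ k, HasDerivAt (d k) (d (k + 1) u) u)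
    (hr : ∀ᶠ u in 𝓝 0, ∀ k, HasDerivAt (r k) (r (k + 1) u) u)
    (hdr : ∀ᶠ u in 𝓝 0, d 0 u * d2 Φ (u • v) a a = r 0 u) (hd0 : d 0 0 = 0) :
    d 1 0 * d2 Φ z a a = r 1 0 ∧
      d 3 0 * d2 Φ z a a + 3 * d 1 0 * d4 Φ z v v a a = r 3 0 := by
  subst hz
  have hmem : ∀ᶠ u : ℝ in 𝓝 0, u • v ∈ Ω := by simpa using eventually_line_mem hΩ h0 v
  have key := leibniz_of_mul_eq hd hr (hmem.mono fun u hu => hasDerivAt_ray2 hΩ h hu a a)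
    (hmem.mono fun u hu => hasDerivAt_ray3 hΩ h hu v a a)
    (differentiableAt_ray4 hΩ h hmem.self_of_nhds v v a a) hdr hd0
  rwa [zero_smul, h3, mul_zero, add_zero] at key

end Rays

section Qubit

/-- The Pauli matrix `diag(1, -1)`. -/
def pauliZ : Tangent 2 :=
  ⟨!![1, 0; 0, -1], by ext i j; fin_cases i <;> fin_cases j <;> simp, by
    simp [Matrix.trace_fin_two]⟩

/-- The Pauli matrix with vanishing diagonal and real entries. -/
def pauliX : Tangent 2 :=
  ⟨!![0, 1; 1, 0], by ext i j; fin_cases i <;> fin_cases j <;> simp, by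
    simp [Matrix.trace_fin_two]⟩

theorem coe_pauliZ : (pauliZ : Matrix (Fin 2) (Fin 2) ℂ) = !![1, 0; 0, -1] := rfl

theorem coe_pauliX : (pauliX : Matrix (Fin 2) (Fin 2) ℂ) = !![0, 1; 1, 0] := rfl

theorem pauli_sq {a b : ℝ} (h : a ^ 2 + b ^ 2 = 1) :
    ((a • pauliZ + b • pauliX : Tangent 2) : Matrix (Fin 2) (Fin 2) ℂ)
      * (a • pauliZ + b • pauliX : Tangent 2) = 1 := by
  have h' : (a : ℂ) ^ 2 + (b : ℂ) ^ 2 = 1 := by exact_mod_cast h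
  rw [Submodule.coe_add, Submodule.coe_smul, Submodule.coe_smul, coe_pauliZ, coe_pauliX]
  ext i j
  fin_cases i <;> fin_cases j <;> simp [Matrix.mul_apply, Fin.sum_univ_two]
  · linear_combination h'
  · ring
  · ring
  · linear_combination h'

theorem toMatrix_pauliZ (u : ℝ) :
    toMatrix (u • pauliZ) = diagFrame 2 ![1 / 2 + u, 1 / 2 - u] := by
  rw [toMatrix, diagFrame_apply, Submodule.coe_smul, coe_pauliZ]
  ext i j
  fin_cases i <;> fin_cases j <;> simp
  ring

theorem toMatrix_pauliX (t : ℝ) :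
    toMatrix (t • pauliX) = !![(1 / 2 : ℂ), (t : ℂ); (t : ℂ), (1 / 2 : ℂ)] := by
  rw [toMatrix, Submodule.coe_smul, coe_pauliX]
  ext i j
  fin_cases i <;> fin_cases j <;> simp

theorem pauliZ_pos {u : ℝ} (h1 : 0 < 1 / 2 + u) (h2 : 0 < 1 / 2 - u) (a : Fin 2) :
    0 < (![1 / 2 + u, 1 / 2 - u] : Fin 2 → ℝ) a := by
  fin_cases a
  · simpa using h1
  · simpa using h2

theorem pauliZ_mem {u : ℝ} (h1 : 0 < 1 / 2 + u) (h2 : 0 < 1 / 2 - u) :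
    u • pauliZ ∈ stateDomain 2 :=
  mem_stateDomain_frame isHermitian_diagFrame two_ne_zero (toMatrix_pauliZ u) (pauliZ_pos h1 h2)

/-- A power of a Hermitian `2 × 2` matrix commutes with the matrix; the off-diagonal entry of this
relation determines the off-diagonal entry of the power. -/
theorem mpow_offDiag {M : Matrix (Fin 2) (Fin 2) ℂ} (hM : M.PosDef) (s : ℝ) :
    (M 0 0 - M 1 1) * mpow M s 0 1 = M 0 1 * (mpow M s 0 0 - mpow M s 1 1) := by
  have h : M * mpow M s = mpow M s * M := by
    conv_lhs => rw [← mpow_one hM, mpow_mpow hM, mpow_mul_mpow hM]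
    conv_rhs => rw [← mpow_one hM, mpow_mpow hM, mpow_mul_mpow hM]
    congr 1; ring
  have h1 := congrFun (congrFun h 0) 1
  simp only [Matrix.mul_apply, Fin.sum_univ_two] at h1
  linear_combination h1

/-- The derivative along `pauliX` at the states `1/2 + t pauliX` and `1/2 + u pauliZ`. It is an
off-diagonal entry of a power, which is known only after multiplication by the difference of the
diagonal entries; this factor does not depend on `t` and vanishes at `u = 0`. -/
theorem fderiv_quasi_pauliX {α : ℝ} (hα0 : α ≠ 0) (hα1 : α ≠ 1) {t u : ℝ}
    (ht : t • pauliX ∈ stateDomain 2) (h1 : 0 < 1 / 2 + u) (h2 : 0 < 1 / 2 - u) :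
    (powProd 0 ((1 - α) / α) 0 u - powProd 0 0 ((1 - α) / α) u)
      * fderiv ℝ (quasi 2 α) (t • pauliX, u • pauliZ) (pauliX, 0)
    = 4 * α * powProd 0 ((1 - α) / α) ((1 - α) / α) u * (t *
      traceRe 2 (pauliZ * mpow (sandwich α (toMatrix (t • pauliX)) (toMatrix (u • pauliZ))) (α - 1))) := by
  have hσ := (pauliZ_mem h1 h2).1
  have hM := posDef_sandwich ht.1 hσ α
  set M := sandwich α (toMatrix (t • pauliX)) (toMatrix (u • pauliZ)) with hMdef
  set N := mpow M (α - 1) with hN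
  have hoff := mpow_offDiag hM (α - 1)
  set s := (1 - α) / (2 * α) with hs
  set g : ℝ := (1 / 2 + u) ^ s with hg
  set k : ℝ := (1 / 2 - u) ^ s with hk
  have hpow : mpow (toMatrix (u • pauliZ)) s = !![(g : ℂ), 0; 0, (k : ℂ)] := by
    rw [toMatrix_pauliZ, mpow_frame (isHermitian_diagFrame _), diagFrame_apply]
    ext i j
    fin_cases i <;> fin_cases j <;> simp [hg, hk]
  have hsX : sandwich α (pauliX : Matrix (Fin 2) (Fin 2) ℂ) (toMatrix (u • pauliZ))
      = !![0, (g * k : ℂ); (g * k : ℂ), 0] := by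
    rw [sandwich, hpow, coe_pauliX]
    ext i j
    fin_cases i <;> fin_cases j <;> simp [Matrix.mul_apply, Fin.sum_univ_two]
    ring
  have hM' : M = !![(g * g / 2 : ℂ), (t * (g * k) : ℂ); (t * (g * k) : ℂ), (k * k / 2 : ℂ)] := by
    rw [hMdef, sandwich, hpow, toMatrix_pauliX]
    ext i j
    fin_cases i <;> fin_cases j <;> simp [Matrix.mul_apply, Fin.sum_univ_two] <;> ring
  have hNH : N 1 0 = star (N 0 1) := by
    have := congrFun (congrFun (isHermitian_mpow M (α - 1)).eq 1) 0
    rw [Matrix.conjTranspose_apply] at this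
    exact this.symm
  rw [fderiv_quasi_left two_ne_zero hα0 hα1 ht (pauliZ_mem h1 h2), hsX, traceRe_apply,
    Matrix.trace_fin_two]
  have hre : ((N * !![0, (g * k : ℂ); (g * k : ℂ), 0]) 0 0
      + (N * !![0, (g * k : ℂ); (g * k : ℂ), 0]) 1 1).re = 2 * (g * k) * (N 0 1).re := by
    have e : (N * !![0, (g * k : ℂ); (g * k : ℂ), 0]) 0 0
        + (N * !![0, (g * k : ℂ); (g * k : ℂ), 0]) 1 1
        = ((g * k : ℝ) : ℂ) * (N 0 1 + N 1 0) := by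
      simp [Matrix.mul_apply, Fin.sum_univ_two]; ring
    rw [e, hNH, Complex.re_ofReal_mul]
    simp
    ring
  rw [hre]
  have hoff' : (g * g / 2 - k * k / 2) * (N 0 1).re = t * (g * k) * (N 0 0 - N 1 1).re := by
    have e := congrArg Complex.re hoff
    rw [← hN, hM'] at e
    have e1 : ((g * g / 2 : ℂ) - (k * k / 2 : ℂ)) = ((g * g / 2 - k * k / 2 : ℝ) : ℂ) := by
      push_cast; ring
    have e2 : (t * (g * k) : ℂ) = ((t * (g * k) : ℝ) : ℂ) := by push_cast; ring
    simp only [Matrix.of_apply, Matrix.cons_val', Matrix.cons_val_zero, Matrix.cons_val_one,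
      Matrix.cons_val_fin_one] at e
    rwa [e1, e2, Complex.re_ofReal_mul, Complex.re_ofReal_mul] at e
  have hZ : traceRe 2 (pauliZ * N) = (N 0 0 - N 1 1).re := by
    rw [traceRe_apply, coe_pauliZ, Matrix.trace_fin_two]
    simp [Matrix.mul_apply, Fin.sum_univ_two, sub_eq_add_neg]
  rw [hZ]
  have hb : (1 - α) / α = s + s := by rw [hs]; field_simp; ring
  simp only [powProd, Real.rpow_zero, mul_one, one_mul, hb, Real.rpow_add h1, Real.rpow_add h2,
    ← hg, ← hk]
  linear_combination 4 * α * (g * k) * hoff'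

/-- The second derivative along `pauliX` at the states `1/2` and `1/2 + u pauliZ`. -/
theorem d2_quasi_pauliX {α : ℝ} (hα0 : α ≠ 0) (hα1 : α ≠ 1) {u : ℝ} (h1 : 0 < 1 / 2 + u)
    (h2 : 0 < 1 / 2 - u) :
    (powProd 0 ((1 - α) / α) 0 u - powProd 0 0 ((1 - α) / α) u)
      * d2 (quasi 2 α) (0, u • pauliZ) (pauliX, 0) (pauliX, 0)
    = 4 * α * (1 / 2) ^ (α - 1)
      * (powProd 0 (1 - α) ((1 - α) / α) u - powProd 0 ((1 - α) / α) (1 - α) u) := by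
  have hU := isOpen_stateDomain two_ne_zero
  have h0 := zero_mem_stateDomain' (n := 2) two_ne_zero
  have hσ := pauliZ_mem h1 h2
  set h : ℝ → ℝ := fun t => traceRe 2 (pauliZ *
    mpow (sandwich α (toMatrix (t • pauliX)) (toMatrix (u • pauliZ))) (α - 1)) with hh
  have hd : DifferentiableAt ℝ h 0 := by
    have e1 : ContDiffAt ℝ ∞ (fun t : ℝ => toMatrix (t • pauliX)) 0 :=
      contDiff_toMatrix.contDiffAt.comp (0 : ℝ) (contDiffAt_id.smul contDiffAt_const)
    have e2 : ContDiffAt ℝ ∞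
        (fun t : ℝ => sandwich α (toMatrix (t • pauliX)) (toMatrix (u • pauliZ))) 0 :=
      (contDiffAt_const.mul e1).mul contDiffAt_const
    have e3 := contDiffAt_mpow (s := fun _ => α - 1) e2 contDiffAt_const
      (Eventually.of_forall fun t => isHermitian_sandwich (isHermitian_toMatrix _) α)
      (posDef_sandwich (by simpa using h0.1) hσ.1 α)
    exact ((traceRe 2).contDiff.contDiffAt.comp (0 : ℝ)
      (contDiffAt_const.mul e3)).differentiableAt (by simp)
  have k1 := (hasDerivAt_line1 (hU.prod hU) (contDiffOn_quasi α) (z := (0, u • pauliZ)) ⟨h0, hσ⟩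
    (pauliX, 0) (pauliX, 0)).const_mul
      (powProd 0 ((1 - α) / α) 0 u - powProd 0 0 ((1 - α) / α) u)
  have k2 := ((hasDerivAt_id (0 : ℝ)).fun_mul hd.hasDerivAt).const_mul
    (4 * α * powProd 0 ((1 - α) / α) ((1 - α) / α) u)
  have k3 := deriv_unique_of_eventually k1 k2 (by
    filter_upwards [eventually_line_mem hU h0 pauliX] with t ht
    rw [zero_add] at ht
    have e : ((0 : Tangent 2), u • pauliZ) + t • (pauliX, (0 : Tangent 2))
        = (t • pauliX, u • pauliZ) := by simp
    rw [e, fderiv_quasi_pauliX hα0 hα1 ht h1 h2]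
    rfl)
  rw [k3]
  set s := (1 - α) / (2 * α) with hs
  have h0' : h 0 = ((1 / 2 + u) ^ s * (1 / 2) * (1 / 2 + u) ^ s) ^ (α - 1)
      - ((1 / 2 - u) ^ s * (1 / 2) * (1 / 2 - u) ^ s) ^ (α - 1) := by
    simp only [hh]
    rw [zero_smul, toMatrix_zero_frame (diagFrame 2), toMatrix_pauliZ,
      sandwich_frame isHermitian_diagFrame, mpow_frame (isHermitian_diagFrame _), diagFrame_apply,
      traceRe_apply, coe_pauliZ, Matrix.trace_fin_two]
    simp [Matrix.mul_apply, Fin.sum_univ_two, sub_eq_add_neg, hs]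
  have hpw : ∀ m : ℝ, 0 < m → (m ^ s * (1 / 2) * m ^ s) ^ (α - 1) * m ^ ((1 - α) / α)
      = (1 / 2) ^ (α - 1) * m ^ (1 - α) := fun m hm => by
    have hms := Real.rpow_pos_of_pos hm s
    rw [Real.mul_rpow (by positivity) hms.le, Real.mul_rpow hms.le (by norm_num),
      ← Real.rpow_mul hm.le]
    have e : m ^ (s * (α - 1)) * (1 / 2) ^ (α - 1) * m ^ (s * (α - 1)) * m ^ ((1 - α) / α)
        = (1 / 2) ^ (α - 1) * (m ^ (s * (α - 1)) * m ^ (s * (α - 1)) * m ^ ((1 - α) / α)) := by ring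
    rw [e, ← Real.rpow_add hm, ← Real.rpow_add hm]
    congr 2
    rw [hs]; field_simp; ring
  have p1 := hpw _ h1
  have p2 := hpw _ h2
  simp only [id, one_mul, zero_mul, add_zero]
  rw [h0']
  simp only [powProd]
  linear_combination 4 * α * (1 / 2 - u) ^ ((1 - α) / α) * p1
    - 4 * α * (1 / 2 + u) ^ ((1 - α) / α) * p2

end Qubit

section Qubit

/-- The terms of first and third order at `u = 0` of the relation `d2_quasi_pauliX`. -/
theorem pauli_leibniz {α : ℝ} (hα0 : α ≠ 0) (hα1 : α ≠ 1) {b c : ℝ} (hb : b = (1 - α) / α)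
    (hc : c = 4 * α * (1 / 2 : ℝ) ^ (α - 1)) :
    (powProd 1 b 0 0 - powProd 1 0 b 0) * d2 (quasi 2 α) (0, 0) (pauliX, 0) (pauliX, 0)
      = c * (powProd 1 (1 - α) b 0 - powProd 1 b (1 - α) 0) ∧
    (powProd 3 b 0 0 - powProd 3 0 b 0) * d2 (quasi 2 α) (0, 0) (pauliX, 0) (pauliX, 0)
      + 3 * (powProd 1 b 0 0 - powProd 1 0 b 0)
        * d4 (quasi 2 α) (0, 0) (0, pauliZ) (0, pauliZ) (pauliX, 0) (pauliX, 0)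
      = c * (powProd 3 (1 - α) b 0 - powProd 3 b (1 - α) 0) := by
  have hU := isOpen_stateDomain two_ne_zero
  have hUU := hU.prod hU
  have hQ := contDiffOn_quasi (n := 2) α
  have h0 := zero_mem_stateDomain' (n := 2) two_ne_zero
  have hev : ∀ᶠ u : ℝ in 𝓝 0, 0 < 1 / 2 + u ∧ 0 < 1 / 2 - u := by
    filter_upwards [Ioo_mem_nhds (show (-(1 / 2) : ℝ) < 0 by norm_num)
      (show (0 : ℝ) < 1 / 2 by norm_num)] with u hu
    exact ⟨by linarith [hu.1], by linarith [hu.2]⟩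
  refine leibniz_ray (d := fun k u => powProd k b 0 u - powProd k 0 b u)
    (r := fun k u => c * (powProd k (1 - α) b u - powProd k b (1 - α) u))
    hUU hQ Prod.mk_zero_zero ⟨h0, h0⟩ (d3_quasi_two_zero α _ _ _)
    (hev.mono fun u hu k =>
      (hasDerivAt_powProd k b 0 hu.1 hu.2).sub (hasDerivAt_powProd k 0 b hu.1 hu.2))
    (hev.mono fun u hu k => ((hasDerivAt_powProd k (1 - α) b hu.1 hu.2).sub
      (hasDerivAt_powProd k b (1 - α) hu.1 hu.2)).const_mul c) (hev.mono fun u hu => ?_)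
    (by simp [powProd_zero_zero])
  rw [Prod.smul_mk, smul_zero, hb, hc]
  exact d2_quasi_pauliX hα0 hα1 hu.1 hu.2

/-- The relations of `pauli_leibniz`, solved for the fourth derivative `w`. -/
theorem solve_pauli_leibniz {α b c q w : ℝ} (hα0 : α ≠ 0) (hα1 : α ≠ 1) (hb : b = (1 - α) / α)
    (hc : c = 4 * α * (1 / 2 : ℝ) ^ (α - 1))
    (e1 : (powProd 1 b 0 0 - powProd 1 0 b 0) * q
      = c * (powProd 1 (1 - α) b 0 - powProd 1 b (1 - α) 0))
    (e3 : (powProd 3 b 0 0 - powProd 3 0 b 0) * q + 3 * (powProd 1 b 0 0 - powProd 1 0 b 0) * w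
      = c * (powProd 3 (1 - α) b 0 - powProd 3 b (1 - α) 0)) :
    3 * w = 16 * (α - 1) ^ 2 * (α ^ 2 + 2) := by
  simp only [powProd_one_zero, powProd_three_zero, zero_add, add_zero] at e1 e3
  have hH : (0 : ℝ) < (1 / 2) ^ b := Real.rpow_pos_of_pos (by norm_num) b
  have hc1 : c * (1 / 2 : ℝ) ^ (1 - α + b) = 4 * α * (1 / 2) ^ b := by
    rw [hc, mul_assoc, ← Real.rpow_add (by norm_num)]; congr 2; ring
  rw [add_comm b (1 - α)] at e1 e3
  have hαb : 1 - α = α * b := by rw [hb]; field_simp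
  have hb0 : b ≠ 0 := fun h => hα1 (by rw [h] at hαb; linarith)
  have hq : b * q = 4 * α * (1 - α - b) := by
    refine mul_right_cancel₀ hH.ne' ?_
    linear_combination (1 / 4) * e1 + (1 - α - b) * hc1
  have hq' : q = 4 * α * (α - 1) := by
    refine mul_left_cancel₀ hb0 ?_
    rw [hq, hαb]; ring
  have hw := mul_right_cancel₀ hH.ne' (show (16 * (b * (b - 1) * (b - 2)) * q + 12 * b * w)
      * (1 / 2) ^ b = (64 * α * ((1 - α) * (1 - α - 1) * (1 - α - 2) - 3 * (1 - α) * (1 - α - 1) * b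
        + 3 * (1 - α) * b * (b - 1) - b * (b - 1) * (b - 2))) * (1 / 2) ^ b by
    linear_combination e3 + 16 * ((1 - α) * (1 - α - 1) * (1 - α - 2)
      - 3 * (1 - α) * (1 - α - 1) * b + 3 * (1 - α) * b * (b - 1) - b * (b - 1) * (b - 2)) * hc1)
  rw [hq', hαb] at hw
  have hw' : 3 * w = 16 * α ^ 2 * ((α * b - 1) * (α * b - 2) - 3 * b * (α * b - 1)
      + 3 * b * (b - 1) - (b - 1) * (b - 2)) := by
    refine mul_left_cancel₀ hb0 ?_
    linear_combination (1 / 4) * hw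
  rw [hw', hb]
  field_simp
  ring

/-- The mixed fourth derivative along `pauliZ` and `pauliX` at the maximally mixed state. -/
theorem d4_quasi_pauli {α : ℝ} (hα0 : α ≠ 0) (hα1 : α ≠ 1) :
    3 * d4 (quasi 2 α) (0, 0) (0, pauliZ) (0, pauliZ) (pauliX, 0) (pauliX, 0)
      = 16 * (α - 1) ^ 2 * (α ^ 2 + 2) :=
  solve_pauli_leibniz hα0 hα1 rfl rfl (pauli_leibniz hα0 hα1 rfl rfl).1
    (pauli_leibniz hα0 hα1 rfl rfl).2

theorem d4_quasi_circle {α : ℝ} (hα0 : α ≠ 0) {a b : ℝ} (h : a ^ 2 + b ^ 2 = 1) :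
    d4 (quasi 2 α) (0, 0) (0, a • pauliZ + b • pauliX) (a • pauliZ + b • pauliX, 0)
      (a • pauliZ + b • pauliX, 0) (0, a • pauliZ + b • pauliX)
      = 16 * α ^ 2 * (α - 1) ^ 2 := d4_quasi_involution hα0 _ (pauli_sq h)

end Qubit

section Symmetry

variable {E : Type*} [NormedAddCommGroup E] [NormedSpace ℝ E] {Ω : Set (E × E)} {Φ : E × E → ℝ}

/-- If the fourth derivative of `Φ`, twice in each argument, is symmetric under an exchange of
directions between the arguments, then it is totally symmetric, hence determined on a plane by its
values on the unit circle when these are constant. -/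
theorem d4_mixed_of_symm (hΩ : IsOpen Ω) (h : ContDiffOn ℝ ∞ Φ Ω) {z : E × E} (hz : z ∈ Ω)
    (hs : ∀ l i j k, d4 Φ z (0, l) (i, 0) (j, 0) (0, k) = d4 Φ z (0, i) (l, 0) (j, 0) (0, k))
    {x y : E} {τ : ℝ} (hτ : ∀ a b : ℝ, a ^ 2 + b ^ 2 = 1 → d4 Φ z (0, a • x + b • y)
      (a • x + b • y, 0) (a • x + b • y, 0) (0, a • x + b • y) = τ) :
    d4 Φ z (0, x) (0, x) (y, 0) (y, 0) = τ / 3 := by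
  rw [d4_symm_mid hΩ h hz, d4_symm_right hΩ h hz]
  refine quartic_mixed (F := fun l i j k => d4 Φ z (0, l) (i, 0) (j, 0) (0, k))
    (fun a b x y i j k => ?_) hs (fun l i j k => d4_symm_mid hΩ h hz _ _ _ _)
    (fun l i j k => ?_) hτ
  · have e : ((0 : E), a • x + b • y) = a • ((0 : E), x) + b • ((0 : E), y) := by simp
    simp only [e, map_add, map_smul, add_apply, smul_apply, smul_eq_mul]
  · rw [d4_symm_left hΩ h hz, d4_symm_mid hΩ h hz, d4_symm_right hΩ h hz, d4_symm_mid hΩ h hz,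
      d4_symm_left hΩ h hz]

end Symmetry

/-! ### Curvature for `α ≠ 1` -/

section NotFlat

theorem not_isFlat_two {α : ℝ} (hα0 : α ≠ 0) (hα1 : α ≠ 1) :
    ¬ IsFlat (stateDomain 2) (eguchiConnection (stateDomain 2) (chartDiv 2 α)) := fun hflat => by
  have hα1' : α - 1 ≠ 0 := sub_ne_zero.2 hα1
  have hU := isOpen_stateDomain two_ne_zero
  have h0 := zero_mem_stateDomain' (n := 2) two_ne_zero
  obtain ⟨Γ, -, hR⟩ := (isContrast_chartDiv two_ne_zero hα0 hα1).d4_quasi_symm_of_flat hflat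
    (κ := 1 / (α * (α - 1))) (one_div_ne_zero (mul_ne_zero hα0 hα1')) (contDiffOn_quasi α)
    (fun z hz => quasi_pos two_ne_zero α hz) (fun z _ => chartDiv_eq hα1 z) h0
  simp only [d3_quasi_two_zero, sub_zero] at hR
  have h1 := d4_mixed_of_symm (hU.prod hU) (contDiffOn_quasi α) ⟨h0, h0⟩ hR
    fun a b => d4_quasi_circle (a := a) (b := b) hα0
  have h2 := d4_quasi_pauli hα0 hα1
  rw [h1] at h2
  have h3 : (α - 1) ^ 2 = 0 := by linear_combination (-1 / 32) * h2
  exact hα1' (pow_eq_zero_iff two_ne_zero |>.1 h3)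

/-- For `α ≠ 1` the connection of `D_α` is curved at the maximally mixed state. -/
theorem not_isFlat {n : ℕ} (hn : 2 ≤ n) {α : ℝ} (hα0 : α ≠ 0) (hα1 : α ≠ 1) :
    ¬ IsFlat (stateDomain n) (eguchiConnection (stateDomain n) (chartDiv n α)) := by
  rcases hn.eq_or_lt with rfl | h
  · exact not_isFlat_two hα0 hα1
  · exact not_isFlat_of_three_le h hα0 hα1

end NotFlat

end InfoGeom

end

open InfoGeom in
theorem theorem2 (n : ℕ) (hn : 2 ≤ n) (α : ℝ) (hα : α ≠ 0) :
    -- the induced structure is a dualistic structure on the state space ...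
    IsDualistic (stateDomain n)
      (renyiMetric n α) (renyiConnection n α) (renyiDualConnection n α) ∧
    -- ... whose connections satisfy the equations that define them
    (∀ X Y Z : Tangent n → Tangent n, ContDiffOn ℝ ∞ X (stateDomain n) →
      ContDiffOn ℝ ∞ Y (stateDomain n) → ContDiffOn ℝ ∞ Z (stateDomain n) →
      ∀ x ∈ stateDomain n,
        renyiMetric n α (renyiConnection n α X Y) Z x = -jetXYZ (chartDiv n α) X Y Z x ∧
        renyiMetric n α (renyiDualConnection n α X Y) Z x =
          -jetXYZ (fun q p => chartDiv n α p q) X Y Z x) ∧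
    -- it is dually flat exactly for `α = 1`
    (IsDuallyFlat (stateDomain n)
      (renyiMetric n α) (renyiConnection n α) (renyiDualConnection n α) ↔ α = 1) ∧
    -- `D_1`, the limit of `D_β` as `β → 1`, exists and is the Umegaki relative entropy
    (∀ ρ ∈ stateSpace n, ∀ σ ∈ stateSpace n,
      Tendsto (fun β => renyiDiv β ρ σ) (𝓝[≠] 1) (𝓝 (renyiDiv 1 ρ σ)) ∧
      renyiDiv 1 ρ σ = umegaki ρ σ) := by
  have hn0 : n ≠ 0 := by omega
  have hD : IsContrast (stateDomain n) (chartDiv n α) := by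
    rcases eq_or_ne α 1 with rfl | hα1
    · exact isContrast_chartDiv_one hn0
    · exact isContrast_chartDiv hn0 hα hα1
  refine ⟨hD.isDualistic, fun X Y Z hX hY hZ x hx =>
    ⟨hD.metric_connection hX hY hZ hx, hD.metric_dualConnection hX hY hZ hx⟩, ⟨fun h => ?_, ?_⟩,
    fun ρ hρ σ hσ => ⟨tendsto_renyiDiv hρ hσ, renyiDiv_one hρ hσ⟩⟩
  · by_contra hα1
    exact not_isFlat hn hα hα1 h.flat
  · rintro rfl
    exact hD.isDuallyFlat_of_d3_eq_zero fun x hx a b c => d3_chartDiv_one hn0 hx a b c
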